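/- Let $m\ge 1$. Let $SU^*(2m)$ be the group of complex $2m\times 2m$ matrices of determinant $1$ that commute with the antilinear map $(z,w)\mapsto(\bar w,-\bar z)$ of $\mathbf C^{2m}=\mathbf C^m\oplus\mathbf C^m$, and let $U^*(2m)=SU^*(2m)\cdot U(1)=\{e^{i\theta}A : \theta\in\mathbf R,\ A\in SU^*(2m)\}$. Let $M$ be a compact connected smooth manifold of real dimension $4m$ with a smooth torsion-free affine connection $\nabla$ whose holonomy group lies in $U^*(2m)$: for some point $x_0$ and some real linear isomorphism $u:T_{x_0}M\to\mathbf C^{2m}$, parallel transport around every piecewise smooth loop at $x_0$ acts on $\mathbf C^{2m}$, via $u$, as an element of $U^*(2m)$. If $m=1$, so that $U^*(2)=U(2)$ and $M$ is a Kähler surface with the metric for which $u$ is unitary, assume also that the scalar curvature vanishes. Multiplication by $i$ on $\mathbf C^{2m}$ induces, by parallel transport, an integrable complex structure $I$ on $M$. Let $K=\Lambda^{2m,0}T^*M$ be the canonical bundle of $(M,I)$, and let $\rho(X,Y)=i\,\mathrm{tr}_{\mathbf C}R(X,Y)$ be the Ricci form, where $R$ is the curvature of $\nabla$; thus $\rho$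 is $i$ times the curvature of the connection induced by $\nabla$ on $K^*=\Lambda^{2m}T^{1,0}$. Then either $\rho$ vanishes identically on $M$, or $\dim_{\mathbf C}H^0(M,K^N)=0$ for every integer $N\neq 0$. In particular, all the plurigenera ($N\ge 1$) vanish unless $\rho\equiv 0$, and the same holds for the negative powers of $K$. -/

import Mathlib

open scoped Manifold ContDiff
open Bundle VectorField

noncomputable section

/-! ## The group `U*(2m) = SL(m,ℍ)·U(1)` -/

/-- `ℂ^{2m}`, with coordinates `(z₁,…,z_m,w₁,…,w_m)`. -/
abbrev C2 (m : ℕ) : Type := Fin m ⊕ Fin m → ℂ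

/-- The antilinear map `(z, w) ↦ (w̄, -z̄)` of `ℂ^{2m}`. -/
def quatMap (m : ℕ) (v : C2 m) : C2 m :=
  Sum.elim (fun i => starRingEnd ℂ (v (Sum.inr i))) (fun i => -starRingEnd ℂ (v (Sum.inl i)))

/-- `SU*(2m)`: complex matrices of determinant `1` commuting with `quatMap`. -/
def SUStar (m : ℕ) : Set (Matrix (Fin m ⊕ Fin m) (Fin m ⊕ Fin m) ℂ) :=
  {A | A.det = 1 ∧ ∀ v, A.mulVec (quatMap m v) = quatMap m (A.mulVec v)}

/-- `U*(2m) = SU*(2m)·U(1)`. -/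
def UStar (m : ℕ) : Set (Matrix (Fin m ⊕ Fin m) (Fin m ⊕ Fin m) ℂ) :=
  {B | ∃ A ∈ SUStar m, ∃ c : ℂ, ‖c‖ = 1 ∧ B = c • A}

section Geometry

variable {E : Type*} [NormedAddCommGroup E] [NormedSpace ℝ E]
  {M : Type*} [TopologicalSpace M] [ChartedSpace E M] [IsManifold 𝓘(ℝ, E) ∞ M]

/-! ## Parallel transport and holonomy -/

/-- `V`, a vector field along the curve `γ`, is parallel. Near `γ t` one writes `V = ∑ cⁱ eᵢ` in
the frame `eᵢ` that is constant in the tangent bundle trivialization of the chart at `γ t`;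
the equation is `∑ (dcⁱ/dt) eᵢ + cⁱ ∇_{γ'} eᵢ = 0` at time `t`. -/
def IsParallelAlong
    (cov : CovariantDerivative 𝓘(ℝ, E) E (TangentSpace 𝓘(ℝ, E) : M → Type _))
    (γ : ℝ → M) (V : ∀ t, TangentSpace 𝓘(ℝ, E) (γ t)) : Prop :=
  ∀ t : ℝ,
    let e := trivializationAt E (TangentSpace 𝓘(ℝ, E) : M → Type _) (γ t)
    let W : ∀ y : M, TangentSpace 𝓘(ℝ, E) y := fun y => e.symm y (e ⟨γ t, V t⟩).2
    HasDerivAt (fun r => (e ⟨γ r, V r⟩).2)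
      (-(e ⟨γ t, cov W (γ t) (mfderiv 𝓘(ℝ, ℝ) 𝓘(ℝ, E) γ t (1 : ℝ))⟩).2) t

/-- `P : T_x M → T_y M` is the parallel transport along some piecewise smooth curve from `x`
to `y`, i.e. a composition of parallel transports along smooth curves. -/
inductive IsParallelTransport
    (cov : CovariantDerivative 𝓘(ℝ, E) E (TangentSpace 𝓘(ℝ, E) : M → Type _)) :
    (x y : M) → (TangentSpace 𝓘(ℝ, E) x ≃L[ℝ] TangentSpace 𝓘(ℝ, E) y) → Prop
  | curve (γ : ℝ → M) (hγ : ContMDiff 𝓘(ℝ, ℝ) 𝓘(ℝ, E) ∞ γ)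
      (P : TangentSpace 𝓘(ℝ, E) (γ 0) ≃L[ℝ] TangentSpace 𝓘(ℝ, E) (γ 1))
      (hP : ∀ v, ∃ V : ∀ t, TangentSpace 𝓘(ℝ, E) (γ t),
        IsParallelAlong cov γ V ∧ V 0 = v ∧ V 1 = P v) :
      IsParallelTransport cov (γ 0) (γ 1) P
  | trans {x y z : M}
      {P : TangentSpace 𝓘(ℝ, E) x ≃L[ℝ] TangentSpace 𝓘(ℝ, E) y}
      {Q : TangentSpace 𝓘(ℝ, E) y ≃L[ℝ] TangentSpace 𝓘(ℝ, E) z}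
      (hP : IsParallelTransport cov x y P) (hQ : IsParallelTransport cov y z Q) :
      IsParallelTransport cov x z (P.trans Q)

/-- The holonomy group at `x₀`: parallel transports along piecewise smooth loops. -/
def holonomyGroup
    (cov : CovariantDerivative 𝓘(ℝ, E) E (TangentSpace 𝓘(ℝ, E) : M → Type _)) (x₀ : M) :
    Set (TangentSpace 𝓘(ℝ, E) x₀ ≃L[ℝ] TangentSpace 𝓘(ℝ, E) x₀) :=
  {P | IsParallelTransport cov x₀ x₀ P}

/-- The holonomy group at `x₀` lies in `U*(2m)`, when `T_{x₀} M` is identified with `ℂ^{2m}`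
by the frame `u`. -/
def HolonomyInUStar {m : ℕ}
    (cov : CovariantDerivative 𝓘(ℝ, E) E (TangentSpace 𝓘(ℝ, E) : M → Type _)) (x₀ : M)
    (u : TangentSpace 𝓘(ℝ, E) x₀ ≃L[ℝ] C2 m) : Prop :=
  ∀ P ∈ holonomyGroup cov x₀, ∃ B ∈ UStar m, ∀ v, u (P v) = B.mulVec (u v)

open Classical in
/-- A frame at `x` obtained from the frame `u` at `x₀` by parallel transport along some curve
from `x₀` to `x`. If the holonomy at `x₀` lies in `U*(2m)`, it is unique up to `U*(2m)`.
(The value `u` in the `else` branch is never used on a connected manifold.) -/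
def adaptedFrame {m : ℕ}
    (cov : CovariantDerivative 𝓘(ℝ, E) E (TangentSpace 𝓘(ℝ, E) : M → Type _)) (x₀ : M)
    (u : TangentSpace 𝓘(ℝ, E) x₀ ≃L[ℝ] C2 m) (x : M) :
    TangentSpace 𝓘(ℝ, E) x ≃L[ℝ] C2 m :=
  if h : ∃ P, IsParallelTransport cov x₀ x P then h.choose.symm.trans u else u

/-- Multiplication by `i` on `ℂ^{2m}`, as a real linear map. -/
def mulI (m : ℕ) : C2 m →L[ℝ] C2 m := (Complex.I • ContinuousLinearMap.id ℂ (C2 m)).restrictScalars ℝ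

/-- The parallel complex structure on `M` induced by multiplication by `i` in the frame `u`. -/
def complexStructure {m : ℕ}
    (cov : CovariantDerivative 𝓘(ℝ, E) E (TangentSpace 𝓘(ℝ, E) : M → Type _)) (x₀ : M)
    (u : TangentSpace 𝓘(ℝ, E) x₀ ≃L[ℝ] C2 m) (x : M) :
    TangentSpace 𝓘(ℝ, E) x →L[ℝ] TangentSpace 𝓘(ℝ, E) x :=
  let w := adaptedFrame cov x₀ u x
  (w.symm : C2 m →L[ℝ] TangentSpace 𝓘(ℝ, E) x) ∘L mulI m ∘L
    (w : TangentSpace 𝓘(ℝ, E) x →L[ℝ] C2 m)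

/-! ## Curvature -/

/-- `∇_X ∇_Y Z - ∇_Y ∇_X Z - ∇_{[X,Y]} Z` at `x`. -/
def curvatureFields
    (cov : CovariantDerivative 𝓘(ℝ, E) E (TangentSpace 𝓘(ℝ, E) : M → Type _))
    (X Y Z : ∀ y : M, TangentSpace 𝓘(ℝ, E) y) (x : M) : TangentSpace 𝓘(ℝ, E) x :=
  cov (fun y => cov Z y (Y y)) x (X x) - cov (fun y => cov Z y (X y)) x (Y x)
    - cov Z x (mlieBracket 𝓘(ℝ, E) X Y x)

/-- The curvature tensor `R(X,Y)Z` at `x`, computed with local smooth extensions of the three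
vectors. -/
def curvature
    (cov : CovariantDerivative 𝓘(ℝ, E) E (TangentSpace 𝓘(ℝ, E) : M → Type _)) (x : M)
    (X Y Z : TangentSpace 𝓘(ℝ, E) x) : TangentSpace 𝓘(ℝ, E) x :=
  curvatureFields cov (FiberBundle.extend E X) (FiberBundle.extend E Y)
    (FiberBundle.extend E Z) x

/-- The Ricci form: `i` times the curvature `tr_ℂ R(X,Y)` of the connection induced on the
anticanonical bundle `K* = Λ^{2m} T^{1,0}`. The trace is computed in an adapted complex frame. -/
def ricciForm {m : ℕ}
    (cov : CovariantDerivative 𝓘(ℝ, E) E (TangentSpace 𝓘(ℝ, E) : M → Type _)) (x₀ : M)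
    (u : TangentSpace 𝓘(ℝ, E) x₀ ≃L[ℝ] C2 m) (x : M) (X Y : TangentSpace 𝓘(ℝ, E) x) : ℂ :=
  let w := adaptedFrame cov x₀ u x
  Complex.I * ∑ k, w (curvature cov x X Y (w.symm (Pi.single k 1))) k

/-- The scalar curvature `∑_{p,q} g(R(e_p,e_q)e_q, e_p)` of the metric `g` for which the adapted
frame is unitary. The basis `e` consists of the vectors corresponding to the standard real
orthonormal basis of `ℂ^{2m}`. For `m = 1` one has `U*(2) = U(2)`, so that `g` is parallel;
only this case is used. -/
def scalarCurvature {m : ℕ}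
    (cov : CovariantDerivative 𝓘(ℝ, E) E (TangentSpace 𝓘(ℝ, E) : M → Type _)) (x₀ : M)
    (u : TangentSpace 𝓘(ℝ, E) x₀ ≃L[ℝ] C2 m) (x : M) : ℝ :=
  let w := adaptedFrame cov x₀ u x
  let c : Fin 2 → ℂ := ![1, Complex.I]
  let e : (Fin m ⊕ Fin m) × Fin 2 → TangentSpace 𝓘(ℝ, E) x :=
    fun p => w.symm (Pi.single p.1 (c p.2))
  ∑ p, ∑ q, (starRingEnd ℂ (c p.2) * w (curvature cov x (e p) (e q) (e q)) p.1).re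

/-! ## Holomorphic sections of powers of the canonical bundle

Here `J` is an (integrable) almost complex structure on `M`. -/

/-- The family `v·A`, with `(v·A)_j = ∑ᵢ A_{ij} vᵢ`, where `i` acts as the endomorphism `J`. -/
def complexComb {m : ℕ} {x : M}
    (J : TangentSpace 𝓘(ℝ, E) x →L[ℝ] TangentSpace 𝓘(ℝ, E) x)
    (v : Fin m ⊕ Fin m → TangentSpace 𝓘(ℝ, E) x)
    (A : Matrix (Fin m ⊕ Fin m) (Fin m ⊕ Fin m) ℂ) (j : Fin m ⊕ Fin m) :
    TangentSpace 𝓘(ℝ, E) x :=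
  ∑ i, ((A i j).re • v i + (A i j).im • J (v i))

/-- `v` is a complex basis of `(T_x M, J)`. -/
def IsComplexFrame {m : ℕ} {x : M}
    (J : TangentSpace 𝓘(ℝ, E) x →L[ℝ] TangentSpace 𝓘(ℝ, E) x)
    (v : Fin m ⊕ Fin m → TangentSpace 𝓘(ℝ, E) x) : Prop :=
  LinearIndependent ℝ (Sum.elim v (fun k => J (v k))) ∧
    Submodule.span ℝ (Set.range (Sum.elim v (fun k => J (v k)))) = ⊤

/-- `Y` is a smooth local frame of the complex vector bundle `(TM, J)` over the open set `U`. -/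
structure IsSmoothComplexFrameOn {m : ℕ}
    (J : ∀ x : M, TangentSpace 𝓘(ℝ, E) x →L[ℝ] TangentSpace 𝓘(ℝ, E) x)
    (Y : Fin m ⊕ Fin m → ∀ y : M, TangentSpace 𝓘(ℝ, E) y) (U : Set M) : Prop where
  isOpen : IsOpen U
  smooth : ∀ k, ContMDiffOn 𝓘(ℝ, E) (𝓘(ℝ, E).prod 𝓘(ℝ, E)) ∞
    (fun y => (⟨y, Y k y⟩ : TangentBundle 𝓘(ℝ, E) M)) U
  frame : ∀ y ∈ U, IsComplexFrame (J y) (fun k => Y k y)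

/-- The Dolbeault operator of the tangent bundle, `∂̄_X Y = ½([X,Y] + J[JX,Y])`. -/
def dbarField (J : ∀ x : M, TangentSpace 𝓘(ℝ, E) x →L[ℝ] TangentSpace 𝓘(ℝ, E) x)
    (X Y : ∀ y : M, TangentSpace 𝓘(ℝ, E) y) (x : M) : TangentSpace 𝓘(ℝ, E) x :=
  (2⁻¹ : ℝ) • (mlieBracket 𝓘(ℝ, E) X Y x
    + J x (mlieBracket 𝓘(ℝ, E) (fun y => J y (X y)) Y x))

/-- The Dolbeault operator on functions, `∂̄_X f = ½(df(X) + i df(JX))`. -/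
def dbarFun (J : ∀ x : M, TangentSpace 𝓘(ℝ, E) x →L[ℝ] TangentSpace 𝓘(ℝ, E) x)
    (X : ∀ y : M, TangentSpace 𝓘(ℝ, E) y) (f : M → ℂ) (x : M) : ℂ :=
  2⁻¹ * (mvfderiv 𝓘(ℝ, E) f x (X x) + Complex.I * mvfderiv 𝓘(ℝ, E) f x (J x (X x)))

/-- A holomorphic section of `K^N`, `N ∈ ℤ`, where `K = Λ^{2m,0}` is the canonical bundle.
An element of the fibre of `K^N` at `x` is a function on the complex frames of `T_x M` with
`s(v·A) = det(A)^N s(v)` (extended by `0` to the families that are not frames). The section is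
smooth if its value on every smooth local frame `Y` is. It is holomorphic if `∂̄ s = 0`, that is:
if `∂̄_X Y = Y·B` at a point then `∂̄_X (s(Y)) = N tr(B) s(Y)` there. -/
structure IsHolomorphicSection {m : ℕ}
    (J : ∀ x : M, TangentSpace 𝓘(ℝ, E) x →L[ℝ] TangentSpace 𝓘(ℝ, E) x) (N : ℤ)
    (s : ∀ x : M, (Fin m ⊕ Fin m → TangentSpace 𝓘(ℝ, E) x) → ℂ) : Prop where
  off_frames : ∀ x v, ¬ IsComplexFrame (J x) v → s x v = 0
  equivariant : ∀ x v A, IsComplexFrame (J x) v → IsComplexFrame (J x) (complexComb (J x) v A) →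
    s x (complexComb (J x) v A) = A.det ^ N * s x v
  smooth : ∀ Y U, IsSmoothComplexFrameOn J Y U →
    ContMDiffOn 𝓘(ℝ, E) 𝓘(ℝ, ℂ) ∞ (fun y => s y (fun k => Y k y)) U
  dbar_eq_zero : ∀ Y U, IsSmoothComplexFrameOn J Y U →
    ∀ X : ∀ y : M, TangentSpace 𝓘(ℝ, E) y,
    ContMDiffOn 𝓘(ℝ, E) (𝓘(ℝ, E).prod 𝓘(ℝ, E)) ∞
      (fun y => (⟨y, X y⟩ : TangentBundle 𝓘(ℝ, E) M)) U →
    ∀ x ∈ U, ∀ B : Matrix (Fin m ⊕ Fin m) (Fin m ⊕ Fin m) ℂ,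
      (∀ j, dbarField J X (Y j) x = complexComb (J x) (fun k => Y k x) B j) →
      dbarFun J X (fun y => s y (fun k => Y k y)) x
        = N * B.trace * s x (fun k => Y k x)

/-- The complex vector space `H⁰(M, K^N)` of holomorphic sections of `K^N`. -/
def holomorphicSections (m : ℕ)
    (J : ∀ x : M, TangentSpace 𝓘(ℝ, E) x →L[ℝ] TangentSpace 𝓘(ℝ, E) x) (N : ℤ) :
    Submodule ℂ (∀ x : M, (Fin m ⊕ Fin m → TangentSpace 𝓘(ℝ, E) x) → ℂ) where
  carrier := {s | IsHolomorphicSection J N s}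
  add_mem' := by
    intro s t hs ht
    refine ⟨fun x v hv => ?_, fun x v A hv hw => ?_, fun Y U hY => ?_, ?_⟩
    · simp [hs.off_frames x v hv, ht.off_frames x v hv]
    · simp [hs.equivariant x v A hv hw, ht.equivariant x v A hv hw, mul_add]
    · exact (hs.smooth Y U hY).add (ht.smooth Y U hY)
    · intro Y U hY X hX x hx B hB
      have hU := hY.isOpen.mem_nhds hx
      have h1 := ((hs.smooth Y U hY).contMDiffAt hU).mdifferentiableAt (by simp)
      have h2 := ((ht.smooth Y U hY).contMDiffAt hU).mdifferentiableAt (by simp)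
      have e1 := hs.dbar_eq_zero Y U hY X hX x hx B hB
      have e2 := ht.dbar_eq_zero Y U hY X hX x hx B hB
      have h5 : mvfderiv 𝓘(ℝ, E) (fun y => (s + t) y (fun k => Y k y)) x
          = mvfderiv 𝓘(ℝ, E) (fun y => s y (fun k => Y k y)) x
          + mvfderiv 𝓘(ℝ, E) (fun y => t y (fun k => Y k y)) x := mvfderiv_add h1 h2
      have h6 : (s + t) x (fun k => Y k x) = s x (fun k => Y k x) + t x (fun k => Y k x) := rfl
      unfold dbarFun at e1 e2 ⊢
      rw [h5, h6, add_apply, add_apply]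
      linear_combination e1 + e2
  zero_mem' := by
    refine ⟨fun x v hv => rfl, fun x v A hv hw => by simp, fun Y U hY => contMDiffOn_const, ?_⟩
    intro Y U hY X hX x hx B hB
    have h : (fun y => (0 : ∀ x : M, (Fin m ⊕ Fin m → TangentSpace 𝓘(ℝ, E) x) → ℂ) y
      (fun k => Y k y)) = fun _ => (0 : ℂ) := rfl
    unfold dbarFun
    rw [h, mvfderiv_const]
    simp
  smul_mem' := by
    intro c s hs
    refine ⟨fun x v hv => ?_, fun x v A hv hw => ?_, fun Y U hY => ?_, ?_⟩
    · simp [hs.off_frames x v hv]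
    · simp [hs.equivariant x v A hv hw, mul_left_comm]
    · exact ((c • ContinuousLinearMap.id ℝ ℂ).contMDiff).comp_contMDiffOn (hs.smooth Y U hY)
    · intro Y U hY X hX x hx B hB
      have hU := hY.isOpen.mem_nhds hx
      have h1 := ((hs.smooth Y U hY).contMDiffAt hU).mdifferentiableAt (by simp)
      have e1 := hs.dbar_eq_zero Y U hY X hX x hx B hB
      have h3 := (((c • ContinuousLinearMap.id ℝ ℂ).hasMFDerivAt).comp x h1.hasMFDerivAt).mfderiv
      have h5 : ∀ v, mvfderiv 𝓘(ℝ, E) (fun y => (c • s) y (fun k => Y k y)) x v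
          = c * mvfderiv 𝓘(ℝ, E) (fun y => s y (fun k => Y k y)) x v :=
        fun v => congrArg (fun L => L v) h3
      have h6 : (c • s) x (fun k => Y k x) = c * s x (fun k => Y k x) := rfl
      unfold dbarFun at e1 ⊢
      rw [h5, h5, h6]
      linear_combination c * e1

/-- The dimension of `H⁰(M, K^N)`: the `N`-th plurigenus for `N ≥ 1`. -/
def plurigenus (m : ℕ)
    (J : ∀ x : M, TangentSpace 𝓘(ℝ, E) x →L[ℝ] TangentSpace 𝓘(ℝ, E) x) (N : ℤ) : Cardinal :=
  Module.rank ℂ (holomorphicSections m J N)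

end Geometry

end

/-! Elements of `U*(2m)` have complex determinant of modulus one. Hence a section `s` of `K^N` has a
parallel norm `|s|` (`sectionNorm`), computed in frames carried from `x₀` by parallel transport.
Where `s ≠ 0`, put `f = log |s|²`. If `s` is holomorphic, the usual relation between `∂∂̄ log |s|²`
and the curvature of `K^N` becomes, for the torsion-free connection, `∇df(v,v) + ∇df(Iv,Iv) = N
(Ric(v,v) + Ric(Iv,Iv))` (`hessian_sectionPotential`, `hessian_add_hessian_frameI`).

The curvature takes values in `𝔰𝔩(m,ℍ) ⊕ 𝔲(1)`: it commutes with `I`, has real trace zero, and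
`[R,J]` is a multiple of `K = IJ`. With the first Bianchi identity this forces `Ric(Jv,Jv) =
-Ric(v,v)` when `m ≥ 2`, so the sum of `Ric` over `v, Iv, Jv, Kv` vanishes
(`IsQuaternionicCurvature.ricciTrace_average`). When `m = 1` that sum is a multiple of the scalar
curvature, which is zero by assumption. So the Hessian of `f` has trace zero on every quaternionic
line.

In general there is no parallel metric, hence no Laplacian at hand. Hopf's argument does not need
one: at the decisive point it uses a single quaternionic line, the one containing the direction `q -
c` from the centre of the barrier (`eventually_eq_of_isMax`). By compactness `|s|` attains its
maximum. The strong maximum principle and connectedness make `|s|` a nonzero constant if `s ≠ 0`.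
Then `df = 0`, and the skew part of the Hessian identity gives `N tr(I R) = 0`. Since also `tr R =
0`, the complex trace of `R` vanishes and `ρ = 0`.

The difficulty is regularity: the adapted frames are chosen point by point, without continuity, and
`J` is determined only up to rotation towards `K`. Three quantities are independent of the choice:
`I`, the operator `Q(S) = JSJ + KSK` (`frameQ`) and the volume density (`frameDensity`). Each solves
a linear equation along every line of a chart, which already implies smoothness
(`contDiffOn_of_lineDeriv`), and each is annihilated by the curvature (`curvature_apply_parallel`).
This yields the algebraic type of the curvature (`isQuaternionicCurvature`) without any theory of
the holonomy algebra. Sections are made into functions by a smooth complex frame, or gauge, of the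
tangent bundle (`exists_isComplexGauge`). -/

noncomputable section

set_option maxSynthPendingDepth 3

/-! ### Calculus: fields parallel along lines, linear equations, derivative of the determinant -/

section Calculus

open Set Filter Topology

variable {E : Type*} [NormedAddCommGroup E] [NormedSpace ℝ E]
  {F : Type*} [NormedAddCommGroup F] [NormedSpace ℝ F]

/-- A function whose derivative along every line is given by a continuous linear expression in its
value is Fréchet differentiable. -/
theorem hasFDerivAt_of_lineDeriv {Ω : Set E} (hΩ : IsOpen Ω) {L : E → E →L[ℝ] F →L[ℝ] F}
    (hL : ContinuousOn L Ω) {S : E → F}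
    (h : ∀ p ∈ Ω, ∀ v, HasDerivAt (fun s : ℝ => S (p + s • v)) (L p v (S p)) 0)
    {p : E} (hp : p ∈ Ω) : HasFDerivAt S ((L p).flip (S p)) p := by
  set C : ℝ := ‖L p‖ + 1 with hC
  have hC0 : 0 < C := by positivity
  have hLp : ContinuousAt L p := hL.continuousAt (hΩ.mem_nhds hp)
  set K : ℝ := ‖S p‖ * Real.exp C + 1 with hK
  have hK0 : 0 < K := by positivity
  rw [hasFDerivAt_iff_isLittleO_nhds_zero, Asymptotics.isLittleO_iff]
  intro ε hε
  -- The derivative of `S` along a segment deviates from `L p v (S p)` by two errors: the variation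
  -- of `L`, at most `η K ‖v‖`, and the variation of `S`, at most `C² K ‖v‖²`. The choices of `η`
  -- and `δ` make each at most `ε ‖v‖ / 2`.
  set η : ℝ := min 1 (ε / (2 * K)) with hη
  have hη0 : 0 < η := by positivity
  have h0 : ContinuousAt (fun q => ‖L q - L p‖) p := by
    have hs : ContinuousAt (fun q => L q - L p) p := hLp.sub continuousAt_const
    exact hs.norm
  have h1 : ∀ᶠ q in 𝓝 p, q ∈ Ω ∧ ‖L q - L p‖ < η :=
    (show ∀ᶠ q in 𝓝 p, q ∈ Ω from hΩ.mem_nhds hp).and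
      (h0.eventually_lt continuousAt_const (by simpa using hη0))
  obtain ⟨r, hr, hball⟩ := Metric.eventually_nhds_iff_ball.1 h1
  set δ : ℝ := min (min r 1) (ε / (2 * (C * C * K))) with hδ
  have hδ0 : 0 < δ := by positivity
  filter_upwards [Metric.ball_mem_nhds (0 : E) hδ0] with v hv
  have hvn : ‖v‖ < δ := by simpa using hv
  have hv1 : ‖v‖ ≤ 1 := hvn.le.trans ((min_le_left _ _).trans (min_le_right _ _))
  have hvr : ‖v‖ < r := hvn.trans_le ((min_le_left _ _).trans (min_le_left _ _))
  have hvε : ‖v‖ * (C * C * K) ≤ ε / 2 := by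
    have := hvn.le.trans (min_le_right _ _)
    rw [le_div_iff₀ (by positivity)] at this
    linarith
  have hmem : ∀ s ∈ Icc (0 : ℝ) 1, p + s • v ∈ Metric.ball p r := by
    intro s hs
    rw [Metric.mem_ball, dist_eq_norm]
    simp only [add_sub_cancel_left, norm_smul, Real.norm_eq_abs, abs_of_nonneg hs.1]
    nlinarith [hs.2, norm_nonneg v]
  have hLC : ∀ s ∈ Icc (0 : ℝ) 1, ‖L (p + s • v)‖ ≤ C := by
    intro s hs
    have h2 := (hball _ (hmem s hs)).2
    have h3 := norm_sub_norm_le (L (p + s • v)) (L p)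
    have : η ≤ 1 := min_le_left _ _
    linarith
  set g : ℝ → F := fun s => S (p + s • v) with hg
  have hgd : ∀ s ∈ Icc (0 : ℝ) 1, HasDerivAt g (L (p + s • v) v (g s)) s := by
    intro s hs
    have h2 := h _ (hball _ (hmem s hs)).1 v
    have h3 : HasDerivAt (fun x : ℝ => x - s) 1 s := (hasDerivAt_id s).sub_const s
    have h5 := HasDerivAt.scomp s (h := fun x : ℝ => x - s)
      (g₁ := fun t : ℝ => S ((p + s • v) + t • v)) (by simpa using h2) h3
    rw [one_smul] at h5
    refine h5.congr_of_eventuallyEq (Eventually.of_forall fun x => ?_)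
    simp only [hg, Function.comp]
    congr 1
    module
  -- Grönwall bounds `S` on all short segments from `p` at once. This uniformity replaces the
  -- continuity of `S`, which is not assumed.
  have hgK : ∀ s ∈ Icc (0 : ℝ) 1, ‖g s‖ ≤ K := by
    intro s hs
    have := norm_le_gronwallBound_of_norm_deriv_right_le (f := g)
      (f' := fun s => L (p + s • v) v (g s)) (δ := ‖S p‖) (K := C) (ε := 0) (a := 0) (b := 1)
      (fun s hs => (hgd s hs).continuousAt.continuousWithinAt)
      (fun s hs => (hgd s (Ico_subset_Icc_self hs)).hasDerivWithinAt) (by simp [hg])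
      (fun s hs => by
        rw [add_zero]
        refine (ContinuousLinearMap.le_opNorm _ _).trans ?_
        gcongr
        refine (ContinuousLinearMap.le_opNorm _ _).trans ?_
        have := hLC s (Ico_subset_Icc_self hs)
        nlinarith [norm_nonneg v, norm_nonneg (L (p + s • v))]) s hs
    rw [gronwallBound_ε0, sub_zero] at this
    have h2 : Real.exp (C * s) ≤ Real.exp C := Real.exp_le_exp.2 (by nlinarith [hs.2])
    have := mul_le_mul_of_nonneg_left h2 (norm_nonneg (S p))
    linarith
  have hgS : ∀ s ∈ Icc (0 : ℝ) 1, ‖g s - S p‖ ≤ C * ‖v‖ * K := by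
    intro s hs
    have := norm_image_sub_le_of_norm_deriv_le_segment' (f := g)
      (f' := fun s => L (p + s • v) v (g s)) (C := C * ‖v‖ * K) (a := 0) (b := 1)
      (fun s hs => (hgd s hs).hasDerivWithinAt)
      (fun s hs => by
        refine (ContinuousLinearMap.le_of_opNorm₂_le_of_le _ (hLC s (Ico_subset_Icc_self hs))
          le_rfl (hgK s (Ico_subset_Icc_self hs)))) s hs
    have h0 : g 0 = S p := by simp [hg]
    rw [h0] at this
    have h3 : 0 ≤ C * ‖v‖ * K := by positivity
    nlinarith [hs.2, hs.1]
  have key := norm_image_sub_le_of_norm_deriv_le_segment' (f := fun s => g s - s • (L p v (S p)))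
      (f' := fun s => L (p + s • v) v (g s) - L p v (S p)) (C := ε * ‖v‖) (a := 0) (b := 1)
      (fun s hs => by
        have := (hgd s hs).sub ((hasDerivAt_id s).smul_const (L p v (S p)))
        rw [one_smul] at this
        exact this.hasDerivWithinAt)
      (fun s hs => by
        have hs' := Ico_subset_Icc_self hs
        have e : L (p + s • v) v (g s) - L p v (S p)
            = (L (p + s • v) - L p) v (g s) + L p v (g s - S p) := by simp
        have h2 : ‖L (p + s • v) - L p‖ ≤ η := (hball _ (hmem s hs')).2.le
        have h3 : ‖(L (p + s • v) - L p) v (g s)‖ ≤ η * ‖v‖ * K :=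
          ContinuousLinearMap.le_of_opNorm₂_le_of_le _ h2 le_rfl (hgK s hs')
        have h4 : ‖L p v (g s - S p)‖ ≤ C * ‖v‖ * (C * ‖v‖ * K) :=
          ContinuousLinearMap.le_of_opNorm₂_le_of_le _ (by linarith) le_rfl (hgS s hs')
        have h5 : η * K ≤ ε / 2 := by
          have : η ≤ ε / (2 * K) := min_le_right _ _
          rw [le_div_iff₀ (by positivity)] at this
          linarith
        rw [e]
        refine (norm_add_le _ _).trans ?_
        nlinarith [norm_nonneg v]) 1 (by simp)
  simpa [hg, sub_right_comm] using key

/-- A field that is parallel along every line, for a smooth connection, is smooth. -/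
theorem contDiffOn_of_lineDeriv {Ω : Set E} (hΩ : IsOpen Ω) {L : E → E →L[ℝ] F →L[ℝ] F}
    (hL : ContDiffOn ℝ ∞ L Ω) {S : E → F}
    (h : ∀ p ∈ Ω, ∀ v, HasDerivAt (fun s : ℝ => S (p + s • v)) (L p v (S p)) 0) :
    ContDiffOn ℝ ∞ S Ω := by
  have hd : ∀ p ∈ Ω, HasFDerivAt S ((L p).flip (S p)) p :=
    fun p hp => hasFDerivAt_of_lineDeriv hΩ hL.continuousOn h hp
  rw [contDiffOn_infty]
  intro n
  -- Bootstrap: the derivative of `S` is bilinear in `L` and `S`, so it is as smooth as `S` is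
  -- already known to be.
  induction n with
  | zero =>
    exact contDiffOn_zero.2 fun p hp => (hd p hp).continuousAt.continuousWithinAt
  | succ n ih =>
    push_cast
    rw [contDiffOn_succ_iff_fderiv_of_isOpen hΩ]
    refine ⟨fun p hp => (hd p hp).differentiableAt.differentiableWithinAt, by simp, ?_⟩
    have h1 : ContDiffOn ℝ n L Ω := hL.of_le (by exact_mod_cast le_top)
    have h2 : ContDiffOn ℝ n (fun p => (L p).flip (S p)) Ω := by
      have h3 : ContDiffOn ℝ n (fun p => ContinuousLinearMap.apply ℝ F (S p)) Ω :=
        contDiffOn_const.clm_apply ih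
      exact h3.clm_comp h1
    exact h2.congr fun p hp => (hd p hp).fderiv

/-- Existence of solutions of a linear equation with small coefficients. -/
theorem exists_linear_ode_solution [CompleteSpace F] {A : ℝ → F →L[ℝ] F}
    (hA : ContinuousOn A (Icc (-2) 2)) (hb : ∀ t ∈ Icc (-2 : ℝ) 2, ‖A t‖ ≤ 1 / 8) (x₀ : F) :
    ∃ x : ℝ → F, x 0 = x₀ ∧ ∀ t ∈ Ioo (-2 : ℝ) 2, HasDerivAt x (A t (x t)) t := by
  -- In the ball of radius `‖x₀‖` about `x₀` the speed is at most `2‖x₀‖/8`. In time `2` the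
  -- solution moves at most `‖x₀‖/2` and stays in the ball.
  have hpl : IsPicardLindelof (fun t x => A t x) (tmin := -2) (tmax := 2) ⟨0, by simp⟩ x₀
      ‖x₀‖₊ 0 (‖x₀‖₊ / 4) (1 / 8) := by
    refine ⟨fun t ht => ?_, fun x _ => ?_, fun t ht x hx => ?_, ?_⟩
    · refine ((A t).lipschitz.weaken ?_).lipschitzOnWith
      exact hb t ht
    · exact hA.clm_apply continuousOn_const
    · refine (ContinuousLinearMap.le_of_opNorm_le_of_le _ (hb t ht)
        (b := 2 * ‖x₀‖) ?_).trans (le_of_eq ?_)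
      · have := norm_le_norm_add_norm_sub' x x₀
        rw [mem_closedBall_iff_norm] at hx
        simp only [coe_nnnorm] at hx
        linarith
      · push_cast; ring
    · push_cast
      norm_num
      nlinarith [norm_nonneg x₀]
  obtain ⟨x, hx0, hx⟩ := hpl.exists_eq_forall_mem_Icc_hasDerivWithinAt₀
  exact ⟨x, hx0, fun t ht => (hx t (Ioo_subset_Icc_self ht)).hasDerivAt (Icc_mem_nhds ht.1 ht.2)⟩

section Det

/-- The determinant is polynomial, hence differentiable. Its derivative is read off along the lines
`1 + rA`, where `det (1 + rA) = 1 + r tr A + O(r²)`. -/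
theorem Matrix.hasFDerivAt_det_one {ι : Type*} [Fintype ι] [DecidableEq ι] :
    ∃ D : (ι → ι → ℝ) →L[ℝ] ℝ, HasFDerivAt (fun A : ι → ι → ℝ => (Matrix.of A).det) D
      (Matrix.of.symm (1 : Matrix ι ι ℝ)) ∧ ∀ A, D A = (Matrix.of A).trace := by
  have hd : Differentiable ℝ (fun A : ι → ι → ℝ => (Matrix.of A).det) := by
    simp only [Matrix.det_apply, Matrix.of_apply]
    fun_prop
  refine ⟨_, (hd _).hasFDerivAt, fun A => ?_⟩
  set q : ℝ → (ι → ι → ℝ) := fun r => Matrix.of.symm (1 : Matrix ι ι ℝ) + r • A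
  have h1 : HasDerivAt q A 0 := by
    have := ((hasDerivAt_id (0 : ℝ)).smul_const A).const_add (Matrix.of.symm (1 : Matrix ι ι ℝ))
    rw [one_smul] at this
    exact this
  have h2 := ((hd (q 0)).hasFDerivAt.comp_hasDerivAt (0 : ℝ) h1)
  have h3 : HasDerivAt (fun r : ℝ => (Matrix.of (q r)).det) (Matrix.of A).trace 0 := by
    have e : (fun r : ℝ => (Matrix.of (q r)).det) = fun r => 1 + (Matrix.of A).trace * r +
        ((1 + (Polynomial.X : Polynomial ℝ) • (Matrix.of A).map Polynomial.C).det.divX.divX).eval r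
          * r ^ 2 := by
      funext r
      exact Matrix.det_one_add_smul r (Matrix.of A)
    rw [e]
    have h4 := ((1 + (Polynomial.X : Polynomial ℝ) • (Matrix.of A).map Polynomial.C).det.divX.divX
      ).hasDerivAt (0 : ℝ)
    have h5 := h4.mul ((hasDerivAt_id (0 : ℝ)).pow 2)
    have h6 := (((hasDerivAt_id (0 : ℝ)).const_mul (Matrix.of A).trace).const_add 1).add h5
    refine h6.congr_deriv ?_
    simp
  have h7 : q 0 = Matrix.of.symm (1 : Matrix ι ι ℝ) := by simp [q]
  rw [h7] at h2
  exact h2.unique h3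

variable [FiniteDimensional ℝ E]

theorem hasFDerivAt_det_one :
    ∃ D : (E →L[ℝ] E) →L[ℝ] ℝ, HasFDerivAt (fun A : E →L[ℝ] E => A.det) D 1 ∧
      ∀ A : E →L[ℝ] E, D A = LinearMap.trace ℝ E (A : E →ₗ[ℝ] E) := by
  classical
  let b := Module.finBasis ℝ E
  obtain ⟨D, hD, htr⟩ := Matrix.hasFDerivAt_det_one (ι := Fin (Module.finrank ℝ E))
  let T : (E →L[ℝ] E) →ₗ[ℝ] (Fin (Module.finrank ℝ E) → Fin (Module.finrank ℝ E) → ℝ) :=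
    { toFun := fun A => Matrix.of.symm (LinearMap.toMatrix b b (A : E →ₗ[ℝ] E))
      map_add' := fun A B => by simp; rfl
      map_smul' := fun c A => by simp; rfl }
  let T' := LinearMap.toContinuousLinearMap T
  refine ⟨D ∘L T', ?_, fun A => ?_⟩
  · have h1 : T' 1 = Matrix.of.symm (1 : Matrix _ _ ℝ) := by
      change Matrix.of.symm (LinearMap.toMatrix b b (LinearMap.id)) = _
      rw [LinearMap.toMatrix_id]
    have h2 := HasFDerivAt.comp (1 : E →L[ℝ] E) (by rw [h1]; exact hD) T'.hasFDerivAt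
    refine h2.congr_of_eventuallyEq (Eventually.of_forall fun A => ?_)
    change LinearMap.det (A : E →ₗ[ℝ] E) = (LinearMap.toMatrix b b (A : E →ₗ[ℝ] E)).det
    rw [LinearMap.det_toMatrix]
  · rw [ContinuousLinearMap.comp_apply, htr, LinearMap.trace_eq_matrix_trace ℝ b]
    rfl

/-- Jacobi's formula. -/
theorem hasFDerivAt_det_of_inverse {A B : E →L[ℝ] E} (hAB : A * B = 1) (hBA : B * A = 1) :
    ∃ D : (E →L[ℝ] E) →L[ℝ] ℝ, HasFDerivAt (fun A : E →L[ℝ] E => A.det) D A ∧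
      ∀ H : E →L[ℝ] E, D H = A.det * LinearMap.trace ℝ E (B * H : E →L[ℝ] E) := by
  obtain ⟨D, hD, htr⟩ := hasFDerivAt_det_one (E := E)
  let T : (E →L[ℝ] E) →L[ℝ] (E →L[ℝ] E) := ContinuousLinearMap.mul ℝ (E →L[ℝ] E) B
  refine ⟨A.det • (D ∘L T), ?_, fun H => ?_⟩
  · have h1 : T A = 1 := hBA
    have h2 := (HasFDerivAt.comp A (by rw [h1]; exact hD) T.hasFDerivAt).const_smul A.det
    refine h2.congr_of_eventuallyEq (Eventually.of_forall fun H => ?_)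
    change LinearMap.det (H : E →ₗ[ℝ] E) = LinearMap.det (A : E →ₗ[ℝ] E) •
      LinearMap.det ((B * H : E →L[ℝ] E) : E →ₗ[ℝ] E)
    rw [smul_eq_mul, ← LinearMap.det_comp]
    congr 1
    ext x
    have := congrArg (fun f : E →L[ℝ] E => f (H x)) hAB
    simpa using this.symm
  · simp [htr, T]

end Det

end Calculus

/-! ### Hopf's strong maximum principle -/

section MaximumPrinciple

open Set Filter Topology

/-- The second derivative test, necessary condition. -/
theorem IsLocalMax.second_deriv_nonpos {E : Type*} [NormedAddCommGroup E] [NormedSpace ℝ E]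
    {g : E → ℝ} {g' : E → E →L[ℝ] ℝ} {g'' : E →L[ℝ] E →L[ℝ] ℝ} {q : E}
    (hg : ∀ᶠ p in 𝓝 q, HasFDerivAt g (g' p) p) (hg' : HasFDerivAt g' g'' q)
    (hmax : IsLocalMax g q) (v : E) : g'' v v ≤ 0 := by
  by_contra! hpos
  have hline : HasDerivAt (fun t : ℝ => q + t • v) v 0 := by
    simpa using ((hasDerivAt_id (0 : ℝ)).smul_const v).const_add q
  have hcont : ContinuousAt (fun t : ℝ => q + t • v) 0 := hline.continuousAt
  have h0 : q + (0 : ℝ) • v = q := by simp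
  set φ : ℝ → ℝ := fun t => g (q + t • v) with hφ
  have hφ' : ∀ᶠ t in 𝓝 (0 : ℝ), HasDerivAt φ (g' (q + t • v) v) t := by
    have h1 : Tendsto (fun t : ℝ => q + t • v) (𝓝 0) (𝓝 q) := by
      have := hcont.tendsto; rwa [h0] at this
    filter_upwards [h1.eventually hg] with t ht
    have hl : HasDerivAt (fun t : ℝ => q + t • v) v t := by
      simpa using ((hasDerivAt_id t).smul_const v).const_add q
    exact ht.comp_hasDerivAt t hl
  have hd : deriv φ =ᶠ[𝓝 0] fun t => g' (q + t • v) v := hφ'.mono fun t ht => ht.deriv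
  have hd2 : HasDerivAt (fun t : ℝ => g' (q + t • v) v) (g'' v v) 0 := by
    have h1 : HasDerivAt (fun t : ℝ => g' (q + t • v)) (g'' v) 0 :=
      HasFDerivAt.comp_hasDerivAt (l := g') (l' := g'') 0 (by rw [h0]; exact hg') hline
    simpa using h1.clm_apply (hasDerivAt_const 0 v)
  have hdd : deriv (deriv φ) 0 = g'' v v := by rw [hd.deriv_eq, hd2.deriv]
  have hmaxφ : IsLocalMax φ 0 := by
    have : Tendsto (fun t : ℝ => q + t • v) (𝓝 0) (𝓝 q) := by
      have := hcont.tendsto; rwa [h0] at this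
    have h2 := this.eventually hmax
    refine h2.mono fun t ht => ?_
    simpa [hφ] using ht
  -- A positive second derivative at the critical point makes `0` a local minimum too. Then `φ` is
  -- locally constant and its second derivative vanishes, a contradiction.
  have hmin : IsLocalMin φ 0 :=
    isLocalMin_of_deriv_deriv_pos (by rw [hdd]; exact hpos) hmaxφ.deriv_eq_zero
      hφ'.self_of_nhds.continuousAt
  have hconst : φ =ᶠ[𝓝 0] fun _ => φ 0 := by
    filter_upwards [hmin, hmaxφ] with t h1 h2
    exact le_antisymm h2 h1
  have h3 : deriv φ =ᶠ[𝓝 0] fun _ => 0 := by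
    refine hconst.deriv.trans (Eventually.of_forall fun t => ?_)
    simp
  rw [h3.deriv_eq] at hdd
  simp at hdd
  linarith

variable {E : Type*} [NormedAddCommGroup E] [InnerProductSpace ℝ E]

variable (E) in
/-- The real inner product as a continuous bilinear map. -/
def realInnerL : E →L[ℝ] E →L[ℝ] ℝ := innerSL ℝ

@[simp]
theorem realInnerL_apply (x y : E) : realInnerL E x y = inner ℝ x y := rfl

theorem hasFDerivAt_gaussian (α : ℝ) (c x : E) :
    HasFDerivAt (fun x => Real.exp (-α * ‖x - c‖ ^ 2))
      ((-(2 * α) * Real.exp (-α * ‖x - c‖ ^ 2)) • realInnerL E (x - c)) x := by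
  have h1 : HasFDerivAt (fun x : E => ‖x - c‖ ^ 2) (2 • realInnerL E (x - c)) x := by
    have := ((hasFDerivAt_id x).sub_const c).norm_sq
    exact this
  have h2 := (h1.const_mul (-α)).exp
  refine h2.congr_fderiv ?_
  ext v
  simp
  ring

theorem hasFDerivAt_gaussian_deriv (α : ℝ) (c x : E) :
    HasFDerivAt (fun x => (-(2 * α) * Real.exp (-α * ‖x - c‖ ^ 2)) • realInnerL E (x - c))
      ((-(2 * α) * Real.exp (-α * ‖x - c‖ ^ 2)) • realInnerL E +
        ((4 * α ^ 2 * Real.exp (-α * ‖x - c‖ ^ 2)) • realInnerL E (x - c)).smulRight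
          (realInnerL E (x - c))) x := by
  have h1 := (hasFDerivAt_gaussian α c x).const_mul (-(2 * α))
  have h2 : HasFDerivAt (fun x : E => realInnerL E (x - c)) (realInnerL E) x := by
    have := (realInnerL E).hasFDerivAt.comp x ((hasFDerivAt_id x).sub_const c)
    exact this
  refine (h1.smul h2).congr_fderiv ?_
  ext v w
  simp
  left
  ring

/-- Positivity of the barrier function: on an annulus, `exp (-α ‖x - c‖ ^ 2)` is strictly
subharmonic for the operators under consideration when `α` is large. -/
theorem gaussian_barrier {C ρ d : ℝ} (hC : 0 ≤ C) (hρ : 0 < ρ) :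
    ∃ α : ℝ, 0 < α ∧ ∀ (y : E) (G : E →L[ℝ] E →L[ℝ] E) (u : Fin 4 → E), u 0 = y → ρ ≤ ‖y‖ →
      ‖y‖ ≤ d → ‖G‖ ≤ C → (∀ i, ‖u i‖ ≤ C * ‖y‖) →
      0 < ∑ i, (2 * α * inner ℝ y (u i) ^ 2 - ‖u i‖ ^ 2 + inner ℝ y (G (u i) (u i))) := by
  -- `M` bounds the terms without `α`. The vector `u 0 = y` alone contributes `2α‖y‖⁴ ≥ 2αρ⁴`, which
  -- equals `2(|M| + 1)` for the chosen `α`; this is why only the first vector needs to be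
  -- prescribed.
  set M : ℝ := 4 * ((C * d) ^ 2 + d * (C * (C * d) * (C * d))) with hM
  refine ⟨(|M| + 1) / ρ ^ 4, by positivity, fun y G u hu hy hyd hG hui => ?_⟩
  set α := (|M| + 1) / ρ ^ 4
  have hα : 0 < α := by positivity
  have hd : 0 ≤ d := (norm_nonneg y).trans hyd
  have hui' : ∀ i, ‖u i‖ ≤ C * d := fun i => (hui i).trans (by gcongr)
  have h1 : ∀ i, -((C * d) ^ 2 + d * (C * (C * d) * (C * d))) ≤
      - ‖u i‖ ^ 2 + inner ℝ y (G (u i) (u i)) := by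
    intro i
    have h2 : ‖G (u i) (u i)‖ ≤ C * (C * d) * (C * d) :=
      ContinuousLinearMap.le_of_opNorm₂_le_of_le _ hG (hui' i) (hui' i)
    have h3 : |inner ℝ y (G (u i) (u i))| ≤ d * (C * (C * d) * (C * d)) :=
      (abs_real_inner_le_norm _ _).trans (by gcongr)
    have h4 : ‖u i‖ ^ 2 ≤ (C * d) ^ 2 := by
      have := hui' i
      gcongr
    have := neg_abs_le (inner ℝ y (G (u i) (u i)))
    linarith
  have h5 : ρ ^ 4 ≤ ∑ i, inner ℝ y (u i) ^ 2 := by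
    have h6 : inner ℝ y (u 0) ^ 2 ≤ ∑ i, inner ℝ y (u i) ^ 2 :=
      Finset.single_le_sum (f := fun i => inner ℝ y (u i) ^ 2) (fun i _ => sq_nonneg _)
        (Finset.mem_univ 0)
    refine le_trans ?_ h6
    rw [hu, real_inner_self_eq_norm_sq]
    calc ρ ^ 4 ≤ ‖y‖ ^ 4 := by gcongr
      _ = (‖y‖ ^ 2) ^ 2 := by ring
  have h7 : ∑ i, (2 * α * inner ℝ y (u i) ^ 2 - ‖u i‖ ^ 2 + inner ℝ y (G (u i) (u i)))
      = 2 * α * ∑ i, inner ℝ y (u i) ^ 2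
        + ∑ i, (- ‖u i‖ ^ 2 + inner ℝ y (G (u i) (u i))) := by
    rw [Finset.mul_sum, ← Finset.sum_add_distrib]
    exact Finset.sum_congr rfl fun i _ => by ring
  have h8 : -M ≤ ∑ i, (- ‖u i‖ ^ 2 + inner ℝ y (G (u i) (u i))) := by
    have := Finset.sum_le_sum (s := (Finset.univ : Finset (Fin 4))) fun i _ => h1 i
    simp only [Finset.sum_const, Finset.card_univ, Fintype.card_fin, nsmul_eq_mul] at this
    push_cast at this
    linarith
  have h9 : |M| + 1 = α * ρ ^ 4 := by
    simp only [α]; field_simp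
  have h10 : α * ρ ^ 4 ≤ α * ∑ i, inner ℝ y (u i) ^ 2 := by gcongr
  rw [h7]
  have := le_abs_self M
  have := abs_nonneg M
  linarith

/-- **Hopf's strong maximum principle**, for an operator that is the trace of the Hessian
`D²f(X,X) - Df(Γ(X,X))` on families of four vectors the first of which is arbitrary. -/
theorem eventually_eq_of_isMax [FiniteDimensional ℝ E] {Ω : Set E} (hΩ : IsOpen Ω)
    {f : E → ℝ} {f' : E → E →L[ℝ] ℝ} {f'' : E → E →L[ℝ] E →L[ℝ] ℝ}
    (hf : ∀ p ∈ Ω, HasFDerivAt f (f' p) p) (hf' : ∀ p ∈ Ω, HasFDerivAt f' (f'' p) p)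
    {G : E → E →L[ℝ] E →L[ℝ] E} {C : ℝ} (hG : ∀ p ∈ Ω, ‖G p‖ ≤ C)
    (hop : ∀ p ∈ Ω, ∀ v, ∃ u : Fin 4 → E, u 0 = v ∧ (∀ i, ‖u i‖ ≤ C * ‖v‖) ∧
      0 ≤ ∑ i, (f'' p (u i) (u i) - f' p (G p (u i) (u i))))
    {z₀ : E} (hz₀ : z₀ ∈ Ω) (hmax : ∀ p ∈ Ω, f p ≤ f z₀) :
    ∀ᶠ p in 𝓝 z₀, f p = f z₀ := by
  have hC : 0 ≤ C := (norm_nonneg _).trans (hG z₀ hz₀)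
  obtain ⟨r, hr, hrΩ⟩ := Metric.isOpen_iff.1 hΩ z₀ hz₀
  refine Metric.eventually_nhds_iff_ball.2 ⟨r / 8, by positivity, fun p₁ hp₁ => ?_⟩
  by_contra hne
  have hfc : ContinuousOn f Ω := fun p hp => (hf p hp).continuousAt.continuousWithinAt
  have hcb : Metric.closedBall z₀ (r / 2) ⊆ Ω :=
    (Metric.closedBall_subset_ball (by linarith)).trans hrΩ
  set Z : Set E := Metric.closedBall z₀ (r / 2) ∩ f ⁻¹' {f z₀} with hZ
  have hZc : IsCompact Z := by
    have : IsClosed Z := (hfc.mono hcb).preimage_isClosed_of_isClosed Metric.isClosed_closedBall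
      isClosed_singleton
    exact (isCompact_closedBall z₀ (r / 2)).of_isClosed_subset this inter_subset_left
  have hz₀Z : z₀ ∈ Z := ⟨Metric.mem_closedBall_self (by positivity), rfl⟩
  -- `z` is a point of the contact set `{f = f z₀}` nearest to `p₁`, where `f < f z₀`. The radii
  -- `r/8` and `r/2` keep everything below inside `Ω`.
  obtain ⟨z, hzZ, hzd⟩ := hZc.exists_infDist_eq_dist ⟨z₀, hz₀Z⟩ p₁
  have hmin : ∀ y ∈ Z, dist p₁ z ≤ dist p₁ y := fun y hy => hzd ▸ Metric.infDist_le_dist_of_mem hy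
  have hd1 : dist p₁ z < r / 8 := (hmin z₀ hz₀Z).trans_lt hp₁
  have hp₁z : p₁ ≠ z := fun h => hne (by rw [h]; exact hzZ.2)
  -- Halving the ball about `p₁` gives a ball about `c` that is internally tangent to it at `z`, so
  -- that its closure meets the contact set in `z` only.
  set c : E := (2⁻¹ : ℝ) • (p₁ + z) with hc
  set ρ : ℝ := ‖z - c‖ with hρdef
  have hzc : z - c = (2⁻¹ : ℝ) • (z - p₁) := by rw [hc]; module
  have hcp : c - p₁ = z - c := by rw [hc]; module
  have hρ : 0 < ρ := by
    rw [hρdef, hzc, norm_smul]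
    have : 0 < ‖z - p₁‖ := norm_pos_iff.2 (sub_ne_zero.2 hp₁z.symm)
    exact mul_pos (by norm_num) this
  have hρ2 : dist p₁ z = 2 * ρ := by
    rw [hρdef, hzc, norm_smul, dist_comm, dist_eq_norm]; norm_num; ring
  have hp₁' : dist p₁ z₀ < r / 8 := hp₁
  have hzz₀ : dist z z₀ < r / 2 := by
    have := dist_triangle z p₁ z₀
    rw [dist_comm z p₁] at this
    linarith
  -- the only point of `Z` in the closed ball of radius `ρ` around `c` is `z`
  have honly : ∀ x ∈ Metric.closedBall c ρ, x ∈ Z → x = z := by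
    intro x hx hxZ
    by_contra hxz
    have h1 : ‖x - c‖ ≤ ρ := by rwa [← dist_eq_norm]
    have h2 : ‖x - p₁‖ ^ 2 = 2 * ‖x - c‖ ^ 2 + 2 * ρ ^ 2 - ‖x - z‖ ^ 2 := by
      have h3 : x - p₁ = (x - c) + (z - c) := by rw [← hcp]; abel
      have h4 : x - z = (x - c) - (z - c) := by abel
      have := parallelogram_law_with_norm ℝ (x - c) (z - c)
      rw [h3, h4]
      nlinarith
    have h5 : 0 < ‖x - z‖ := norm_pos_iff.2 (sub_ne_zero.2 hxz)
    have h6 := hmin x hxZ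
    rw [hρ2, dist_comm, dist_eq_norm] at h6
    nlinarith [norm_nonneg (x - c)]
  set D : Set E := Metric.closedBall z (ρ / 2) with hD
  have hDcb : D ⊆ Metric.closedBall z₀ (r / 2) := by
    intro x hx
    have h1 : dist x z ≤ ρ / 2 := hx
    have h2 := dist_triangle x z z₀
    have h3 : dist z z₀ ≤ 2 * ρ + dist p₁ z₀ := by
      have := dist_triangle z p₁ z₀
      rw [dist_comm z p₁, hρ2] at this
      exact this
    have h4 : 2 * ρ ≤ dist p₁ z₀ := hρ2 ▸ hmin z₀ hz₀Z
    rw [Metric.mem_closedBall]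
    linarith
  have hDΩ : D ⊆ Ω := hDcb.trans hcb
  -- Points within `ρ/2` of `z` have distance between `ρ/2` and `2ρ` from `c`, because `‖z - c‖ =
  -- ρ`.
  obtain ⟨α, hα, hbar⟩ := gaussian_barrier (E := E) (C := max C 1) (ρ := ρ / 2) (d := 2 * ρ)
    (by positivity) (by positivity)
  set w : E → ℝ := fun x => Real.exp (-α * ‖x - c‖ ^ 2) with hw
  set S : Set E := Metric.sphere z (ρ / 2) ∩ Metric.closedBall c ρ with hS
  have hSc : IsCompact S := (isCompact_sphere z (ρ / 2)).inter_right Metric.isClosed_closedBall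
  have hSD : S ⊆ D := fun x hx => Metric.sphere_subset_closedBall hx.1
  have hSlt : ∀ x ∈ S, f x < f z₀ := by
    intro x hx
    refine lt_of_le_of_ne (hmax x (hDΩ (hSD hx))) fun h => ?_
    have := honly x hx.2 ⟨hDcb (hSD hx), h⟩
    have h2 : dist x z = ρ / 2 := hx.1
    rw [this, dist_self] at h2
    linarith
  obtain ⟨η, hη, hηS⟩ : ∃ η > 0, ∀ x ∈ S, f x ≤ f z₀ - η := by
    rcases S.eq_empty_or_nonempty with h | h
    · exact ⟨1, one_pos, by simp [h]⟩
    · obtain ⟨x, hxS, hx⟩ := hSc.exists_isMaxOn h (hfc.mono (hSD.trans hDΩ))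
      exact ⟨f z₀ - f x, sub_pos.2 (hSlt x hxS), fun y hy => by
        have := hx hy
        simp only [mem_ofPred_eq] at this
        linarith⟩
  -- The factor `η/2` makes the maximum of `g` over the ball `D` interior. On the part of the
  -- boundary sphere in the ball about `c`, `f` has dropped by `η` while the barrier adds at most
  -- `η/2`. On the rest of the sphere the barrier is smaller than at `z`.
  set g : E → ℝ := fun x => f x + (η / 2) * w x with hg
  have hw1 : ∀ x, w x ≤ 1 := fun x => Real.exp_le_one_iff.2 (by nlinarith [sq_nonneg ‖x - c‖])
  have hw0 : ∀ x, 0 < w x := fun x => Real.exp_pos _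
  have hgc : ContinuousOn g D := by
    refine (hfc.mono hDΩ).add (Continuous.continuousOn ?_)
    simp only [hw]
    fun_prop
  obtain ⟨q, hqD, hq⟩ := (isCompact_closedBall z (ρ / 2)).exists_isMaxOn
    ⟨z, Metric.mem_closedBall_self (by positivity)⟩ hgc
  have hgz : g z = f z₀ + (η / 2) * w z := by
    simp only [hg]
    rw [show f z = f z₀ from hzZ.2]
  have hgq : g z ≤ g q := hq (Metric.mem_closedBall_self (by positivity))
  have hqint : q ∈ Metric.ball z (ρ / 2) := by
    rw [Metric.mem_ball]
    refine lt_of_le_of_ne hqD fun h => ?_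
    by_cases hqc : q ∈ Metric.closedBall c ρ
    · have h1 := hηS q ⟨h, hqc⟩
      have h2 : g q ≤ f z₀ - η + η / 2 * 1 := by
        simp only [hg]
        have := hw1 q
        nlinarith
      have h3 := hw0 z
      rw [hgz] at hgq
      nlinarith
    · have h1 : ρ < ‖q - c‖ := by
        rw [Metric.mem_closedBall, not_le, dist_eq_norm] at hqc; exact hqc
      have h2 : w q < w z := by
        simp only [hw]
        refine Real.exp_lt_exp.2 ?_
        rw [← hρdef]
        have : ρ ^ 2 < ‖q - c‖ ^ 2 := by gcongr
        nlinarith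
      have h3 : f q ≤ f z₀ := hmax q (hDΩ hqD)
      rw [hgz] at hgq
      simp only [hg] at hgq
      nlinarith
  have hDn : D ∈ 𝓝 q := mem_of_superset (Metric.isOpen_ball.mem_nhds hqint)
    Metric.ball_subset_closedBall
  have hlm : IsLocalMax g q := hq.isLocalMax hDn
  have hqΩ : q ∈ Ω := hDΩ hqD
  set w' : E → E →L[ℝ] ℝ := fun x =>
    (-(2 * α) * Real.exp (-α * ‖x - c‖ ^ 2)) • realInnerL E (x - c) with hw'
  set g' : E → E →L[ℝ] ℝ := fun x => f' x + (η / 2) • w' x with hg'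
  have hgd : ∀ x ∈ Ω, HasFDerivAt g (g' x) x := fun x hx =>
    (hf x hx).add ((hasFDerivAt_gaussian α c x).const_mul (η / 2))
  have hgd' := (hf' q hqΩ).add ((hasFDerivAt_gaussian_deriv α c q).const_smul (η / 2))
  have hcrit : g' q = 0 := hlm.hasFDerivAt_eq_zero (hgd q hqΩ)
  have htest := hlm.second_deriv_nonpos (g' := g')
    (Filter.mem_of_superset (hΩ.mem_nhds hqΩ) hgd) hgd'
  -- The operator is used only at the interior maximum `q`, on the four vectors starting with the
  -- direction `q - c`. There `dg = 0` and the Hessian of `g` is nonpositive, so the strict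
  -- positivity of the barrier contradicts `hpos`.
  obtain ⟨u, hu0, huC, hpos⟩ := hop q hqΩ (q - c)
  have hqz : ‖q - z‖ ≤ ρ / 2 := by rw [← dist_eq_norm]; exact hqD
  have hqc1 : ρ / 2 ≤ ‖q - c‖ := by
    have := norm_sub_norm_le (z - c) (z - q)
    rw [norm_sub_rev z q, show z - c - (z - q) = q - c by abel] at this
    linarith
  have hqc2 : ‖q - c‖ ≤ 2 * ρ := by
    have := norm_add_le (q - z) (z - c)
    rw [show q - z + (z - c) = q - c by abel] at this
    linarith
  have hb := hbar (q - c) (G q) u hu0 hqc1 hqc2 ((hG q hqΩ).trans (le_max_left _ _))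
    (fun i => (huC i).trans (by gcongr; exact le_max_left _ _))
  have hsum : ∑ i, (f'' q (u i) (u i) - f' q (G q (u i) (u i))) ≤
      - (η / 2 * (2 * α * w q)) * ∑ i, (2 * α * inner ℝ (q - c) (u i) ^ 2 - ‖u i‖ ^ 2
        + inner ℝ (q - c) (G q (u i) (u i))) := by
    rw [Finset.mul_sum]
    refine Finset.sum_le_sum fun i _ => ?_
    have h1 := htest (u i)
    have h2 := congrArg (fun L : E →L[ℝ] ℝ => L (G q (u i) (u i))) hcrit
    simp [hg', hw'] at h1 h2
    simp only [hw, inner_sub_left, neg_mul]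
    linarith
  have : 0 < η / 2 * (2 * α * w q) := by have := hw0 q; positivity
  nlinarith

end MaximumPrinciple

/-! ### Algebra of curvature tensors with values in `𝔰𝔩(m,ℍ) ⊕ 𝔲(1)` -/

section QuaternionicCurvature

open LinearMap (trace)

variable {V : Type*} [AddCommGroup V] [Module ℝ V]

/-- The Ricci tensor `(Y, Z) ↦ tr (X ↦ R(X,Y)Z)`. -/
def ricciTrace (R : V →ₗ[ℝ] V →ₗ[ℝ] Module.End ℝ V) (Y Z : V) : ℝ :=
  trace ℝ V ((R.flip Y).flip Z)

/-- An algebraic curvature tensor with values in `𝔰𝔩(m,ℍ) ⊕ 𝔲(1)`. -/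
structure IsQuaternionicCurvature (R : V →ₗ[ℝ] V →ₗ[ℝ] Module.End ℝ V) (I J : Module.End ℝ V) :
    Prop where
  sq_left : I * I = -1
  sq_right : J * J = -1
  anticomm : J * I = -(I * J)
  skew : ∀ X Y, R X Y = -R Y X
  bianchi : ∀ X Y Z, R X Y Z + R Y Z X + R Z X Y = 0
  trace_eq_zero : ∀ X Y, trace ℝ V (R X Y) = 0
  comm_left : ∀ X Y, R X Y * I = I * R X Y
  comm_right : ∀ X Y, ∃ t : ℝ, R X Y * J - J * R X Y = t • (I * J)

namespace IsQuaternionicCurvature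

variable {R : V →ₗ[ℝ] V →ₗ[ℝ] Module.End ℝ V} {I J : Module.End ℝ V}

theorem apply_left_left (h : IsQuaternionicCurvature R I J) (v : V) : I (I v) = -v := by
  simpa using congrArg (fun f : Module.End ℝ V => f v) h.sq_left

theorem apply_right_right (h : IsQuaternionicCurvature R I J) (v : V) : J (J v) = -v := by
  simpa using congrArg (fun f : Module.End ℝ V => f v) h.sq_right

theorem apply_right_left (h : IsQuaternionicCurvature R I J) (v : V) : J (I v) = -I (J v) := by
  simpa using congrArg (fun f : Module.End ℝ V => f v) h.anticomm

theorem apply_comm (h : IsQuaternionicCurvature R I J) (X Y v : V) : R X Y (I v) = I (R X Y v) := by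
  simpa using congrArg (fun f : Module.End ℝ V => f v) (h.comm_left X Y)

/-- The Ricci tensor is symmetric. -/
theorem ricciTrace_comm (h : IsQuaternionicCurvature R I J) (Y Z : V) : ricciTrace R Y Z = ricciTrace R Z Y := by
  -- By Bianchi the two endomorphisms being traced differ by `R(Y,Z)` up to sign, and that has trace
  -- zero.
  have h1 : (R.flip Y).flip Z - (R.flip Z).flip Y = -R Y Z := by
    ext X
    have h2 := h.bianchi X Y Z
    rw [h.skew Z X] at h2
    simp only [LinearMap.sub_apply, LinearMap.flip_apply, LinearMap.neg_apply] at h2 ⊢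
    linear_combination (norm := module) h2
  have h3 := congrArg (trace ℝ V) h1
  rw [map_sub, map_neg, h.trace_eq_zero] at h3
  simp only [ricciTrace]
  linarith

/-- The trace of `I R(Y,Z)` in terms of the Ricci tensor. -/
theorem trace_left_mul (h : IsQuaternionicCurvature R I J) (Y Z : V) :
    trace ℝ V (I * R Y Z) = ricciTrace R Z (I Y) - ricciTrace R Y (I Z) := by
  simp only [ricciTrace]
  rw [← map_sub]
  congr 1
  ext X
  have h2 := congrArg I (h.bianchi X Y Z)
  rw [h.skew Z X] at h2
  simp only [map_add, map_zero, LinearMap.neg_apply, map_neg] at h2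
  simp only [Module.End.mul_apply, LinearMap.sub_apply, LinearMap.flip_apply, h.apply_comm]
  linear_combination (norm := module) h2

/-- The component of the curvature along `I`. -/
theorem comm_right_eq [FiniteDimensional ℝ V] (h : IsQuaternionicCurvature R I J) (X Y : V) :
    (Module.finrank ℝ V : ℝ) • (R X Y * J - J * R X Y)
      = (-(2 * trace ℝ V (I * R X Y))) • (I * J) := by
  obtain ⟨t, ht⟩ := h.comm_right X Y
  have hk : (I * J) * (I * J) = -1 := by
    calc (I * J) * (I * J) = I * (J * I) * J := by noncomm_ring
      _ = -((I * I) * (J * J)) := by rw [h.anticomm]; noncomm_ring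
      _ = -1 := by rw [h.sq_left, h.sq_right]; noncomm_ring
  have hJK : J * (I * J) = I := by
    calc J * (I * J) = (J * I) * J := by noncomm_ring
      _ = -(I * (J * J)) := by rw [h.anticomm]; noncomm_ring
      _ = I := by rw [h.sq_right]; noncomm_ring
  have hKJ : (I * J) * J = -I := by
    rw [mul_assoc, h.sq_right]; noncomm_ring
  -- Multiplying `[R,J] = tK` by `K` and taking traces gives `2 tr(I R) = -t dim V`, which
  -- determines `t`.
  have h1 := congrArg (fun f => trace ℝ V ((I * J) * f)) ht
  simp only [mul_sub, map_sub, mul_smul_comm, hk, map_smul, map_neg, LinearMap.trace_one,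
    smul_eq_mul] at h1
  have h2 : trace ℝ V (I * J * (R X Y * J)) = trace ℝ V (I * R X Y) := by
    calc trace ℝ V (I * J * (R X Y * J)) = trace ℝ V ((I * J * R X Y) * J) := by
          rw [mul_assoc (I * J)]
      _ = trace ℝ V (J * (I * J * R X Y)) := LinearMap.trace_mul_comm ℝ _ _
      _ = trace ℝ V (I * R X Y) := by rw [← mul_assoc J (I * J), hJK]
  have h3 : trace ℝ V (I * J * (J * R X Y)) = - trace ℝ V (I * R X Y) := by
    rw [← mul_assoc, hKJ, neg_mul, map_neg]
  rw [h2, h3] at h1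
  rw [ht, smul_smul]
  congr 1
  linarith

/-- `R` commutes with `I` while `J` anticommutes with it, so moving `I` around the trace shows that
the number equals its negative. -/
theorem trace_right_mul (h : IsQuaternionicCurvature R I J) (X Y : V) : trace ℝ V (J * R X Y) = 0 := by
  have h1 : trace ℝ V ((I * J) * (R X Y * I)) = trace ℝ V ((I * J) * (I * R X Y)) := by
    rw [h.comm_left]
  have hIK : I * (I * J) = -J := by rw [← mul_assoc, h.sq_left]; noncomm_ring
  have hKI : (I * J) * I = J := by
    calc (I * J) * I = I * (J * I) := by noncomm_ring
      _ = -((I * I) * J) := by rw [h.anticomm]; noncomm_ring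
      _ = J := by rw [h.sq_left]; noncomm_ring
  have h2 : trace ℝ V ((I * J) * (R X Y * I)) = -trace ℝ V (J * R X Y) := by
    calc trace ℝ V ((I * J) * (R X Y * I)) = trace ℝ V (((I * J) * R X Y) * I) := by
          rw [mul_assoc (I * J)]
      _ = trace ℝ V (I * ((I * J) * R X Y)) := LinearMap.trace_mul_comm ℝ _ _
      _ = _ := by rw [← mul_assoc I (I * J), hIK, neg_mul, map_neg]
  have h3 : trace ℝ V ((I * J) * (I * R X Y)) = trace ℝ V (J * R X Y) := by
    rw [← mul_assoc, hKI]
  linarith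

/-- In real dimension different from `4` the Ricci tensor is compatible with `J`. -/
theorem ricciTrace_right [FiniteDimensional ℝ V] (h : IsQuaternionicCurvature R I J) (hn : Module.finrank ℝ V ≠ 4) (Y Z : V) :
    ricciTrace R (J Y) Z = ricciTrace R Y (J Z) := by
  set n : ℝ := (Module.finrank ℝ V : ℝ) with hndef
  set B : V → V → ℝ := ricciTrace R with hB
  have hBs : ∀ Y Z, B Y Z = B Z Y := h.ricciTrace_comm
  have hBneg : ∀ Y Z, B (-Y) Z = - B Y Z := fun Y Z => by
    simp only [hB, ricciTrace]
    rw [← map_neg (trace ℝ V)]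
    congr 1
    ext X
    simp
  have hBneg' : ∀ Y Z, B Y (-Z) = - B Y Z := fun Y Z => by rw [hBs, hBneg, hBs]
  -- the 2-form `θ X Y = tr (I R(X,Y))`
  let θ : V → V →ₗ[ℝ] ℝ := fun Z =>
    (trace ℝ V) ∘ₗ (LinearMap.mulLeft ℝ I) ∘ₗ (R.flip Z)
  have hθ : ∀ X Z, θ Z X = B Z (I X) - B X (I Z) := fun X Z => h.trace_left_mul X Z
  have hJR : ∀ X Y Z, n • J (R X Y Z) = n • R X Y (J Z) + (2 * θ Y X) • I (J Z) := by
    intro X Y Z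
    have h1 := congrArg (fun f : Module.End ℝ V => f Z) (h.comm_right_eq X Y)
    simp only [LinearMap.smul_apply, LinearMap.sub_apply, Module.End.mul_apply, neg_smul,
      smul_sub] at h1
    change n • (R X Y) (J Z) - n • J ((R X Y) Z) = -((2 * θ Y X) • I (J Z)) at h1
    linear_combination (norm := module) -h1
  -- This is the trace of `J` applied to the Bianchi identity. Commuting `J` past `R` costs the
  -- rank-one terms in `θ`; the factor `n` avoids a division.
  have hb : ∀ Y Z, n * (B Z (J Y) - B Y (J Z)) + 2 * θ Z (I (J Y)) - 2 * θ Y (I (J Z)) = 0 := by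
    intro Y Z
    have h1 : n • (J * R Y Z) = n • (R.flip Z).flip (J Y) + (2 : ℝ) • (θ Z).smulRight (I (J Y))
        - (n • (R.flip Y).flip (J Z) + (2 : ℝ) • (θ Y).smulRight (I (J Z))) := by
      ext X
      have h2 := congrArg J (h.bianchi X Y Z)
      rw [h.skew Z X] at h2
      simp only [map_add, map_zero, LinearMap.neg_apply, map_neg] at h2
      have e1 := hJR X Z Y
      have e2 := hJR X Y Z
      simp only [LinearMap.smul_apply, LinearMap.sub_apply, LinearMap.add_apply,
        Module.End.mul_apply, LinearMap.flip_apply, LinearMap.smulRight_apply, smul_smul]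
      rw [← e1, ← e2]
      have h3 := congrArg (fun v => n • v) h2
      simp only [smul_add, smul_neg, smul_zero] at h3
      linear_combination (norm := module) h3
    have h2 := congrArg (trace ℝ V) h1
    simp only [map_smul, map_sub, map_add, h.trace_right_mul, LinearMap.trace_smulRight,
      smul_eq_mul, mul_zero] at h2
    simp only [hB, ricciTrace]
    linarith
  have hI2 := h.apply_left_left
  have hJI := h.apply_right_left
  -- The defect `p` satisfies `(n-2) p(Y,Z) = -2 p(IY,IZ)`. Used twice, this gives `n(n-4) p = 0`,
  -- so real dimension `4` is the exception.
  set p : V → V → ℝ := fun Y Z => B (J Y) Z - B Y (J Z) with hp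
  have key : ∀ Y Z, (n - 2) * p Y Z = -2 * p (I Y) (I Z) := by
    intro Y Z
    have h1 := hb Y Z
    simp only [hθ, hI2, hBneg'] at h1
    simp only [hp, hJI, hBneg, hBneg']
    rw [hBs Z (J Y)] at h1
    rw [hBs (I (J Z)) (I Y)] at h1
    linarith
  have h1 := key Y Z
  have h2 := key (I Y) (I Z)
  have h3 : p (I (I Y)) (I (I Z)) = p Y Z := by
    simp only [hp, hI2, map_neg, hBneg, hBneg', neg_neg]
  rw [h3] at h2
  have h4 : (n * (n - 4)) * p Y Z = 0 := by linear_combination (n - 2) * h1 - 2 * h2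
  have hn4 : n - 4 ≠ 0 := by
    rw [sub_ne_zero, hndef]
    exact_mod_cast hn
  by_cases hn0 : n = 0
  · have : Subsingleton V := by
      rw [← Module.finrank_zero_iff (R := ℝ)]
      rw [hndef] at hn0
      exact_mod_cast hn0
    rw [Subsingleton.elim (J Y) 0, Subsingleton.elim Y 0, Subsingleton.elim Z 0, map_zero]
  · have := (mul_eq_zero.1 h4).resolve_left (mul_ne_zero hn0 hn4)
    simp only [hp] at this
    linarith

/-- The quaternionic average of the Ricci tensor vanishes in real dimension different from `4`. -/
theorem ricciTrace_average [FiniteDimensional ℝ V] (h : IsQuaternionicCurvature R I J) (hn : Module.finrank ℝ V ≠ 4) (v : V) :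
    ricciTrace R v v + ricciTrace R (I v) (I v) + ricciTrace R (J v) (J v)
      + ricciTrace R (I (J v)) (I (J v)) = 0 := by
  have h1 : ∀ v, ricciTrace R (J v) (J v) = - ricciTrace R v v := by
    intro v
    rw [h.ricciTrace_right hn, h.apply_right_right]
    simp only [ricciTrace, map_neg]
  have h2 : ricciTrace R (I (J v)) (I (J v)) = ricciTrace R (J (I v)) (J (I v)) := by
    rw [h.apply_right_left]
    simp only [ricciTrace, map_neg]
    rw [← map_neg]
    congr 1
    ext; simp
  rw [h2, h1, h1]
  ring

end IsQuaternionicCurvature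

end QuaternionicCurvature

/-! ### Quaternionic frames and what survives a change by `U*(2m)` -/

section Frames

variable {m : ℕ}

/-- The antilinear map `quatMap` as a real linear map. -/
def quatL (m : ℕ) : C2 m →L[ℝ] C2 m :=
  LinearMap.toContinuousLinearMap
    { toFun := quatMap m
      map_add' := fun v w => by
        funext k
        rcases k with k | k <;> simp [quatMap]
        ring
      map_smul' := fun c v => by
        funext k
        rcases k with k | k <;> simp [quatMap] }

@[simp] theorem quatL_apply (v : C2 m) : quatL m v = quatMap m v := rfl

@[simp] theorem mulI_apply (v : C2 m) : mulI m v = Complex.I • v := by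
  simp [mulI]

theorem quatMap_quatMap (v : C2 m) : quatMap m (quatMap m v) = -v := by
  funext k
  rcases k with k | k <;> simp [quatMap]

theorem quatMap_smul (c : ℂ) (v : C2 m) :
    quatMap m (c • v) = starRingEnd ℂ c • quatMap m v := by
  funext k
  rcases k with k | k <;> simp [quatMap]

section TopologicalModule

variable {V : Type*} [AddCommGroup V] [Module ℝ V] [TopologicalSpace V]

/-- The complex structure determined by a frame. -/
def frameI (w : V ≃L[ℝ] C2 m) : V →L[ℝ] V :=
  (w.symm : C2 m →L[ℝ] V) ∘L mulI m ∘L (w : V →L[ℝ] C2 m)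

/-- The second complex structure determined by a frame. -/
def frameJ (w : V ≃L[ℝ] C2 m) : V →L[ℝ] V :=
  (w.symm : C2 m →L[ℝ] V) ∘L quatL m ∘L (w : V →L[ℝ] C2 m)

@[simp] theorem apply_frameI (w : V ≃L[ℝ] C2 m) (x : V) : w (frameI w x) = Complex.I • w x := by
  simp [frameI]

@[simp] theorem apply_frameJ (w : V ≃L[ℝ] C2 m) (x : V) : w (frameJ w x) = quatMap m (w x) := by
  simp [frameJ]

theorem frameI_frameI (w : V ≃L[ℝ] C2 m) (x : V) : frameI w (frameI w x) = -x := by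
  apply w.injective
  simp [smul_smul]

theorem frameJ_frameJ (w : V ≃L[ℝ] C2 m) (x : V) : frameJ w (frameJ w x) = -x := by
  apply w.injective
  simp [quatMap_quatMap]

theorem frameJ_frameI (w : V ≃L[ℝ] C2 m) (x : V) :
    frameJ w (frameI w x) = -frameI w (frameJ w x) := by
  apply w.injective
  simp [quatMap_smul]

end TopologicalModule

variable {V : Type*} [NormedAddCommGroup V] [NormedSpace ℝ V]

theorem frameI_mul_frameI (w : V ≃L[ℝ] C2 m) : frameI w * frameI w = -1 := by
  ext x
  apply w.injective
  simp [smul_smul]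

theorem frameJ_mul_frameJ (w : V ≃L[ℝ] C2 m) : frameJ w * frameJ w = -1 := by
  ext x
  apply w.injective
  simp [quatMap_quatMap]

theorem frameJ_mul_frameI (w : V ≃L[ℝ] C2 m) : frameJ w * frameI w = -(frameI w * frameJ w) := by
  ext x
  apply w.injective
  simp [quatMap_smul]

/-- The endomorphism `S ↦ J S J + K S K` of `End V`, which is invariant under rotations of `J`
and `K`. -/
def frameQ (w : V ≃L[ℝ] C2 m) : (V →L[ℝ] V) →L[ℝ] (V →L[ℝ] V) :=
  ContinuousLinearMap.mulLeftRight ℝ (V →L[ℝ] V) (frameJ w) (frameJ w) +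
    ContinuousLinearMap.mulLeftRight ℝ (V →L[ℝ] V) (frameI w * frameJ w) (frameI w * frameJ w)

theorem frameQ_apply (w : V ≃L[ℝ] C2 m) (S : V →L[ℝ] V) :
    frameQ w S = frameJ w * S * frameJ w
      + (frameI w * frameJ w) * S * (frameI w * frameJ w) := by
  simp [frameQ]

/-- For `B = cA` the antilinear map turns the scalar `c` into its conjugate `c̄ = c̄² c`. The phase
`a + bi = c̄²` is the rotation of `J` towards `K` that a change of adapted frame can cause. -/
theorem quatMap_mulVec_of_mem_UStar {B : Matrix (Fin m ⊕ Fin m) (Fin m ⊕ Fin m) ℂ}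
    (hB : B ∈ UStar m) :
    ∃ a b : ℝ, a ^ 2 + b ^ 2 = 1 ∧ ∀ v, quatMap m (B.mulVec v)
      = (a + b * Complex.I : ℂ) • B.mulVec (quatMap m v) := by
  obtain ⟨A, hA, c, hc, rfl⟩ := hB
  have hcc : c * starRingEnd ℂ c = 1 := by
    rw [Complex.mul_conj, Complex.normSq_eq_norm_sq, hc]; simp
  refine ⟨(starRingEnd ℂ c ^ 2).re, (starRingEnd ℂ c ^ 2).im, ?_, fun v => ?_⟩
  · have h1 : Complex.normSq (starRingEnd ℂ c ^ 2) = 1 := by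
      rw [Complex.normSq_eq_norm_sq]; simp [hc]
    rw [Complex.normSq_apply] at h1
    nlinarith
  · rw [Complex.re_add_im, Matrix.smul_mulVec, Matrix.smul_mulVec, quatMap_smul, smul_smul, hA.2]
    congr 1
    linear_combination (-starRingEnd ℂ c) * hcc

/-- Two frames related by a linear map and an element of `U*(2m)`. -/
def IsUStarRelated (w w' : V ≃L[ℝ] C2 m) (U : V →L[ℝ] V) : Prop :=
  ∃ B ∈ UStar m, ∀ x, w' (U x) = B.mulVec (w x)

section Related

variable {w w' : V ≃L[ℝ] C2 m} {U W : V →L[ℝ] V}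

theorem IsUStarRelated.frameI_mul (h : IsUStarRelated w w' U) :
    frameI w' * U = U * frameI w := by
  obtain ⟨B, hB, h⟩ := h
  ext x
  apply w'.injective
  simp [h, Matrix.mulVec_smul]

theorem IsUStarRelated.frameJ_mul (h : IsUStarRelated w w' U) :
    ∃ a b : ℝ, a ^ 2 + b ^ 2 = 1 ∧ frameJ w' * U = U * (a • frameJ w + b • (frameI w * frameJ w)) := by
  obtain ⟨B, hB, h⟩ := h
  obtain ⟨a, b, hab, hq⟩ := quatMap_mulVec_of_mem_UStar hB
  refine ⟨a, b, hab, ?_⟩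
  ext x
  apply w'.injective
  change w' (frameJ w' (U x)) = w' (U ((a • frameJ w + b • (frameI w * frameJ w)) x))
  rw [apply_frameJ, h, hq, h]
  simp only [add_apply, smul_apply, map_add, map_smul, mul_apply_eq_comp,
    apply_frameJ, apply_frameI]
  rw [add_smul, mul_smul, Complex.coe_smul, Complex.coe_smul, Matrix.mulVec_add,
    Matrix.mulVec_smul, Matrix.mulVec_smul, Matrix.mulVec_smul]

theorem IsUStarRelated.frameI_eq (h : IsUStarRelated w w' U) (hUW : U * W = 1) :
    frameI w' = U * frameI w * W := by
  rw [← h.frameI_mul, mul_assoc, hUW, mul_one]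

/-- Up to conjugation by `U`, the pair `(J, K)` becomes `(aJ + bK, aK - bJ)`. The expression `JSJ +
KSK` is a sum of squares in this pair, so the cross terms cancel and `a² + b² = 1` does the rest. -/
theorem IsUStarRelated.frameQ_eq (h : IsUStarRelated w w' U) (hUW : U * W = 1)
    (S : V →L[ℝ] V) : frameQ w' S = U * frameQ w (W * S * U) * W := by
  obtain ⟨a, b, hab, hJ⟩ := h.frameJ_mul
  have hI := h.frameI_mul
  set I := frameI w
  set J := frameJ w
  have hII : I * (I * J) = -J := by
    rw [← mul_assoc, frameI_mul_frameI]; simp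
  have hJ' : frameJ w' = U * (a • J + b • (I * J)) * W := by
    rw [← hJ, mul_assoc, hUW, mul_one]
  have hK' : frameI w' * frameJ w' = U * (a • (I * J) - b • J) * W := by
    rw [hJ', ← mul_assoc, ← mul_assoc, hI, mul_assoc U I, mul_add, mul_smul_comm, mul_smul_comm,
      hII, smul_neg, ← sub_eq_add_neg]
  rw [frameQ_apply, frameQ_apply, hK', hJ']
  have e1 : ∀ X Y : V →L[ℝ] V, U * X * W * S * (U * Y * W) = U * (X * (W * S * U) * Y) * W := by
    intro X Y; simp only [mul_assoc]
  rw [e1, e1, ← add_mul, ← mul_add]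
  congr 2
  set T := W * S * U
  have hab' : b ^ 2 = 1 - a ^ 2 := by linarith
  simp only [mul_add, add_mul, mul_sub, sub_mul, smul_mul_assoc, mul_smul_comm]
  have h2 : ∀ X : V →L[ℝ] V, b • b • X = X - a • a • X := fun X => by
    rw [smul_smul, smul_smul, show b * b = 1 - a * a by nlinarith]; module
  simp only [smul_add, smul_sub, h2]
  module

/-- The real determinant of a complex matrix is the squared modulus of its complex determinant,
which is `1` on `U*(2m)`. -/
theorem IsUStarRelated.abs_det_eq [FiniteDimensional ℝ V] (h : IsUStarRelated w w' U)
    (w₀ : V ≃L[ℝ] C2 m) :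
    |((w₀.symm : C2 m →L[ℝ] V) ∘L (w' : V →L[ℝ] C2 m)).det| * |U.det|
      = |((w₀.symm : C2 m →L[ℝ] V) ∘L (w : V →L[ℝ] C2 m)).det| := by
  obtain ⟨B, hB, h⟩ := h
  obtain ⟨A, hA, c, hc, rfl⟩ := hB
  set f : C2 m →ₗ[ℂ] C2 m := Matrix.toLin' (c • A) with hf
  have hdet : LinearMap.det (f.restrictScalars ℝ) = 1 := by
    rw [LinearMap.det_restrictScalars, hf, LinearMap.det_toLin', Matrix.det_smul, hA.1,
      Algebra.norm_complex_eq]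
    simp [Complex.normSq_eq_norm_sq, hc]
  have h1 : (w₀.symm : C2 m →L[ℝ] V) ∘L (w' : V →L[ℝ] C2 m) ∘L U
      = ((w₀.symm : C2 m →L[ℝ] V) ∘L (LinearMap.toContinuousLinearMap (f.restrictScalars ℝ))
        ∘L (w₀ : V →L[ℝ] C2 m)) ∘L ((w₀.symm : C2 m →L[ℝ] V) ∘L (w : V →L[ℝ] C2 m)) := by
    ext x
    simp [h, hf, Matrix.smul_mulVec]
  have h3 : LinearMap.det (((w₀.symm : C2 m →L[ℝ] V) ∘L
      (LinearMap.toContinuousLinearMap (f.restrictScalars ℝ)) ∘L (w₀ : V →L[ℝ] C2 m) :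
        V →L[ℝ] V) : V →ₗ[ℝ] V) = 1 := by
    rw [← hdet, ← LinearMap.det_conj (f.restrictScalars ℝ) w₀.symm.toLinearEquiv]
    rfl
  set T' : V →L[ℝ] V := (w₀.symm : C2 m →L[ℝ] V) ∘L (w' : V →L[ℝ] C2 m)
  set T : V →L[ℝ] V := (w₀.symm : C2 m →L[ℝ] V) ∘L (w : V →L[ℝ] C2 m)
  have h4 : LinearMap.det ((T' : V →ₗ[ℝ] V) ∘ₗ (U : V →ₗ[ℝ] V)) = LinearMap.det (T : V →ₗ[ℝ] V) := by
    have h5 := congrArg (fun T : V →L[ℝ] V => LinearMap.det (T : V →ₗ[ℝ] V)) h1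
    refine h5.trans ?_
    change LinearMap.det (LinearMap.comp _ (T : V →ₗ[ℝ] V)) = _
    rw [LinearMap.det_comp, h3, one_mul]
  rw [LinearMap.det_comp] at h4
  change |LinearMap.det (T' : V →ₗ[ℝ] V)| * |LinearMap.det (U : V →ₗ[ℝ] V)|
    = |LinearMap.det (T : V →ₗ[ℝ] V)|
  rw [← h4, abs_mul]

end Related

/-- The infinitesimal version of the invariance of `frameQ`. -/
theorem exists_commutator_frameJ [Nontrivial V] (w : V ≃L[ℝ] C2 m) {A : V →L[ℝ] V}
    (hI : A * frameI w = frameI w * A)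
    (hQ : ∀ S, A * frameQ w S - frameQ w S * A = frameQ w (A * S - S * A)) :
    ∃ t : ℝ, A * frameJ w - frameJ w * A = t • (frameI w * frameJ w) := by
  set I := frameI w with hIdef
  set J := frameJ w with hJdef
  set D := A * J - J * A with hD
  have hII : I * I = -1 := frameI_mul_frameI w
  have hJJ : J * J = -1 := frameJ_mul_frameJ w
  have hJI : J * I = -(I * J) := frameJ_mul_frameI w
  have hID : A * (I * J) - (I * J) * A = I * D := by
    rw [hD, mul_sub, ← mul_assoc A, hI]; simp only [mul_assoc]
  -- This is the Leibniz rule for `ad A` applied to `JSJ + KSK`, with `[A,K] = I[A,J]` because `A`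
  -- commutes with `I`.
  have key : ∀ S, D * S * J + J * S * D + (I * D) * S * (I * J) + (I * J) * S * (I * D) = 0 := by
    intro S
    have h1 := hQ S
    rw [frameQ_apply, frameQ_apply] at h1
    rw [← hID, hD]
    rw [← sub_eq_zero] at h1
    rw [← h1]
    noncomm_ring
  have hJinj : ∀ x, J (J x) = -x := fun x => by
    simpa using congrArg (fun f : V →L[ℝ] V => f x) hJJ
  have hIinj : ∀ x, I (I x) = -x := fun x => by
    simpa using congrArg (fun f : V →L[ℝ] V => f x) hII
  obtain ⟨b, hb⟩ := exists_ne (0 : V)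
  -- a functional with `φ (J b) = 1` and `φ (K b) = 0`
  obtain ⟨φ, hφ1, hφ2⟩ : ∃ φ : V →L[ℝ] ℝ, φ (J b) = 1 ∧ φ (I (J b)) = 0 := by
    have hJb : J b ≠ 0 := fun h => hb (by simpa [h] using hJinj b)
    have hwJb : w (J b) ≠ 0 := fun h => hJb (w.injective (by rw [h, map_zero]))
    obtain ⟨k, hk⟩ := Function.ne_iff.1 hwJb
    have hk : w (J b) k ≠ 0 := hk
    refine ⟨Complex.reCLM ∘L (((w (J b) k)⁻¹ • ContinuousLinearMap.id ℂ ℂ).restrictScalars ℝ) ∘L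
      (ContinuousLinearMap.proj k) ∘L (w : V →L[ℝ] C2 m), ?_, ?_⟩
    · simp [hk]
    · have : (w (J b) k)⁻¹ * (Complex.I * w (J b) k) = Complex.I := by field_simp
      simp [I, this]
  -- Testing `key` on the rank-one maps `φ ⊗ a`, evaluated at `b`, shows that `D` is a combination
  -- of `J` and `K`.
  have hDa : ∀ a, D a = (-(φ (D b))) • J a + (-(φ (I (D b)))) • I (J a) := by
    intro a
    have h1 := congrArg (fun f : V →L[ℝ] V => f b) (key (φ.smulRight a))
    simp [hφ1, hφ2] at h1
    linear_combination (norm := module) h1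
  set p := -(φ (D b))
  set q := -(φ (I (D b)))
  have hDe : D = p • J + q • (I * J) := by
    ext a; simp [hDa]
  have hIIJ : I * (I * J) = -J := by rw [← mul_assoc, hII]; simp
  have hKK : (I * J) * (I * J) = -1 := by
    rw [mul_assoc, ← mul_assoc J, hJI, neg_mul, mul_neg, mul_assoc I J J, hJJ]
    simp [hII]
  have hp : p = 0 := by
    have h1 := key 1
    rw [hDe] at h1
    simp only [mul_one, mul_add, mul_smul_comm, hIIJ, add_mul, smul_mul_assoc, hJJ, hKK, neg_mul,
      mul_neg] at h1
    have h2 : (-4 * p) • (1 : V →L[ℝ] V) = 0 := by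
      linear_combination (norm := module) h1
    have := (smul_eq_zero.1 h2).resolve_right one_ne_zero
    linarith
  exact ⟨q, by rw [hDe, hp, zero_smul, zero_add]⟩

/-- `J` is bounded in terms of the rotation invariant endomorphism. -/
theorem norm_frameJ_sq_le {V : Type*} [NormedAddCommGroup V] [InnerProductSpace ℝ V]
    (w : V ≃L[ℝ] C2 m) (a : V) : ‖frameJ w a‖ ^ 2 ≤ ‖frameQ w‖ * ‖a‖ ^ 2 := by
  set J := frameJ w
  set K := frameI w * frameJ w with hK
  -- For this `φ` the vector `Q(φ ⊗ a) a = φ(Ja) Ja + φ(Ka) Ka` pairs with `Ja` to at least `‖Ja‖⁴`,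
  -- so no cancellation between `J` and `K` can occur.
  let φ : V →L[ℝ] ℝ := realInnerL V (J a)
  have h1 : frameQ w (φ.smulRight a) a = φ (J a) • J a + φ (K a) • K a := by
    rw [frameQ_apply]; simp [hK, J]
  have h2 : ‖frameQ w (φ.smulRight a) a‖ ≤ ‖frameQ w‖ * (‖J a‖ * ‖a‖) * ‖a‖ := by
    refine (ContinuousLinearMap.le_opNorm _ _).trans ?_
    gcongr
    refine (ContinuousLinearMap.le_opNorm _ _).trans ?_
    gcongr
    rw [ContinuousLinearMap.norm_smulRight_apply]
    gcongr
    exact ContinuousLinearMap.opNorm_le_bound _ (norm_nonneg _) fun x => norm_inner_le_norm _ _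
  have h3 : φ (frameQ w (φ.smulRight a) a) = ‖J a‖ ^ 4 + (φ (K a)) ^ 2 := by
    rw [h1]
    simp only [map_add, map_smul, smul_eq_mul]
    have : φ (J a) = ‖J a‖ ^ 2 := real_inner_self_eq_norm_sq _
    rw [this]; ring
  have h4 : φ (frameQ w (φ.smulRight a) a) ≤ ‖J a‖ * (‖frameQ w‖ * (‖J a‖ * ‖a‖) * ‖a‖) :=
    (real_inner_le_norm _ _).trans (by gcongr)
  rw [h3] at h4
  by_cases h5 : ‖J a‖ = 0
  · rw [h5]; simp; positivity
  · have h6 : 0 < ‖J a‖ ^ 2 := by positivity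
    have h7 : ‖J a‖ ^ 2 * ‖J a‖ ^ 2 ≤ ‖J a‖ ^ 2 * (‖frameQ w‖ * ‖a‖ ^ 2) := by
      nlinarith [sq_nonneg (φ (K a))]
    exact le_of_mul_le_mul_left h7 h6

end Frames

/-! ### Real and complex traces in a frame -/

section FrameTraces

variable {m : ℕ} {V : Type*} [AddCommGroup V] [Module ℝ V] [TopologicalSpace V]

/-- The trace of a real endomorphism, computed in a complex frame. -/
theorem trace_eq_sum_frame (w : V ≃L[ℝ] C2 m) (T : Module.End ℝ V) :
    LinearMap.trace ℝ V T = ∑ p : (Fin m ⊕ Fin m) × Fin 2,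
      (starRingEnd ℂ ((![1, Complex.I] : Fin 2 → ℂ) p.2) *
        w (T (w.symm (Pi.single p.1 ((![1, Complex.I] : Fin 2 → ℂ) p.2)))) p.1).re := by
  let b : Module.Basis (Σ _ : Fin m ⊕ Fin m, Fin 2) ℝ (C2 m) := Pi.basis fun _ => Complex.basisOneI
  rw [← LinearMap.trace_conj' T w.toLinearEquiv, LinearMap.trace_eq_matrix_trace ℝ b,
    Matrix.trace, Fintype.sum_sigma, Fintype.sum_prod_type]
  refine Finset.sum_congr rfl fun k _ => ?_
  rw [Fin.sum_univ_two, Fin.sum_univ_two]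
  simp [LinearMap.toMatrix_apply, b, Pi.basis_apply, Pi.basis_repr, LinearEquiv.conj_apply]

/-- The complex trace of an endomorphism, computed in a complex frame. -/
def complexTrace (w : V ≃L[ℝ] C2 m) (T : Module.End ℝ V) : ℂ :=
  ∑ k, w (T (w.symm (Pi.single k 1))) k

theorem apply_symm_I_smul (w : V ≃L[ℝ] C2 m) (T : Module.End ℝ V)
    (hT : ∀ x, T (frameI w x) = frameI w (T x)) (v : C2 m) :
    w (T (w.symm (Complex.I • v))) = Complex.I • w (T (w.symm v)) := by
  have h1 : w.symm (Complex.I • v) = frameI w (w.symm v) := by simp [frameI]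
  rw [h1, hT, apply_frameI]

theorem two_mul_re_complexTrace (w : V ≃L[ℝ] C2 m) (T : Module.End ℝ V)
    (hT : ∀ x, T (frameI w x) = frameI w (T x)) :
    2 * (complexTrace w T).re = LinearMap.trace ℝ V T := by
  rw [trace_eq_sum_frame w, Fintype.sum_prod_type, complexTrace, Complex.re_sum, Finset.mul_sum]
  refine Finset.sum_congr rfl fun k _ => ?_
  rw [Fin.sum_univ_two]
  have h1 : (Pi.single k Complex.I : C2 m) = Complex.I • Pi.single k 1 := by
    rw [← Pi.single_smul']; simp
  simp only [Matrix.cons_val_zero, Matrix.cons_val_one, h1, apply_symm_I_smul w T hT, map_one,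
    one_mul, Complex.conj_I, Pi.smul_apply, smul_eq_mul]
  rw [← mul_assoc]
  simp
  ring

theorem two_mul_im_complexTrace (w : V ≃L[ℝ] C2 m) (T : Module.End ℝ V)
    (hT : ∀ x, T (frameI w x) = frameI w (T x)) :
    2 * (complexTrace w T).im = -LinearMap.trace ℝ V ((frameI w : V →ₗ[ℝ] V) ∘ₗ T) := by
  rw [← two_mul_re_complexTrace w ((frameI w : V →ₗ[ℝ] V) ∘ₗ T) (fun x => by simp [hT])]
  have h1 : complexTrace w ((frameI w : V →ₗ[ℝ] V) ∘ₗ T) = Complex.I * complexTrace w T := by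
    rw [complexTrace, complexTrace, Finset.mul_sum]
    exact Finset.sum_congr rfl fun k _ => by simp
  rw [h1]
  simp

section RicciTrace

/-- The Ricci tensor as a bilinear form. -/
def ricciForm₂ {V : Type*} [AddCommGroup V] [Module ℝ V]
    (R : V →ₗ[ℝ] V →ₗ[ℝ] Module.End ℝ V) : V →ₗ[ℝ] V →ₗ[ℝ] ℝ :=
  LinearMap.mk₂ ℝ (ricciTrace R)
    (fun Y Y' Z => by
      simp only [ricciTrace]; rw [← map_add]; congr 1; ext; simp)
    (fun c Y Z => by
      simp only [ricciTrace]; rw [← map_smul]; congr 1; ext; simp)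
    (fun Y Z Z' => by
      simp only [ricciTrace]; rw [← map_add]; congr 1; ext; simp)
    (fun c Y Z => by
      simp only [ricciTrace]; rw [← map_smul]; congr 1; ext; simp)

theorem ricciForm₂_apply {V : Type*} [AddCommGroup V] [Module ℝ V]
    (R : V →ₗ[ℝ] V →ₗ[ℝ] Module.End ℝ V) (Y Z : V) :
    ricciForm₂ R Y Z = ricciTrace R Y Z := rfl

/-- This matches the double sum in `scalarCurvature` with a trace of the Ricci tensor: the sum over
`p` is the trace that defines `ricciTrace`. -/
theorem sum_ricciTrace_frame (R : V →ₗ[ℝ] V →ₗ[ℝ] Module.End ℝ V) (w : V ≃L[ℝ] C2 m) :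
    ∑ p : (Fin m ⊕ Fin m) × Fin 2, ∑ q : (Fin m ⊕ Fin m) × Fin 2,
      (starRingEnd ℂ ((![1, Complex.I] : Fin 2 → ℂ) p.2) *
        w (R (w.symm (Pi.single p.1 ((![1, Complex.I] : Fin 2 → ℂ) p.2)))
          (w.symm (Pi.single q.1 ((![1, Complex.I] : Fin 2 → ℂ) q.2)))
          (w.symm (Pi.single q.1 ((![1, Complex.I] : Fin 2 → ℂ) q.2)))) p.1).re
      = ∑ q : (Fin m ⊕ Fin m) × Fin 2,
        ricciTrace R (w.symm (Pi.single q.1 ((![1, Complex.I] : Fin 2 → ℂ) q.2)))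
          (w.symm (Pi.single q.1 ((![1, Complex.I] : Fin 2 → ℂ) q.2))) := by
  rw [Finset.sum_comm]
  refine Finset.sum_congr rfl fun q _ => ?_
  rw [ricciTrace, trace_eq_sum_frame w]
  rfl

end RicciTrace

/-- In the quaternionic line, the quaternionic average of a symmetric form is proportional to its
trace. -/
theorem average_eq_zero_of_trace_eq_zero (w : V ≃L[ℝ] C2 1) (B : V →ₗ[ℝ] V →ₗ[ℝ] ℝ)
    (hB : ∀ x y, B x y = B y x)
    (htr : ∑ q : (Fin 1 ⊕ Fin 1) × Fin 2,
      B (w.symm (Pi.single q.1 ((![1, Complex.I] : Fin 2 → ℂ) q.2)))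
        (w.symm (Pi.single q.1 ((![1, Complex.I] : Fin 2 → ℂ) q.2))) = 0) (v : V) :
    B v v + B (frameI w v) (frameI w v) + B (frameJ w v) (frameJ w v)
      + B (frameI w (frameJ w v)) (frameI w (frameJ w v)) = 0 := by
  set I := frameI w with hI
  set J := frameJ w with hJ
  set f : V := w.symm (Pi.single (Sum.inl 0) 1) with hf
  have e1 : w.symm (Pi.single (Sum.inl 0) Complex.I) = I f := by
    apply w.injective
    simp [hI, hf, ← Pi.single_smul']
  have e2 : w.symm (Pi.single (Sum.inr 0) 1) = -J f := by
    apply w.injective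
    rw [map_neg, hJ, apply_frameJ, hf]
    funext k
    rcases k with k | k <;> simp [quatMap, Fin.eq_zero k]
  have e3 : w.symm (Pi.single (Sum.inr 0) Complex.I) = -I (J f) := by
    have : (Pi.single (Sum.inr 0) Complex.I : C2 1) = Complex.I • Pi.single (Sum.inr 0) 1 := by
      rw [← Pi.single_smul']; simp
    rw [this]
    apply w.injective
    rw [w.apply_symm_apply, map_neg, hI, apply_frameI, ← smul_neg, ← map_neg, ← e2,
      w.apply_symm_apply]
  have hsum : B f f + B (I f) (I f) + B (J f) (J f) + B (I (J f)) (I (J f)) = 0 := by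
    rw [Fintype.sum_prod_type, Fintype.sum_sum_type] at htr
    simp only [Finset.univ_unique, Fin.default_eq_zero, Finset.sum_singleton, Fin.sum_univ_two,
      Matrix.cons_val_zero, Matrix.cons_val_one, e1, e2, e3, map_neg, LinearMap.neg_apply,
      neg_neg, ← hf] at htr
    linarith
  -- Every vector is a quaternionic multiple of `f`. In the average over `v, Iv, Jv, Kv` the mixed
  -- terms cancel, leaving `a² + b² + c² + d²` times the value at `f`.
  obtain ⟨a, b, c, d, hv⟩ : ∃ a b c d : ℝ, v = a • f + b • I f + c • J f + d • I (J f) := by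
    refine ⟨(w v (Sum.inl 0)).re, (w v (Sum.inl 0)).im, -(w v (Sum.inr 0)).re,
      -(w v (Sum.inr 0)).im, ?_⟩
    have e2' : J f = - w.symm (Pi.single (Sum.inr 0) 1) := by rw [e2, neg_neg]
    have e3' : I (J f) = - w.symm (Pi.single (Sum.inr 0) Complex.I) := by rw [e3, neg_neg]
    rw [e2', ← e2', e3', e2', ← e1, hf]
    apply w.injective
    funext k
    rcases k with k | k <;> simp [Fin.eq_zero k, Complex.re_add_im]
  have hII : ∀ x, I (I x) = -x := frameI_frameI w
  have hJJ : ∀ x, J (J x) = -x := frameJ_frameJ w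
  have hJI : ∀ x, J (I x) = -I (J x) := frameJ_frameI w
  rw [hv]
  simp only [map_add, map_smul, map_neg, hJI, hII, hJJ, LinearMap.add_apply, LinearMap.smul_apply,
    LinearMap.neg_apply, smul_eq_mul, neg_neg, smul_neg]
  rw [hB (I f) f, hB (J f) f, hB (I (J f)) f, hB (J f) (I f), hB (I (J f)) (I f),
    hB (I (J f)) (J f)]
  linear_combination (a ^ 2 + b ^ 2 + c ^ 2 + d ^ 2) * hsum

end FrameTraces

/-! ### Complex frames and changes of frame -/

section ComplexFrames

variable {m : ℕ} {E : Type*} [NormedAddCommGroup E] [NormedSpace ℝ E]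
  {M : Type*} [TopologicalSpace M] [ChartedSpace E M]

theorem isComplexFrame_frame {x : M} (w : TangentSpace 𝓘(ℝ, E) x ≃L[ℝ] C2 m) :
    IsComplexFrame (frameI w) (fun k => w.symm (Pi.single k 1)) := by
  let b : Module.Basis (Σ _ : Fin m ⊕ Fin m, Fin 2) ℝ (C2 m) := Pi.basis fun _ => Complex.basisOneI
  let e : (Fin m ⊕ Fin m) ⊕ (Fin m ⊕ Fin m) ≃ (Σ _ : Fin m ⊕ Fin m, Fin 2) :=
    { toFun := Sum.elim (fun k => ⟨k, 0⟩) (fun k => ⟨k, 1⟩)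
      invFun := fun p => if p.2 = 0 then Sum.inl p.1 else Sum.inr p.1
      left_inv := by rintro (k | k) <;> simp
      right_inv := by rintro ⟨k, i⟩; fin_cases i <;> simp }
  let b' := (b.reindex e.symm).map w.symm.toLinearEquiv
  have h : Sum.elim (fun k => w.symm (Pi.single k 1))
      (fun k => frameI w (w.symm (Pi.single k 1))) = b' := by
    funext k
    apply w.injective
    rcases k with k | k <;> simp [b', b, e, Pi.basis_apply, ← Pi.single_smul']
  refine ⟨?_, ?_⟩
  · rw [h]; exact b'.linearIndependent
  · rw [h]; exact b'.span_eq

/-- The matrix of a change of complex frame. -/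
def frameChange {V : Type*} [AddCommGroup V] [Module ℝ V] [TopologicalSpace V]
    (w w' : V ≃L[ℝ] C2 m) : Matrix (Fin m ⊕ Fin m) (Fin m ⊕ Fin m) ℂ :=
  Matrix.of fun i j => w (w'.symm (Pi.single j 1)) i

theorem complexComb_frame {x : M} (w : TangentSpace 𝓘(ℝ, E) x ≃L[ℝ] C2 m)
    (A : Matrix (Fin m ⊕ Fin m) (Fin m ⊕ Fin m) ℂ) (j : Fin m ⊕ Fin m) :
    complexComb (frameI w) (fun k => w.symm (Pi.single k 1)) A j = w.symm (fun i => A i j) := by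
  apply w.injective
  simp only [complexComb, map_sum, map_add, map_smul, apply_frameI, w.apply_symm_apply]
  funext i
  rw [Finset.sum_apply, Finset.sum_eq_single i]
  · simp [mul_comm Complex.I, Complex.re_add_im]
  · intro k _ hk
    simp [Pi.single_eq_of_ne hk.symm]
  · simp

theorem complexComb_frameChange {x : M} (w w' : TangentSpace 𝓘(ℝ, E) x ≃L[ℝ] C2 m) :
    complexComb (frameI w) (fun k => w.symm (Pi.single k 1)) (frameChange w w')
      = fun j => w'.symm (Pi.single j 1) := by
  funext j
  rw [complexComb_frame]
  apply w.injective
  simp only [w.apply_symm_apply]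
  rfl

/-- The modulus of the determinant of a change of complex frame. -/
theorem norm_det_frameChange_sq {V : Type*} [AddCommGroup V] [Module ℝ V] [TopologicalSpace V]
    {w w' : V ≃L[ℝ] C2 m} (h : frameI w = frameI w') :
    ‖(frameChange w w').det‖ ^ 2
      = LinearMap.det ((w'.symm.trans w : C2 m ≃L[ℝ] C2 m) : C2 m →ₗ[ℝ] C2 m) := by
  set f : C2 m →ₗ[ℂ] C2 m := Matrix.toLin' (frameChange w w') with hf
  have h1 : f.restrictScalars ℝ = ((w'.symm.trans w : C2 m ≃L[ℝ] C2 m) : C2 m →ₗ[ℝ] C2 m) := by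
    have hI : ∀ v, w (w'.symm (Complex.I • v)) = Complex.I • w (w'.symm v) := by
      intro v
      have h2 : w'.symm (Complex.I • v) = frameI w' (w'.symm v) := by simp [frameI]
      rw [h2, ← h, apply_frameI]
    let g : C2 m →ₗ[ℂ] C2 m :=
      { toFun := fun v => w (w'.symm v)
        map_add' := fun v v' => by simp
        map_smul' := fun c v => by
          have h3 : c • v = c.re • v + c.im • (Complex.I • v) := by
            rw [← Complex.coe_smul, ← Complex.coe_smul, smul_smul, ← add_smul, Complex.re_add_im]
          rw [h3]
          simp only [map_add, map_smul, hI, RingHom.id_apply]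
          rw [← Complex.coe_smul, ← Complex.coe_smul, smul_smul, ← add_smul, Complex.re_add_im] }
    have h4 : f = g := by
      refine (Pi.basisFun ℂ (Fin m ⊕ Fin m)).ext fun j => ?_
      funext i
      simp [hf, g, frameChange]
    rw [h4]
    rfl
  rw [← h1, LinearMap.det_restrictScalars, hf, LinearMap.det_toLin', Algebra.norm_complex_eq]
  exact (Complex.normSq_eq_norm_sq _).symm

end ComplexFrames

/-! ### Connection forms on an open set and their parallel fields -/

section LocalConnection

open Set Filter Topology

variable {E : Type*} [NormedAddCommGroup E] [NormedSpace ℝ E]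

/-- The curvature `R(X,Y) = ∂_X Γ_Y - ∂_Y Γ_X + [Γ_X, Γ_Y]` of the connection on the trivial
bundle with connection form `Γ`. -/
def connCurvature (Γ : E → E →L[ℝ] E →L[ℝ] E) (p X Y : E) : E →L[ℝ] E :=
  fderiv ℝ Γ p X Y - fderiv ℝ Γ p Y X + (Γ p X * Γ p Y - Γ p Y * Γ p X)

/-- `connCurvature` as an algebraic curvature tensor. -/
def connCurvatureTensor (Γ : E → E →L[ℝ] E →L[ℝ] E) (p : E) :
    E →ₗ[ℝ] E →ₗ[ℝ] Module.End ℝ E :=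
  LinearMap.mk₂ ℝ (fun X Y => (connCurvature Γ p X Y : E →ₗ[ℝ] E))
    (fun X X' Y => by ext; simp [connCurvature]; abel)
    (fun c X Y => by ext; simp [connCurvature]; module)
    (fun X X' Y => by ext; simp [connCurvature]; abel)
    (fun c X Y => by ext; simp [connCurvature]; module)

@[simp] theorem connCurvatureTensor_apply (Γ : E → E →L[ℝ] E →L[ℝ] E) (p X Y Z : E) :
    connCurvatureTensor Γ p X Y Z = connCurvature Γ p X Y Z := rfl

section Parallel

variable {F : Type*} [NormedAddCommGroup F] [NormedSpace ℝ F]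

/-- A field with values in a representation `ρ` of `𝔤𝔩(E)` that is parallel along all lines is
smooth, parallel, and annihilated by the curvature. -/
theorem contDiffOn_of_parallel {Ω : Set E} (hΩ : IsOpen Ω) {Γ : E → E →L[ℝ] E →L[ℝ] E}
    (hΓ : ContDiffOn ℝ ∞ Γ Ω) (ρ : (E →L[ℝ] E) →L[ℝ] F →L[ℝ] F) {S : E → F}
    (h : ∀ p ∈ Ω, ∀ v, HasDerivAt (fun s : ℝ => S (p + s • v)) (ρ (Γ p v) (S p)) 0) :
    ContDiffOn ℝ ∞ S Ω :=
  contDiffOn_of_lineDeriv hΩ (L := fun p => ρ.comp (Γ p)) (contDiffOn_const.clm_comp hΓ) h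

theorem hasFDerivAt_of_parallel {Ω : Set E} (hΩ : IsOpen Ω) {Γ : E → E →L[ℝ] E →L[ℝ] E}
    (hΓ : ContDiffOn ℝ ∞ Γ Ω) (ρ : (E →L[ℝ] E) →L[ℝ] F →L[ℝ] F) {S : E → F}
    (h : ∀ p ∈ Ω, ∀ v, HasDerivAt (fun s : ℝ => S (p + s • v)) (ρ (Γ p v) (S p)) 0)
    {p : E} (hp : p ∈ Ω) : HasFDerivAt S ((ρ.comp (Γ p)).flip (S p)) p :=
  hasFDerivAt_of_lineDeriv hΩ (L := fun p => ρ.comp (Γ p))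
    (contDiffOn_const.clm_comp hΓ).continuousOn h hp

/-- Differentiating `dS = ρ(Γ) S` once more, the skew part of the second derivative of `S` is `ρ(R)
S` up to sign, and it vanishes by symmetry. The sign in `hρ` says that `-ρ` is a Lie algebra
representation, as it must be for `∇S = dS - ρ(Γ) S`. -/
theorem curvature_apply_parallel {Ω : Set E} (hΩ : IsOpen Ω) {Γ : E → E →L[ℝ] E →L[ℝ] E}
    (hΓ : ContDiffOn ℝ ∞ Γ Ω) (ρ : (E →L[ℝ] E) →L[ℝ] F →L[ℝ] F)
    (hρ : ∀ A B x, ρ A (ρ B x) - ρ B (ρ A x) = -ρ (A * B - B * A) x) {S : E → F}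
    (h : ∀ p ∈ Ω, ∀ v, HasDerivAt (fun s : ℝ => S (p + s • v)) (ρ (Γ p v) (S p)) 0)
    {p : E} (hp : p ∈ Ω) (X Y : E) : ρ (connCurvature Γ p X Y) (S p) = 0 := by
  have hd : ∀ q ∈ Ω, HasFDerivAt S ((ρ.comp (Γ q)).flip (S q)) q :=
    fun q hq => hasFDerivAt_of_parallel hΩ hΓ ρ h hq
  have hΓp : HasFDerivAt Γ (fderiv ℝ Γ p) p :=
    ((hΓ.contDiffAt (hΩ.mem_nhds hp)).differentiableAt (by simp)).hasFDerivAt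
  have h2 : ∀ Z, HasFDerivAt (fun q => fderiv ℝ S q Z)
      ((ρ (Γ p Z)).comp ((ρ.comp (Γ p)).flip (S p)) +
        (ContinuousLinearMap.apply ℝ F (S p)).comp
          (ρ.comp ((ContinuousLinearMap.apply ℝ (E →L[ℝ] E) Z).comp (fderiv ℝ Γ p)))) p := by
    intro Z
    have h3 : HasFDerivAt (fun q => ρ (Γ q Z))
        (ρ.comp ((ContinuousLinearMap.apply ℝ (E →L[ℝ] E) Z).comp (fderiv ℝ Γ p))) p :=
      ρ.hasFDerivAt.comp p (((ContinuousLinearMap.apply ℝ (E →L[ℝ] E) Z).hasFDerivAt).comp p hΓp)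
    have h4 := h3.clm_apply (hd p hp)
    refine (h4.congr_fderiv ?_).congr_of_eventuallyEq ?_
    · ext v; simp
    · filter_upwards [hΩ.mem_nhds hp] with q hq
      rw [(hd q hq).fderiv]
      simp
  have hS : ContDiffAt ℝ ∞ S p := (contDiffOn_of_parallel hΩ hΓ ρ h).contDiffAt (hΩ.mem_nhds hp)
  have hsymm := hS.isSymmSndFDerivAt (by simp; exact WithTop.coe_le_coe.2 le_top)
  have hdd : DifferentiableAt ℝ (fderiv ℝ S) p :=
    (hS.fderiv_right (m := 1) (by norm_cast)).differentiableAt (by simp)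
  have h5 : ∀ Z v, fderiv ℝ (fderiv ℝ S) p v Z
      = ρ (Γ p Z) (ρ (Γ p v) (S p)) + ρ (fderiv ℝ Γ p v Z) (S p) := by
    intro Z v
    have h6 : HasFDerivAt (fun q => fderiv ℝ S q Z)
        ((ContinuousLinearMap.apply ℝ F Z).comp (fderiv ℝ (fderiv ℝ S) p)) p :=
      ((ContinuousLinearMap.apply ℝ F Z).hasFDerivAt).comp p hdd.hasFDerivAt
    have h7 := congrArg (fun L : E →L[ℝ] F => L v) (h6.unique (h2 Z))
    simpa using h7
  have h8 := hsymm X Y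
  rw [h5, h5] at h8
  have h9 := hρ (Γ p X) (Γ p Y) (S p)
  simp only [connCurvature, map_add, map_sub, add_apply, sub_apply] at h9 ⊢
  linear_combination (norm := module) h8 + h9

end Parallel

section Adjoint

variable {𝔸 : Type*} [NormedRing 𝔸] [NormedAlgebra ℝ 𝔸]

variable (𝔸) in
/-- The opposite of the adjoint action, `A ↦ (S ↦ S A - A S)`. -/
def negAd : 𝔸 →L[ℝ] 𝔸 →L[ℝ] 𝔸 :=
  (ContinuousLinearMap.mul ℝ 𝔸).flip - ContinuousLinearMap.mul ℝ 𝔸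

@[simp] theorem negAd_apply (A S : 𝔸) : negAd 𝔸 A S = S * A - A * S := by
  simp [negAd]

theorem negAd_commutator (A B S : 𝔸) :
    negAd 𝔸 A (negAd 𝔸 B S) - negAd 𝔸 B (negAd 𝔸 A S) = -negAd 𝔸 (A * B - B * A) S := by
  simp only [negAd_apply]
  noncomm_ring

end Adjoint

variable [FiniteDimensional ℝ E]

variable (E) in
/-- The trace as a continuous linear form. -/
def traceL : (E →L[ℝ] E) →L[ℝ] ℝ :=
  LinearMap.toContinuousLinearMap
    ((LinearMap.trace ℝ E) ∘ₗ (ContinuousLinearMap.coeLM ℝ : (E →L[ℝ] E) →ₗ[ℝ] (E →ₗ[ℝ] E)))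

@[simp] theorem traceL_apply (A : E →L[ℝ] E) :
    traceL E A = LinearMap.trace ℝ E (A : E →ₗ[ℝ] E) := rfl

theorem traceL_mul_comm (A B : E →L[ℝ] E) : traceL E (A * B) = traceL E (B * A) :=
  LinearMap.trace_mul_comm ℝ (A : E →ₗ[ℝ] E) (B : E →ₗ[ℝ] E)

variable {m : ℕ}

/-- A frame field that is parallel up to `U*(2m)`, for the connection form `Γ`. -/
def IsUStarParallel (Γ : E → E →L[ℝ] E →L[ℝ] E) (w : E → E ≃L[ℝ] C2 m) (Ω : Set E) : Prop :=
  ∀ p ∈ Ω, ∀ v, ∃ U : ℝ → E →L[ℝ] E, U 0 = 1 ∧ HasDerivAt U (-(Γ p v)) 0 ∧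
    ∀ᶠ s in 𝓝 (0 : ℝ), IsUStarRelated (w p) (w (p + s • v)) (U s)

section UStarParallel

variable {Γ : E → E →L[ℝ] E →L[ℝ] E} {w : E → E ≃L[ℝ] C2 m} {Ω : Set E}

theorem exists_inverse_curve {U : ℝ → E →L[ℝ] E} {A : E →L[ℝ] E} (h0 : U 0 = 1)
    (hU : HasDerivAt U (-A) 0) :
    ∃ W : ℝ → E →L[ℝ] E, W 0 = 1 ∧ HasDerivAt W A 0 ∧ ∀ᶠ s in 𝓝 (0 : ℝ), U s * W s = 1 := by
  have : CompleteSpace E := FiniteDimensional.complete ℝ E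
  refine ⟨fun s => Ring.inverse (U s), by simp [h0], ?_, ?_⟩
  · have h1 := hasFDerivAt_ringInverse (𝕜 := ℝ) (1 : (E →L[ℝ] E)ˣ)
    have h2 : HasDerivAt (fun s => Ring.inverse (U s)) _ 0 :=
      HasFDerivAt.comp_hasDerivAt (l := Ring.inverse) 0 (by rw [h0]; exact h1) hU
    simpa using h2
  · have h1 : ∀ᶠ A : E →L[ℝ] E in 𝓝 1, IsUnit A := Units.nhds (1 : (E →L[ℝ] E)ˣ)
    have h2 : Tendsto U (𝓝 0) (𝓝 1) := by have := hU.continuousAt.tendsto; rwa [h0] at this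
    filter_upwards [h2.eventually h1] with s hs
    exact Ring.mul_inverse_cancel _ hs

theorem IsUStarParallel.frameI_lineDeriv (hw : IsUStarParallel Γ w Ω) {p : E} (hp : p ∈ Ω)
    (v : E) : HasDerivAt (fun s : ℝ => frameI (w (p + s • v)))
      (negAd (E →L[ℝ] E) (Γ p v) (frameI (w p))) 0 := by
  obtain ⟨U, hU0, hU, hrel⟩ := hw p hp v
  obtain ⟨W, hW0, hW, hUW⟩ := exists_inverse_curve hU0 hU
  have h1 := (hU.mul_const (frameI (w p))).mul hW
  refine (h1.congr_deriv ?_).congr_of_eventuallyEq ?_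
  · rw [hU0, hW0]; simp; abel
  · filter_upwards [hrel, hUW] with s h2 h3
    exact h2.frameI_eq h3

/-- Along a line `frameQ` is conjugated by the operator `S ↦ U S W` on endomorphisms, by rotation
invariance. The derivative is therefore a commutator one level up, with the adjoint action of `Γ`.
-/
theorem IsUStarParallel.frameQ_lineDeriv (hw : IsUStarParallel Γ w Ω) {p : E} (hp : p ∈ Ω)
    (v : E) : HasDerivAt (fun s : ℝ => frameQ (w (p + s • v)))
      (negAd ((E →L[ℝ] E) →L[ℝ] (E →L[ℝ] E)) (-negAd (E →L[ℝ] E) (Γ p v)) (frameQ (w p))) 0 := by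
  obtain ⟨U, hU0, hU, hrel⟩ := hw p hp v
  obtain ⟨W, hW0, hW, hUW⟩ := exists_inverse_curve hU0 hU
  let LM := ContinuousLinearMap.mul ℝ (E →L[ℝ] E)
  have hLU : HasDerivAt (fun s => LM (U s)) (LM (-(Γ p v))) 0 :=
    LM.hasFDerivAt.comp_hasDerivAt 0 hU
  have hLW : HasDerivAt (fun s => LM (W s)) (LM (Γ p v)) 0 :=
    LM.hasFDerivAt.comp_hasDerivAt 0 hW
  have hRU : HasDerivAt (fun s => LM.flip (U s)) (LM.flip (-(Γ p v))) 0 :=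
    LM.flip.hasFDerivAt.comp_hasDerivAt 0 hU
  have hRW : HasDerivAt (fun s => LM.flip (W s)) (LM.flip (Γ p v)) 0 :=
    LM.flip.hasFDerivAt.comp_hasDerivAt 0 hW
  have h1 := ((hLU.mul hRW).mul_const (frameQ (w p))).mul (hLW.mul hRU)
  refine (h1.congr_deriv ?_).congr_of_eventuallyEq ?_
  · ext S x
    simp [LM, hU0, hW0]
    abel
  · filter_upwards [hrel, hUW] with s h2 h3
    ext1 S
    rw [h2.frameQ_eq h3]
    simp [LM, mul_assoc]

/-- The density of a frame field relative to a fixed frame. -/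
def frameDensity {E : Type*} [NormedAddCommGroup E] [NormedSpace ℝ E]
    (w₀ w : E ≃L[ℝ] C2 m) : ℝ :=
  |((w₀.symm : C2 m →L[ℝ] E) ∘L (w : E →L[ℝ] C2 m)).det|

theorem frameDensity_pos {E : Type*} [NormedAddCommGroup E] [NormedSpace ℝ E]
    (w₀ w : E ≃L[ℝ] C2 m) : 0 < frameDensity w₀ w := by
  refine abs_pos.2 ?_
  have : IsUnit (LinearMap.det ((w.trans w₀.symm).toLinearEquiv : E →ₗ[ℝ] E)) :=
    LinearEquiv.isUnit_det' _
  exact this.ne_zero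

/-- The product of the density with `|det U(s)|` is constant along the line, and `det U` has
derivative `-tr Γ(v)` at `0`. -/
theorem IsUStarParallel.frameDensity_lineDeriv (hw : IsUStarParallel Γ w Ω) (w₀ : E ≃L[ℝ] C2 m)
    {p : E} (hp : p ∈ Ω) (v : E) : HasDerivAt (fun s : ℝ => frameDensity w₀ (w (p + s • v)))
      ((ContinuousLinearMap.mul ℝ ℝ ∘L traceL E) (Γ p v) (frameDensity w₀ (w p))) 0 := by
  obtain ⟨U, hU0, hU, hrel⟩ := hw p hp v
  obtain ⟨D, hD, htr⟩ := hasFDerivAt_det_one (E := E)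
  have h1 : HasDerivAt (fun s => (U s).det) (D (-(Γ p v))) 0 :=
    HasFDerivAt.comp_hasDerivAt (l := fun A : E →L[ℝ] E => A.det) 0 (by rw [hU0]; exact hD) hU
  have hdet1 : (U 0).det = 1 := by rw [hU0]; exact LinearMap.det_id
  have h2 := (h1.inv (by rw [hdet1]; exact one_ne_zero)).const_mul (frameDensity w₀ (w p))
  refine (h2.congr_deriv ?_).congr_of_eventuallyEq ?_
  · rw [hdet1, htr]; simp; ring
  · have h3 : ∀ᶠ s in 𝓝 (0 : ℝ), 0 < (U s).det :=
      continuousAt_const.eventually_lt h1.continuousAt (by rw [hdet1]; exact one_pos)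
    filter_upwards [hrel, h3] with s h4 h5
    have h6 := h4.abs_det_eq w₀
    rw [abs_of_pos h5] at h6
    simp only [frameDensity]
    rw [← h6]
    simp only [Pi.inv_apply]
    field_simp

end UStarParallel

end LocalConnection

/-! ### Curvature of a local `U*(2m)`-geometry -/

section LocalGeometry

open Set Filter Topology

variable {E : Type*} [NormedAddCommGroup E] [NormedSpace ℝ E] [FiniteDimensional ℝ E] {m : ℕ}

/-- A smooth torsion-free connection form on an open set, with a frame field that is parallel up
to `U*(2m)`. -/
structure IsUStarGeometry {E : Type*} [NormedAddCommGroup E] [NormedSpace ℝ E]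
    (Γ : E → E →L[ℝ] E →L[ℝ] E) (w : E → E ≃L[ℝ] C2 m) (Ω : Set E) :
    Prop where
  isOpen : IsOpen Ω
  smooth : ContDiffOn ℝ ∞ Γ Ω
  symm : ∀ p ∈ Ω, ∀ X Y, Γ p X Y = Γ p Y X
  parallel : IsUStarParallel Γ w Ω

namespace IsUStarGeometry

variable {Γ : E → E →L[ℝ] E →L[ℝ] E} {w : E → E ≃L[ℝ] C2 m} {Ω : Set E}

theorem hasFDerivAt_connection {E : Type*} [NormedAddCommGroup E] [NormedSpace ℝ E]
    {Γ : E → E →L[ℝ] E →L[ℝ] E} {w : E → E ≃L[ℝ] C2 m} {Ω : Set E} (h : IsUStarGeometry Γ w Ω) {p : E} (hp : p ∈ Ω) :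
    HasFDerivAt Γ (fderiv ℝ Γ p) p :=
  ((h.smooth.contDiffAt (h.isOpen.mem_nhds hp)).differentiableAt (by simp)).hasFDerivAt

theorem contDiffOn_frameI (h : IsUStarGeometry Γ w Ω) :
    ContDiffOn ℝ ∞ (fun p => frameI (w p)) Ω :=
  contDiffOn_of_parallel h.isOpen h.smooth (negAd (E →L[ℝ] E))
    fun _ hp v => h.parallel.frameI_lineDeriv hp v

/-- The complex structure is parallel. -/
theorem exists_hasFDerivAt_frameI (h : IsUStarGeometry Γ w Ω) {p : E} (hp : p ∈ Ω) :
    ∃ D : E →L[ℝ] E →L[ℝ] E, HasFDerivAt (fun p => frameI (w p)) D p ∧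
      ∀ X, D X = frameI (w p) * Γ p X - Γ p X * frameI (w p) :=
  ⟨_, hasFDerivAt_of_parallel h.isOpen h.smooth (negAd (E →L[ℝ] E))
    (fun _ hp v => h.parallel.frameI_lineDeriv hp v) hp, fun X => by simp⟩

/-- This continuity yields local bounds on `J` through `norm_frameJ_sq_le`; `J` itself may jump with
the choice of frame. -/
theorem continuousOn_frameQ (h : IsUStarGeometry Γ w Ω) :
    ContinuousOn (fun p => frameQ (w p)) Ω :=
  (contDiffOn_of_parallel h.isOpen h.smooth
    ((negAd ((E →L[ℝ] E) →L[ℝ] (E →L[ℝ] E))) ∘L (-negAd (E →L[ℝ] E)))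
    fun _ hp v => h.parallel.frameQ_lineDeriv hp v).continuousOn

theorem contDiffOn_frameDensity (h : IsUStarGeometry Γ w Ω) (w₀ : E ≃L[ℝ] C2 m) :
    ContDiffOn ℝ ∞ (fun p => frameDensity w₀ (w p)) Ω :=
  contDiffOn_of_parallel h.isOpen h.smooth (ContinuousLinearMap.mul ℝ ℝ ∘L traceL E)
    fun _ hp v => h.parallel.frameDensity_lineDeriv w₀ hp v

theorem exists_hasFDerivAt_frameDensity (h : IsUStarGeometry Γ w Ω) (w₀ : E ≃L[ℝ] C2 m) {p : E}
    (hp : p ∈ Ω) : ∃ D : E →L[ℝ] ℝ, HasFDerivAt (fun p => frameDensity w₀ (w p)) D p ∧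
      ∀ X, D X = frameDensity w₀ (w p) * traceL E (Γ p X) :=
  ⟨_, hasFDerivAt_of_parallel h.isOpen h.smooth (ContinuousLinearMap.mul ℝ ℝ ∘L traceL E)
    (fun _ hp v => h.parallel.frameDensity_lineDeriv w₀ hp v) hp, fun X => by simp [mul_comm]⟩

theorem curvature_comm_frameI (h : IsUStarGeometry Γ w Ω) {p : E} (hp : p ∈ Ω) (X Y : E) :
    connCurvature Γ p X Y * frameI (w p) = frameI (w p) * connCurvature Γ p X Y := by
  have h1 := curvature_apply_parallel (S := fun p => frameI (w p)) h.isOpen h.smooth (negAd (E →L[ℝ] E))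
    negAd_commutator
    (fun _ hp v => h.parallel.frameI_lineDeriv hp v) hp X Y
  rw [negAd_apply, sub_eq_zero] at h1
  exact h1.symm

theorem curvature_comm_frameQ (h : IsUStarGeometry Γ w Ω) {p : E} (hp : p ∈ Ω) (X Y : E)
    (S : E →L[ℝ] E) :
    connCurvature Γ p X Y * frameQ (w p) S - frameQ (w p) S * connCurvature Γ p X Y
      = frameQ (w p) (connCurvature Γ p X Y * S - S * connCurvature Γ p X Y) := by
  set 𝔹 := (E →L[ℝ] E) →L[ℝ] (E →L[ℝ] E)
  have h1 := curvature_apply_parallel (S := fun p => frameQ (w p)) h.isOpen h.smooth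
    ((negAd 𝔹) ∘L (-negAd (E →L[ℝ] E)))
    (fun A B T => by
      have h2 := negAd_commutator (-negAd (E →L[ℝ] E) A) (-negAd (E →L[ℝ] E) B) T
      refine h2.trans ?_
      change _ = - negAd 𝔹 _ T
      congr 3
      ext1 S
      have h3 := negAd_commutator A B S
      simp only [neg_mul_neg, sub_apply, mul_apply_eq_comp]
      exact h3)
    (fun _ hp v => h.parallel.frameQ_lineDeriv hp v) hp X Y
  have h2 := congrArg (fun f : 𝔹 => f S) h1
  change frameQ (w p) (-(negAd (E →L[ℝ] E) (connCurvature Γ p X Y) S)) -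
    -(negAd (E →L[ℝ] E) (connCurvature Γ p X Y) (frameQ (w p) S)) = 0 at h2
  rw [negAd_apply, negAd_apply, neg_sub] at h2
  linear_combination (norm := module) -h2

theorem trace_curvature (h : IsUStarGeometry Γ w Ω) {p : E} (hp : p ∈ Ω) (X Y : E) :
    LinearMap.trace ℝ E (connCurvature Γ p X Y : E →ₗ[ℝ] E) = 0 := by
  have h1 := curvature_apply_parallel (S := fun q => frameDensity (w p) (w q)) h.isOpen h.smooth
    (ContinuousLinearMap.mul ℝ ℝ ∘L traceL E)
    (fun A B T => by
      have h2 := traceL_mul_comm A B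
      simp only [ContinuousLinearMap.comp_apply, ContinuousLinearMap.mul_apply', map_sub, sub_apply]
      rw [h2]; ring)
    (fun _ hp v => h.parallel.frameDensity_lineDeriv (w p) hp v) hp X Y
  simpa [(frameDensity_pos (w p) (w p)).ne'] using h1

theorem fderiv_connection_symm {E : Type*} [NormedAddCommGroup E] [NormedSpace ℝ E]
    {Γ : E → E →L[ℝ] E →L[ℝ] E} {w : E → E ≃L[ℝ] C2 m} {Ω : Set E} (h : IsUStarGeometry Γ w Ω) {p : E} (hp : p ∈ Ω) (X Y Z : E) :
    fderiv ℝ Γ p X Y Z = fderiv ℝ Γ p X Z Y := by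
  have hd := h.hasFDerivAt_connection hp
  have h1 : ∀ Y Z, HasFDerivAt (fun q => Γ q Y Z)
      ((ContinuousLinearMap.apply ℝ E Z) ∘L (ContinuousLinearMap.apply ℝ (E →L[ℝ] E) Y) ∘L
        fderiv ℝ Γ p) p := fun Y Z =>
    (ContinuousLinearMap.apply ℝ E Z).hasFDerivAt.comp p
      ((ContinuousLinearMap.apply ℝ (E →L[ℝ] E) Y).hasFDerivAt.comp p hd)
  have h2 := (h1 Y Z).unique ((h1 Z Y).congr_of_eventuallyEq (by
    filter_upwards [h.isOpen.mem_nhds hp] with q hq using h.symm q hq Y Z))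
  simpa using congrArg (fun f : E →L[ℝ] E => f X) h2

theorem bianchi {E : Type*} [NormedAddCommGroup E] [NormedSpace ℝ E]
    {Γ : E → E →L[ℝ] E →L[ℝ] E} {w : E → E ≃L[ℝ] C2 m} {Ω : Set E} (h : IsUStarGeometry Γ w Ω) {p : E} (hp : p ∈ Ω) (X Y Z : E) :
    connCurvature Γ p X Y Z + connCurvature Γ p Y Z X + connCurvature Γ p Z X Y = 0 := by
  simp only [connCurvature, add_apply, sub_apply, mul_apply_eq_comp]
  rw [h.fderiv_connection_symm hp X Z Y, h.fderiv_connection_symm hp Y X Z,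
    h.fderiv_connection_symm hp Z Y X, h.symm p hp Z Y, h.symm p hp X Z, h.symm p hp Y X]
  abel

/-- The curvature annihilates the parallel fields `I`, `Q` and the density. These give commutation
with `I`, the form of `[R,J]`, and vanishing trace. -/
theorem isQuaternionicCurvature [Nontrivial E] (h : IsUStarGeometry Γ w Ω) {p : E} (hp : p ∈ Ω) :
    IsQuaternionicCurvature (connCurvatureTensor Γ p) (frameI (w p) : E →ₗ[ℝ] E)
      (frameJ (w p) : E →ₗ[ℝ] E) where
  sq_left := LinearMap.ext fun x => frameI_frameI (w p) x
  sq_right := LinearMap.ext fun x => frameJ_frameJ (w p) x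
  anticomm := LinearMap.ext fun x => frameJ_frameI (w p) x
  skew X Y := LinearMap.ext fun x => by simp [connCurvature]; abel
  bianchi X Y Z := h.bianchi hp X Y Z
  trace_eq_zero X Y := h.trace_curvature hp X Y
  comm_left X Y := LinearMap.ext fun x =>
    congrArg (fun f : E →L[ℝ] E => f x) (h.curvature_comm_frameI hp X Y)
  comm_right X Y := by
    obtain ⟨t, ht⟩ := exists_commutator_frameJ (w p) (h.curvature_comm_frameI hp X Y)
      (h.curvature_comm_frameQ hp X Y)
    exact ⟨t, LinearMap.ext fun x => congrArg (fun f : E →L[ℝ] E => f x) ht⟩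

end IsUStarGeometry

end LocalGeometry

/-! ### Complex gauges and the connection form in a gauge -/

section Gauge

open Set Filter Topology

variable {E : Type*} [NormedAddCommGroup E] [NormedSpace ℝ E] {m : ℕ}

/-- A smooth field of isomorphisms `L` (with inverse `K`) that trivializes the complex structure
of the frame field `w`. -/
structure IsComplexGauge (w : E → E ≃L[ℝ] C2 m) (w₀ : E ≃L[ℝ] C2 m) (L K : E → E →L[ℝ] E)
    (Ω : Set E) : Prop where
  smooth : ContDiffOn ℝ ∞ L Ω
  smooth_inv : ContDiffOn ℝ ∞ K Ω
  mul_inv : ∀ p ∈ Ω, L p * K p = 1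
  inv_mul : ∀ p ∈ Ω, K p * L p = 1
  comm : ∀ p ∈ Ω, L p * frameI w₀ = frameI (w p) * L p

/-- The connection form in the gauge `L`. -/
def gaugeForm (Γ : E → E →L[ℝ] E →L[ℝ] E) (L K : E → E →L[ℝ] E) (p : E) :
    E →L[ℝ] E →L[ℝ] E :=
  (ContinuousLinearMap.mul ℝ (E →L[ℝ] E) (K p)) ∘L
    (fderiv ℝ L p + ((ContinuousLinearMap.mul ℝ (E →L[ℝ] E)).flip (L p)) ∘L Γ p)

theorem gaugeForm_apply (Γ : E → E →L[ℝ] E →L[ℝ] E) (L K : E → E →L[ℝ] E) (p X : E) :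
    gaugeForm Γ L K p X = K p * (fderiv ℝ L p X + Γ p X * L p) := rfl

theorem HasFDerivAt.exists_mul {𝔸 : Type*} [NormedRing 𝔸] [NormedAlgebra ℝ 𝔸] {f g : E → 𝔸}
    {f' g' : E →L[ℝ] 𝔸} {p : E} (hf : HasFDerivAt f f' p) (hg : HasFDerivAt g g' p) :
    ∃ D : E →L[ℝ] 𝔸, HasFDerivAt (fun q => f q * g q) D p ∧
      ∀ X, D X = f p * g' X + f' X * g p :=
  ⟨_, hf.mul' hg, fun X => by simp⟩

/-- The algebra behind the gauge transformation of curvature, with second derivatives of the gauge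
already cancelled; `c` stands for the exterior derivative of the connection form and `r` for the
curvature. -/
theorem gauge_curvature_identity {𝔸 : Type*} [Ring 𝔸] {l k dlx dly gx gy c r : 𝔸}
    (hlk : l * k = 1) (hr : r = c + (gx * gy - gy * gx)) :
    (-(k * dlx * k) * (dly + gy * l) + k * (gy * dlx)) -
      (-(k * dly * k) * (dlx + gx * l) + k * (gx * dly)) + k * (c * l)
    = k * r * l - (k * (dlx + gx * l) * (k * (dly + gy * l))
      - k * (dly + gy * l) * (k * (dlx + gx * l))) := by
  have e : ∀ x y : 𝔸, x * l * (k * y) = x * y := fun x y => by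
    rw [mul_assoc, ← mul_assoc l, hlk, one_mul]
  have e1 : k * (dlx + gx * l) * (k * (dly + gy * l))
      = k * dlx * k * (dly + gy * l) + k * gx * (dly + gy * l) := by
    rw [mul_add k, add_mul, ← mul_assoc k gx l, e, mul_assoc, mul_assoc, mul_assoc, mul_assoc]
  have e2 : k * (dly + gy * l) * (k * (dlx + gx * l))
      = k * dly * k * (dlx + gx * l) + k * gy * (dlx + gx * l) := by
    rw [mul_add k, add_mul, ← mul_assoc k gy l, e, mul_assoc, mul_assoc, mul_assoc, mul_assoc]
  rw [e1, e2, hr]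
  noncomm_ring

namespace IsUStarGeometry

variable {Γ : E → E →L[ℝ] E →L[ℝ] E} {w : E → E ≃L[ℝ] C2 m} {Ω : Set E} {w₀ : E ≃L[ℝ] C2 m}
  {L K : E → E →L[ℝ] E}

theorem _root_.IsComplexGauge.hasFDerivAt (hg : IsComplexGauge w w₀ L K Ω) (hΩ : IsOpen Ω)
    {p : E} (hp : p ∈ Ω) : HasFDerivAt L (fderiv ℝ L p) p :=
  ((hg.smooth.contDiffAt (hΩ.mem_nhds hp)).differentiableAt (by simp)).hasFDerivAt

theorem _root_.IsComplexGauge.inv_comm (hg : IsComplexGauge w w₀ L K Ω) {p : E} (hp : p ∈ Ω) :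
    K p * frameI (w p) = frameI w₀ * K p := by
  have h1 := congrArg (fun x => K p * x * K p) (hg.comm p hp)
  rw [← mul_assoc, hg.inv_mul p hp, one_mul, mul_assoc, mul_assoc, hg.mul_inv p hp, mul_one] at h1
  exact h1.symm

theorem _root_.IsComplexGauge.exists_hasFDerivAt_inv (hg : IsComplexGauge w w₀ L K Ω)
    (hΩ : IsOpen Ω) {p : E} (hp : p ∈ Ω) : ∃ D : E →L[ℝ] E →L[ℝ] E, HasFDerivAt K D p ∧
      ∀ X, D X = -(K p * fderiv ℝ L p X * K p) := by
  have h1 : HasFDerivAt K (fderiv ℝ K p) p :=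
    ((hg.smooth_inv.contDiffAt (hΩ.mem_nhds hp)).differentiableAt (by simp)).hasFDerivAt
  refine ⟨_, h1, fun X => ?_⟩
  have h2 := h1.mul' (hg.hasFDerivAt hΩ hp)
  have h3 : HasFDerivAt (K * L) (0 : E →L[ℝ] E →L[ℝ] E) p :=
    (hasFDerivAt_const (1 : E →L[ℝ] E) p).congr_of_eventuallyEq (by
      filter_upwards [hΩ.mem_nhds hp] with q hq using hg.inv_mul q hq)
  have h4 := congrArg (fun f : E →L[ℝ] E →L[ℝ] E => f X) (h2.unique h3)
  have h5 : K p * fderiv ℝ L p X + fderiv ℝ K p X * L p = 0 := by simpa using h4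
  have h6 := congrArg (fun x => x * K p) h5
  simp only [add_mul, zero_mul] at h6
  rw [mul_assoc (fderiv ℝ K p X), hg.mul_inv p hp, mul_one] at h6
  exact (neg_eq_of_add_eq_zero_right h6).symm

/-- The derivative of the connection form in a gauge: `dB + [B, B] = K R L`. -/
theorem exists_hasFDerivAt_gaugeForm (h : IsUStarGeometry Γ w Ω)
    (hg : IsComplexGauge w w₀ L K Ω) {p : E} (hp : p ∈ Ω) :
    ∃ D : E → E →L[ℝ] E →L[ℝ] E, (∀ Y, HasFDerivAt (fun q => gaugeForm Γ L K q Y) (D Y) p) ∧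
      ∀ X Y, D Y X - D X Y = K p * connCurvature Γ p X Y * L p
        - (gaugeForm Γ L K p X * gaugeForm Γ L K p Y
          - gaugeForm Γ L K p Y * gaugeForm Γ L K p X) := by
  obtain ⟨DK, hDK, hDK'⟩ := hg.exists_hasFDerivAt_inv h.isOpen hp
  have hL := hg.hasFDerivAt h.isOpen hp
  have hΓ := h.hasFDerivAt_connection hp
  have hLp : ContDiffAt ℝ ∞ L p := hg.smooth.contDiffAt (h.isOpen.mem_nhds hp)
  have hsymm := hLp.isSymmSndFDerivAt (by simp; exact WithTop.coe_le_coe.2 le_top)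
  have hdd : DifferentiableAt ℝ (fderiv ℝ L) p :=
    (hLp.fderiv_right (m := 1) (by norm_cast)).differentiableAt (by simp)
  have h1 : ∀ Y, ∃ D : E →L[ℝ] E →L[ℝ] E,
      HasFDerivAt (fun q => gaugeForm Γ L K q Y) D p ∧ ∀ X, D X =
        -(K p * fderiv ℝ L p X * K p) * (fderiv ℝ L p Y + Γ p Y * L p)
          + K p * (fderiv ℝ (fderiv ℝ L) p X Y + fderiv ℝ Γ p X Y * L p
            + Γ p Y * fderiv ℝ L p X) := by
    intro Y
    have e1 : HasFDerivAt (fun q => fderiv ℝ L q Y)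
        ((ContinuousLinearMap.apply ℝ (E →L[ℝ] E) Y) ∘L fderiv ℝ (fderiv ℝ L) p) p :=
      (ContinuousLinearMap.apply ℝ (E →L[ℝ] E) Y).hasFDerivAt.comp p hdd.hasFDerivAt
    have e2 : HasFDerivAt (fun q => Γ q Y)
        ((ContinuousLinearMap.apply ℝ (E →L[ℝ] E) Y) ∘L fderiv ℝ Γ p) p :=
      (ContinuousLinearMap.apply ℝ (E →L[ℝ] E) Y).hasFDerivAt.comp p hΓ
    obtain ⟨D₁, h1, h1'⟩ := e2.exists_mul hL
    obtain ⟨D₂, h2, h2'⟩ := hDK.exists_mul (e1.add h1)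
    refine ⟨D₂, h2, fun X => ?_⟩
    rw [h2', add_apply, h1', hDK', add_comm]
    congr 2
    exact (add_assoc _ _ _).symm.trans (add_right_comm _ _ _)
  choose D hD hD' using h1
  refine ⟨D, hD, fun X Y => ?_⟩
  rw [hD', hD', hsymm X Y]
  refine Eq.trans ?_ (gauge_curvature_identity (gx := Γ p X) (gy := Γ p Y)
    (dlx := fderiv ℝ L p X) (dly := fderiv ℝ L p Y) (c := fderiv ℝ Γ p X Y - fderiv ℝ Γ p Y X)
    (r := connCurvature Γ p X Y) (hg.mul_inv p hp) rfl)
  noncomm_ring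

theorem contDiffOn_gaugeForm (h : IsUStarGeometry Γ w Ω) (hg : IsComplexGauge w w₀ L K Ω) :
    ContDiffOn ℝ ∞ (gaugeForm Γ L K) Ω := by
  have h1 : ContDiffOn ℝ ∞ (fderiv ℝ L) Ω := hg.smooth.fderiv_of_isOpen h.isOpen (by simp)
  have h2 : ContDiffOn ℝ ∞
      (fun p => (ContinuousLinearMap.mul ℝ (E →L[ℝ] E)).flip (L p)) Ω :=
    (ContinuousLinearMap.contDiff _).comp_contDiffOn hg.smooth
  have h3 : ContDiffOn ℝ ∞ (fun p => ContinuousLinearMap.mul ℝ (E →L[ℝ] E) (K p)) Ω :=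
    (ContinuousLinearMap.contDiff _).comp_contDiffOn hg.smooth_inv
  exact h3.clm_comp (h1.add (h2.clm_comp h.smooth))

/-- In the gauge the complex structure is the constant `frameI w₀`, so being parallel means
commuting with the connection form. The proof differentiates `L I₀ = I L` and inserts the formula
for `dI`. -/
theorem gaugeForm_comm [FiniteDimensional ℝ E] (h : IsUStarGeometry Γ w Ω)
    (hg : IsComplexGauge w w₀ L K Ω) {p : E} (hp : p ∈ Ω) (X : E) :
    gaugeForm Γ L K p X * frameI w₀ = frameI w₀ * gaugeForm Γ L K p X := by
  obtain ⟨D, hD, hD'⟩ := h.exists_hasFDerivAt_frameI hp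
  have hL := hg.hasFDerivAt h.isOpen hp
  have h1 := (hD.mul' hL).congr_of_eventuallyEq (f₁ := fun q => L q * frameI w₀) (by
      filter_upwards [h.isOpen.mem_nhds hp] with q hq using hg.comm q hq)
  have h2 := congrArg (fun f : E →L[ℝ] E →L[ℝ] E => f X) ((hL.mul_const' (frameI w₀)).unique h1)
  have h3 : fderiv ℝ L p X * frameI w₀ = frameI (w p) * fderiv ℝ L p X
      + (frameI (w p) * Γ p X - Γ p X * frameI (w p)) * L p := by
    rw [← hD']; simpa using h2
  simp only [gaugeForm_apply]
  rw [← mul_assoc, ← hg.inv_comm hp, mul_assoc, mul_assoc, add_mul, h3, mul_assoc (Γ p X),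
    hg.comm p hp]
  noncomm_ring

end IsUStarGeometry

end Gauge

/-! ### The potential `log |s|²` and its Hessian -/

section Potential

open Set Filter Topology

variable {E : Type*} [NormedAddCommGroup E] [NormedSpace ℝ E] [FiniteDimensional ℝ E] {m : ℕ}

/-- The logarithm of the squared parallel norm of a section of `K^N` that is given by the function
`σ` in the gauge `L`. -/
def sectionPotential (N : ℤ) (σ : E → ℂ) (w : E → E ≃L[ℝ] C2 m) (w₀ : E ≃L[ℝ] C2 m)
    (L : E → E →L[ℝ] E) (p : E) : ℝ :=
  Real.log (‖σ p‖ ^ 2) - N * (Real.log (frameDensity w₀ (w p)) + Real.log (L p).det)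

/-- The derivative of `sectionPotential`. -/
def sectionPotentialDeriv (N : ℤ) (σ : E → ℂ) (Γ : E → E →L[ℝ] E →L[ℝ] E)
    (L K : E → E →L[ℝ] E) (p : E) : E →L[ℝ] ℝ :=
  (2 : ℝ) • (Complex.reCLM ∘L (ContinuousLinearMap.mul ℝ ℂ (σ p)⁻¹) ∘L fderiv ℝ σ p)
    - (N : ℝ) • (traceL E ∘L gaugeForm Γ L K p)

theorem sectionPotentialDeriv_apply (N : ℤ) (σ : E → ℂ) (Γ : E → E →L[ℝ] E →L[ℝ] E)
    (L K : E → E →L[ℝ] E) (p X : E) : sectionPotentialDeriv N σ Γ L K p X =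
      2 * ((σ p)⁻¹ * fderiv ℝ σ p X).re - N * traceL E (gaugeForm Γ L K p X) := rfl

namespace IsUStarGeometry

variable {Γ : E → E →L[ℝ] E →L[ℝ] E} {w : E → E ≃L[ℝ] C2 m} {Ω : Set E} {w₀ : E ≃L[ℝ] C2 m}
  {L K : E → E →L[ℝ] E} {N : ℤ} {σ : E → ℂ}

/-- The logarithmic derivatives of the density, `tr Γ`, and of `det L`, `tr(K dL)` by Jacobi's
formula, add up to the trace of the connection form in the gauge. -/
theorem hasFDerivAt_sectionPotential (h : IsUStarGeometry Γ w Ω)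
    (hg : IsComplexGauge w w₀ L K Ω) (hσ : ContDiffOn ℝ ∞ σ Ω) {p : E} (hp : p ∈ Ω)
    (h0 : σ p ≠ 0) :
    HasFDerivAt (sectionPotential N σ w w₀ L) (sectionPotentialDeriv N σ Γ L K p) p := by
  have h1 : HasFDerivAt σ (fderiv ℝ σ p) p :=
    ((hσ.contDiffAt (h.isOpen.mem_nhds hp)).differentiableAt (by simp)).hasFDerivAt
  have h2 := h1.norm_sq.log (by positivity)
  obtain ⟨D, hD, hD'⟩ := h.exists_hasFDerivAt_frameDensity w₀ hp
  have h3 := hD.log (frameDensity_pos w₀ (w p)).ne'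
  obtain ⟨D₂, hD₂, hD₂'⟩ := hasFDerivAt_det_of_inverse (hg.mul_inv p hp) (hg.inv_mul p hp)
  have hdet : (L p).det ≠ 0 := by
    have e1 : LinearMap.det ((L p * K p : E →L[ℝ] E) : E →ₗ[ℝ] E) = 1 := by
      rw [hg.mul_inv p hp]; exact LinearMap.det_id
    have e2 : LinearMap.det (L p : E →ₗ[ℝ] E) * LinearMap.det (K p : E →ₗ[ℝ] E) = 1 := by
      rw [← LinearMap.det_comp]; exact e1
    exact left_ne_zero_of_mul_eq_one e2
  have h4 : HasFDerivAt (fun q => (L q).det) _ p :=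
    HasFDerivAt.comp (g := fun A : E →L[ℝ] E => A.det) p hD₂ (hg.hasFDerivAt h.isOpen hp)
  have h5 := h4.log hdet
  refine (h2.sub ((h3.add h5).const_mul (N : ℝ))).congr_fderiv ?_
  ext X
  rw [sectionPotentialDeriv_apply, gaugeForm_apply, mul_add, map_add]
  have e1 : traceL E (K p * (Γ p X * L p)) = traceL E (Γ p X) := by
    rw [← mul_assoc, traceL_mul_comm, ← mul_assoc, hg.mul_inv p hp, one_mul]
  have e2 : (frameDensity w₀ (w p))⁻¹ * D X = traceL E (Γ p X) := by
    rw [hD', inv_mul_cancel_left₀ (frameDensity_pos w₀ (w p)).ne']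
  have e3 : ((L p).det)⁻¹ * D₂ (fderiv ℝ L p X) = traceL E (K p * fderiv ℝ L p X) := by
    rw [hD₂', inv_mul_cancel_left₀ hdet]; rfl
  have e4 : (‖σ p‖ ^ 2)⁻¹ * (2 * inner ℝ (σ p) (fderiv ℝ σ p X))
      = 2 * ((σ p)⁻¹ * fderiv ℝ σ p X).re := by
    rw [Complex.inner, Complex.inv_def, Complex.normSq_eq_norm_sq]
    simp only [Complex.mul_re, Complex.conj_re, Complex.conj_im, Complex.ofReal_re,
      Complex.ofReal_im, Complex.mul_im]
    ring
  rw [e1, ← e2, ← e3, ← e4]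
  simp
  ring

theorem contDiffOn_sectionPotentialDeriv (h : IsUStarGeometry Γ w Ω)
    (hg : IsComplexGauge w w₀ L K Ω) (hσ : ContDiffOn ℝ ∞ σ Ω) (h0 : ∀ p ∈ Ω, σ p ≠ 0) :
    ContDiffOn ℝ ∞ (sectionPotentialDeriv N σ Γ L K) Ω := by
  have h1 : ContDiffOn ℝ ∞ (fderiv ℝ σ) Ω := hσ.fderiv_of_isOpen h.isOpen (by simp)
  have h2 : ContDiffOn ℝ ∞ (fun p => ContinuousLinearMap.mul ℝ ℂ (σ p)⁻¹) Ω :=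
    (ContinuousLinearMap.contDiff _).comp_contDiffOn (hσ.inv h0)
  have h3 := (contDiffOn_const (c := Complex.reCLM)).clm_comp (h2.clm_comp h1)
  have h4 := (contDiffOn_const (c := traceL E)).clm_comp (h.contDiffOn_gaugeForm hg)
  exact (h3.const_smul (2 : ℝ)).sub (h4.const_smul (N : ℝ))

/-- The value of the derivative on `I X` when the section is holomorphic. -/
theorem sectionPotentialDeriv_frameI (h : IsUStarGeometry Γ w Ω)
    (hg : IsComplexGauge w w₀ L K Ω) {p : E} (hp : p ∈ Ω) (h0 : σ p ≠ 0) {X : E}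
    (hol : fderiv ℝ σ p X + Complex.I * fderiv ℝ σ p (frameI (w p) X)
      = N * (complexTrace w₀ (gaugeForm Γ L K p X : E →ₗ[ℝ] E)
        + Complex.I * complexTrace w₀ (gaugeForm Γ L K p (frameI (w p) X) : E →ₗ[ℝ] E)) * σ p) :
    sectionPotentialDeriv N σ Γ L K p (frameI (w p) X)
      = -(2 * ((σ p)⁻¹ * fderiv ℝ σ p X).im)
        - N * traceL E (frameI w₀ * gaugeForm Γ L K p X) := by
  set Y := frameI (w p) X
  have hc : ∀ X x, (gaugeForm Γ L K p X : E →ₗ[ℝ] E) (frameI w₀ x)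
      = frameI w₀ ((gaugeForm Γ L K p X : E →ₗ[ℝ] E) x) := fun X x =>
    congrArg (fun f : E →L[ℝ] E => f x) (h.gaugeForm_comm hg hp X)
  have h1 := two_mul_re_complexTrace w₀ (gaugeForm Γ L K p Y : E →ₗ[ℝ] E) (hc Y)
  have h2 : 2 * (complexTrace w₀ (gaugeForm Γ L K p X : E →ₗ[ℝ] E)).im
      = -traceL E (frameI w₀ * gaugeForm Γ L K p X) :=
    two_mul_im_complexTrace w₀ (gaugeForm Γ L K p X : E →ₗ[ℝ] E) (hc X)
  set a := complexTrace w₀ (gaugeForm Γ L K p X : E →ₗ[ℝ] E)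
  set b := complexTrace w₀ (gaugeForm Γ L K p Y : E →ₗ[ℝ] E)
  rw [sectionPotentialDeriv_apply, traceL_apply, ← h1]
  have h3 : (σ p)⁻¹ * fderiv ℝ σ p X + Complex.I * ((σ p)⁻¹ * fderiv ℝ σ p Y)
      = N * (a + Complex.I * b) := by
    linear_combination (σ p)⁻¹ * hol + N * (a + Complex.I * b) * (inv_mul_cancel₀ h0)
  -- The imaginary part of the Cauchy–Riemann equation expresses the derivative along `IX` by the
  -- derivative along `X`.
  have h4 := congrArg Complex.im h3
  set c := (σ p)⁻¹ * fderiv ℝ σ p X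
  set d := (σ p)⁻¹ * fderiv ℝ σ p Y
  have h5 : c.im + d.re = N * (a.im + b.re) := by
    simpa using h4
  linear_combination 2 * h5 + N * h2

/-- The Hessian of the potential of a holomorphic section. -/
theorem hessian_sectionPotential (h : IsUStarGeometry Γ w Ω)
    (hg : IsComplexGauge w w₀ L K Ω) (hσ : ContDiffOn ℝ ∞ σ Ω) (h0 : ∀ p ∈ Ω, σ p ≠ 0)
    (hol : ∀ p ∈ Ω, ∀ X, fderiv ℝ σ p X + Complex.I * fderiv ℝ σ p (frameI (w p) X)
      = N * (complexTrace w₀ (gaugeForm Γ L K p X : E →ₗ[ℝ] E)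
        + Complex.I * complexTrace w₀ (gaugeForm Γ L K p (frameI (w p) X) : E →ₗ[ℝ] E)) * σ p)
    {p : E} (hp : p ∈ Ω) (X Y : E) :
    (fderiv ℝ (sectionPotentialDeriv N σ Γ L K) p X (frameI (w p) Y)
        - sectionPotentialDeriv N σ Γ L K p (Γ p X (frameI (w p) Y)))
      - (fderiv ℝ (sectionPotentialDeriv N σ Γ L K) p Y (frameI (w p) X)
        - sectionPotentialDeriv N σ Γ L K p (Γ p Y (frameI (w p) X)))
      = -(N * traceL E (frameI (w p) * connCurvature Γ p X Y)) := by
  set f' := sectionPotentialDeriv N σ Γ L K with hf'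
  have hd : HasFDerivAt f' (fderiv ℝ f' p) p :=
    (((h.contDiffOn_sectionPotentialDeriv hg hσ h0).contDiffAt
      (h.isOpen.mem_nhds hp)).differentiableAt (by simp)).hasFDerivAt
  obtain ⟨DI, hDI, hDI'⟩ := h.exists_hasFDerivAt_frameI hp
  obtain ⟨DB, hDB, hDB'⟩ := h.exists_hasFDerivAt_gaugeForm hg hp
  have hσp : ContDiffAt ℝ ∞ σ p := hσ.contDiffAt (h.isOpen.mem_nhds hp)
  have hsymm := hσp.isSymmSndFDerivAt (by simp; exact WithTop.coe_le_coe.2 le_top)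
  have hdd : DifferentiableAt ℝ (fderiv ℝ σ) p :=
    (hσp.fderiv_right (m := 1) (by norm_cast)).differentiableAt (by simp)
  have hσ' : HasFDerivAt σ (fderiv ℝ σ p) p := (hσp.differentiableAt (by simp)).hasFDerivAt
  -- This differentiates the formula for `df(IY)` along `X`. After skew-symmetrization in `X` and
  -- `Y` the second derivatives of `σ` and the products of its first derivatives drop out, and only
  -- the exterior derivative of the connection form remains.
  have key : ∀ X Y, fderiv ℝ f' p X (frameI (w p) Y) + f' p (DI X Y)
      = -(2 * ((σ p)⁻¹ * fderiv ℝ (fderiv ℝ σ) p X Y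
          + (-((σ p) ^ 2)⁻¹ * fderiv ℝ σ p X) * fderiv ℝ σ p Y).im)
        - N * traceL E (frameI w₀ * DB Y X) := by
    intro X Y
    have e1 : HasFDerivAt (fun q => f' q (frameI (w q) Y)) _ p :=
      hd.clm_apply ((ContinuousLinearMap.apply ℝ E Y).hasFDerivAt.comp p hDI)
    have e2 : HasFDerivAt (fun q => fderiv ℝ σ q Y)
        ((ContinuousLinearMap.apply ℝ ℂ Y) ∘L fderiv ℝ (fderiv ℝ σ) p) p :=
      (ContinuousLinearMap.apply ℝ ℂ Y).hasFDerivAt.comp p hdd.hasFDerivAt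
    have e3 : HasFDerivAt (fun q => (σ q)⁻¹) _ p :=
      (((hasDerivAt_inv (h0 p hp)).hasFDerivAt).restrictScalars ℝ).comp p hσ'
    obtain ⟨D₁, h1, h1'⟩ := e3.exists_mul e2
    have e4 := (((Complex.imCLM.hasFDerivAt.comp p h1).const_mul 2).neg).sub
      (((traceL E ∘L ContinuousLinearMap.mul ℝ (E →L[ℝ] E) (frameI w₀)).hasFDerivAt.comp p
        (hDB Y)).const_mul (N : ℝ))
    have e5 := e1.unique (e4.congr_of_eventuallyEq (by
      filter_upwards [h.isOpen.mem_nhds hp] with q hq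
      exact h.sectionPotentialDeriv_frameI hg hq (h0 q hq) (hol q hq Y)))
    have e6 := congrArg (fun f : E →L[ℝ] ℝ => f X) e5
    simp [h1'] at e6 ⊢
    linear_combination e6
  have k1 := key X Y
  have k2 := key Y X
  rw [hsymm X Y] at k1
  rw [hDI'] at k1 k2
  simp only [sub_apply, mul_apply_eq_comp, map_sub] at k1 k2
  rw [h.symm p hp Y X] at k2
  have hB : traceL E (frameI w₀ * DB Y X) - traceL E (frameI w₀ * DB X Y)
      = traceL E (frameI (w p) * connCurvature Γ p X Y) := by
    rw [← map_sub, ← mul_sub, hDB', mul_sub, map_sub, mul_sub, map_sub]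
    -- The quadratic term of the curvature does not contribute, because the connection form commutes
    -- with `frameI w₀`.
    have c1 : traceL E (frameI w₀ * (gaugeForm Γ L K p X * gaugeForm Γ L K p Y))
        = traceL E (frameI w₀ * (gaugeForm Γ L K p Y * gaugeForm Γ L K p X)) := by
      rw [← mul_assoc, traceL_mul_comm, ← mul_assoc, ← mul_assoc, h.gaugeForm_comm hg hp Y]
    have c2 : traceL E (frameI w₀ * (K p * connCurvature Γ p X Y * L p))
        = traceL E (frameI (w p) * connCurvature Γ p X Y) := by
      rw [← mul_assoc, ← mul_assoc, traceL_mul_comm, ← mul_assoc, ← mul_assoc, hg.comm p hp,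
        mul_assoc (frameI (w p)), hg.mul_inv p hp, mul_one]
    rw [c1, c2]
    ring
  have him : ((-((σ p) ^ 2)⁻¹ * fderiv ℝ σ p X) * fderiv ℝ σ p Y)
      = ((-((σ p) ^ 2)⁻¹ * fderiv ℝ σ p Y) * fderiv ℝ σ p X) := by ring
  rw [him] at k1
  linear_combination k1 - k2 - N * hB

end IsUStarGeometry

end Potential

/-! ### The maximum principle for the potential -/

section LocalMaximumPrinciple

open Set Filter Topology

theorem IsUStarGeometry.mono {E : Type*} [NormedAddCommGroup E] [NormedSpace ℝ E] {m : ℕ}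
    {Γ : E → E →L[ℝ] E →L[ℝ] E} {w : E → E ≃L[ℝ] C2 m} {Ω Ω' : Set E}
    (h : IsUStarGeometry Γ w Ω) (hΩ' : IsOpen Ω') (hsub : Ω' ⊆ Ω) : IsUStarGeometry Γ w Ω' :=
  ⟨hΩ', h.smooth.mono hsub, fun p hp => h.symm p (hsub hp), fun p hp => h.parallel p (hsub hp)⟩

theorem IsComplexGauge.mono {E : Type*} [NormedAddCommGroup E] [NormedSpace ℝ E] {m : ℕ}
    {w : E → E ≃L[ℝ] C2 m} {w₀ : E ≃L[ℝ] C2 m} {L K : E → E →L[ℝ] E} {Ω Ω' : Set E}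
    (h : IsComplexGauge w w₀ L K Ω) (hsub : Ω' ⊆ Ω) : IsComplexGauge w w₀ L K Ω' :=
  ⟨h.smooth.mono hsub, h.smooth_inv.mono hsub, fun p hp => h.mul_inv p (hsub hp),
    fun p hp => h.inv_mul p (hsub hp), fun p hp => h.comm p (hsub hp)⟩

/-- Existence of a gauge that trivializes the complex structure near a point. -/
theorem IsUStarGeometry.exists_isComplexGauge {E : Type*} [NormedAddCommGroup E] [NormedSpace ℝ E]
    [FiniteDimensional ℝ E] {m : ℕ}
    {Γ : E → E →L[ℝ] E →L[ℝ] E} {w : E → E ≃L[ℝ] C2 m} {Ω : Set E}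
    (h : IsUStarGeometry Γ w Ω) {p₀ : E} (hp₀ : p₀ ∈ Ω) :
    ∃ L K : E → E →L[ℝ] E, ∃ Ω' ⊆ Ω, IsOpen Ω' ∧ p₀ ∈ Ω' ∧
      IsComplexGauge w (w p₀) L K Ω' := by
  have : CompleteSpace E := FiniteDimensional.complete ℝ E
  set I₀ := frameI (w p₀) with hI₀
  -- Since `I² = I₀² = -1`, both `L I₀` and `I L` equal `(I + I₀)/2`. At `p₀` this `L` is the
  -- identity, hence it is invertible nearby.
  let L : E → E →L[ℝ] E := fun p => (2⁻¹ : ℝ) • (1 - frameI (w p) * I₀)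
  have hL : ContDiffOn ℝ ∞ L Ω :=
    (contDiffOn_const.sub (h.contDiffOn_frameI.mul contDiffOn_const)).const_smul _
  have hL₀ : L p₀ = 1 := by
    change (2⁻¹ : ℝ) • (1 - frameI (w p₀) * frameI (w p₀)) = 1
    rw [frameI_mul_frameI]
    module
  have hopen : IsOpen (Ω ∩ L ⁻¹' {A | IsUnit A}) :=
    hL.continuousOn.isOpen_inter_preimage h.isOpen Units.isOpen
  refine ⟨L, fun p => Ring.inverse (L p), _, inter_subset_left, hopen,
    ⟨hp₀, by simp [hL₀]⟩, hL.mono inter_subset_left, ?_, ?_, ?_, ?_⟩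
  · rintro p ⟨hp, u, hu⟩
    have h1 : ContDiffAt ℝ ∞ Ring.inverse (L p) := by
      rw [← hu]; exact contDiffAt_ringInverse ℝ u
    exact (h1.comp p (hL.contDiffAt (h.isOpen.mem_nhds hp))).contDiffWithinAt
  · exact fun p hp => Ring.mul_inverse_cancel _ hp.2
  · exact fun p hp => Ring.inverse_mul_cancel _ hp.2
  · intro p hp
    simp only [L, smul_mul_assoc, mul_smul_comm, sub_mul, mul_sub, one_mul, mul_one]
    rw [mul_assoc, hI₀, frameI_mul_frameI, ← mul_assoc, frameI_mul_frameI]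
    congr 1
    noncomm_ring

variable {E : Type*} [NormedAddCommGroup E] [InnerProductSpace ℝ E] [FiniteDimensional ℝ E] {m : ℕ}

namespace IsUStarGeometry

variable {Γ : E → E →L[ℝ] E →L[ℝ] E} {w : E → E ≃L[ℝ] C2 m} {Ω : Set E} {w₀ : E ≃L[ℝ] C2 m}
  {L K : E → E →L[ℝ] E} {N : ℤ} {σ : E → ℂ}

/-- Take `X = Iv` and `Y = v` in the Hessian identity and express `tr(I R(Iv,v))` by the Ricci
tensor. -/
theorem hessian_add_hessian_frameI [Nontrivial E] (h : IsUStarGeometry Γ w Ω)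
    (hg : IsComplexGauge w w₀ L K Ω) (hσ : ContDiffOn ℝ ∞ σ Ω) (h0 : ∀ p ∈ Ω, σ p ≠ 0)
    (hol : ∀ p ∈ Ω, ∀ X, fderiv ℝ σ p X + Complex.I * fderiv ℝ σ p (frameI (w p) X)
      = N * (complexTrace w₀ (gaugeForm Γ L K p X : E →ₗ[ℝ] E)
        + Complex.I * complexTrace w₀ (gaugeForm Γ L K p (frameI (w p) X) : E →ₗ[ℝ] E)) * σ p)
    {p : E} (hp : p ∈ Ω) (v : E) :
    (fderiv ℝ (sectionPotentialDeriv N σ Γ L K) p v v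
        - sectionPotentialDeriv N σ Γ L K p (Γ p v v))
      + (fderiv ℝ (sectionPotentialDeriv N σ Γ L K) p (frameI (w p) v) (frameI (w p) v)
        - sectionPotentialDeriv N σ Γ L K p (Γ p (frameI (w p) v) (frameI (w p) v)))
      = N * (ricciTrace (connCurvatureTensor Γ p) v v
        + ricciTrace (connCurvatureTensor Γ p) (frameI (w p) v) (frameI (w p) v)) := by
  have h1 := h.hessian_sectionPotential hg hσ h0 hol hp (frameI (w p) v) v
  have h2 : traceL E (frameI (w p) * connCurvature Γ p (frameI (w p) v) v)
      = ricciTrace (connCurvatureTensor Γ p) v (frameI (w p) (frameI (w p) v))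
        - ricciTrace (connCurvatureTensor Γ p) (frameI (w p) v) (frameI (w p) v) :=
    (h.isQuaternionicCurvature hp).trace_left_mul (frameI (w p) v) v
  simp only [← ricciForm₂_apply] at h2 ⊢
  rw [frameI_frameI] at h1 h2
  rw [h2] at h1
  simp only [map_neg] at h1
  linear_combination h1

/-- The strong maximum principle for the potential of a holomorphic section. -/
theorem sectionPotential_eventually_eq [Nontrivial E] (h : IsUStarGeometry Γ w Ω)
    (havg : ∀ p ∈ Ω, ∀ v, ricciTrace (connCurvatureTensor Γ p) v v
      + ricciTrace (connCurvatureTensor Γ p) (frameI (w p) v) (frameI (w p) v)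
      + ricciTrace (connCurvatureTensor Γ p) (frameJ (w p) v) (frameJ (w p) v)
      + ricciTrace (connCurvatureTensor Γ p) (frameI (w p) (frameJ (w p) v))
          (frameI (w p) (frameJ (w p) v)) = 0)
    (hg : IsComplexGauge w w₀ L K Ω) (hσ : ContDiffOn ℝ ∞ σ Ω) (h0 : ∀ p ∈ Ω, σ p ≠ 0)
    (hol : ∀ p ∈ Ω, ∀ X, fderiv ℝ σ p X + Complex.I * fderiv ℝ σ p (frameI (w p) X)
      = N * (complexTrace w₀ (gaugeForm Γ L K p X : E →ₗ[ℝ] E)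
        + Complex.I * complexTrace w₀ (gaugeForm Γ L K p (frameI (w p) X) : E →ₗ[ℝ] E)) * σ p)
    {z₀ : E} (hz₀ : z₀ ∈ Ω)
    (hmax : ∀ p ∈ Ω, sectionPotential N σ w w₀ L p ≤ sectionPotential N σ w w₀ L z₀) :
    ∀ᶠ p in 𝓝 z₀, sectionPotential N σ w w₀ L p = sectionPotential N σ w w₀ L z₀ := by
  have hz := h.isOpen.mem_nhds hz₀
  have c1 := (h.contDiffOn_frameI.continuousOn.continuousAt hz).norm
  have c2 := (h.continuousOn_frameQ.continuousAt hz).norm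
  have c3 := (h.smooth.continuousOn.continuousAt hz).norm
  obtain ⟨b, hb1, hbI, hbQ, hbΓ⟩ : ∃ b : ℝ, 1 ≤ b ∧ ‖frameI (w z₀)‖ < b ∧ ‖frameQ (w z₀)‖ < b ∧
      ‖Γ z₀‖ < b := by
    refine ⟨1 + ‖frameI (w z₀)‖ + ‖frameQ (w z₀)‖ + ‖Γ z₀‖, ?_, ?_, ?_, ?_⟩ <;>
      linarith [norm_nonneg (frameI (w z₀)), norm_nonneg (frameQ (w z₀)), norm_nonneg (Γ z₀)]
  have hev := (c1.eventually_lt continuousAt_const hbI).and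
    ((c2.eventually_lt continuousAt_const hbQ).and (c3.eventually_lt continuousAt_const hbΓ))
  obtain ⟨Ω', hΩ'sub, hΩ', hz₀'⟩ := eventually_nhds_iff.1 (hev.and (h.isOpen.eventually_mem hz₀))
  have hsub : Ω' ⊆ Ω := fun p hp => (hΩ'sub p hp).2
  have hd : ∀ p ∈ Ω, HasFDerivAt (sectionPotentialDeriv N σ Γ L K)
      (fderiv ℝ (sectionPotentialDeriv N σ Γ L K) p) p := fun p hp =>
    (((h.contDiffOn_sectionPotentialDeriv hg hσ h0).contDiffAt
      (h.isOpen.mem_nhds hp)).differentiableAt (by simp)).hasFDerivAt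
  -- The constant is `b²` because `I(Jv)` needs one factor `b` for `I` and one for `J`.
  refine eventually_eq_of_isMax hΩ' (G := Γ) (C := b ^ 2)
    (fun p hp => h.hasFDerivAt_sectionPotential hg hσ (hsub hp) (h0 p (hsub hp)))
    (fun p hp => hd p (hsub hp)) (fun p hp => ?_) (fun p hp v => ?_) hz₀'
    (fun p hp => hmax p (hsub hp))
  · have := (hΩ'sub p hp).1.2.2
    nlinarith
  · obtain ⟨⟨hI, hQ, -⟩, -⟩ := hΩ'sub p hp
    have hIv : ∀ v, ‖frameI (w p) v‖ ≤ b * ‖v‖ := fun v =>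
      ContinuousLinearMap.le_of_opNorm_le _ hI.le v
    have hJv : ‖frameJ (w p) v‖ ≤ b * ‖v‖ := by
      refine le_of_sq_le_sq ?_ (by positivity)
      refine (norm_frameJ_sq_le (w p) v).trans ?_
      rw [mul_pow]
      gcongr
      nlinarith
    have hbb : b ≤ b ^ 2 := by nlinarith
    -- These vectors span the quaternionic line of `v`. The Hessian identities at `v` and `Jv` add
    -- up to `N` times the quaternionic average of the Ricci tensor, so the trace is exactly zero.
    refine ⟨![v, frameI (w p) v, frameJ (w p) v, frameI (w p) (frameJ (w p) v)], rfl, ?_, ?_⟩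
    · have n0 := norm_nonneg v
      intro i
      fin_cases i
      · simp only [Fin.zero_eta, Matrix.cons_val_zero]
        nlinarith
      · exact (hIv v).trans (by gcongr)
      · exact hJv.trans (by gcongr)
      · refine (hIv _).trans ?_
        rw [pow_two, mul_assoc]
        change b * ‖frameJ (w p) v‖ ≤ _
        gcongr
    · refine le_of_eq ?_
      have e1 := h.hessian_add_hessian_frameI hg hσ h0 hol (hsub hp) v
      have e2 := h.hessian_add_hessian_frameI hg hσ h0 hol (hsub hp) (frameJ (w p) v)
      rw [Fin.sum_univ_four]
      simp only [Matrix.cons_val]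
      linear_combination -e1 - e2 - N * havg p (hsub hp) v

/-- If the potential of a holomorphic section is locally constant, the Ricci form vanishes. -/
theorem trace_frameI_mul_curvature_eq_zero (h : IsUStarGeometry Γ w Ω)
    (hg : IsComplexGauge w w₀ L K Ω) (hσ : ContDiffOn ℝ ∞ σ Ω) (h0 : ∀ p ∈ Ω, σ p ≠ 0)
    (hol : ∀ p ∈ Ω, ∀ X, fderiv ℝ σ p X + Complex.I * fderiv ℝ σ p (frameI (w p) X)
      = N * (complexTrace w₀ (gaugeForm Γ L K p X : E →ₗ[ℝ] E)
        + Complex.I * complexTrace w₀ (gaugeForm Γ L K p (frameI (w p) X) : E →ₗ[ℝ] E)) * σ p)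
    (hN : N ≠ 0) {z₀ : E} (hz₀ : z₀ ∈ Ω)
    (hconst : ∀ᶠ p in 𝓝 z₀, sectionPotential N σ w w₀ L p = sectionPotential N σ w w₀ L z₀)
    (X Y : E) : traceL E (frameI (w z₀) * connCurvature Γ z₀ X Y) = 0 := by
  have h1 : ∀ᶠ p in 𝓝 z₀, sectionPotentialDeriv N σ Γ L K p = 0 := by
    filter_upwards [hconst.eventually_nhds, h.isOpen.eventually_mem hz₀] with p hp hpΩ
    have e1 := h.hasFDerivAt_sectionPotential (N := N) hg hσ hpΩ (h0 p hpΩ)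
    exact e1.unique ((hasFDerivAt_const _ p).congr_of_eventuallyEq hp)
  have h2 : fderiv ℝ (sectionPotentialDeriv N σ Γ L K) z₀ = 0 :=
    ((hasFDerivAt_const _ z₀).congr_of_eventuallyEq h1).fderiv
  have h3 := h.hessian_sectionPotential hg hσ h0 hol hz₀ X Y
  rw [h2, h1.self_of_nhds] at h3
  have h4 : (N : ℝ) ≠ 0 := by exact_mod_cast hN
  simpa [h4] using h3

/-- The quaternionic average of the Ricci tensor vanishes. -/
theorem ricciTrace_average [Nontrivial E] (h : IsUStarGeometry Γ w Ω)
    {p : E} (hp : p ∈ Ω)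
    (hscal : m = 1 → ∑ q : (Fin m ⊕ Fin m) × Fin 2,
      ricciTrace (connCurvatureTensor Γ p)
        ((w p).symm (Pi.single q.1 ((![1, Complex.I] : Fin 2 → ℂ) q.2)))
        ((w p).symm (Pi.single q.1 ((![1, Complex.I] : Fin 2 → ℂ) q.2))) = 0) (v : E) :
    ricciTrace (connCurvatureTensor Γ p) v v
      + ricciTrace (connCurvatureTensor Γ p) (frameI (w p) v) (frameI (w p) v)
      + ricciTrace (connCurvatureTensor Γ p) (frameJ (w p) v) (frameJ (w p) v)
      + ricciTrace (connCurvatureTensor Γ p) (frameI (w p) (frameJ (w p) v))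
          (frameI (w p) (frameJ (w p) v)) = 0 := by
  have hq := h.isQuaternionicCurvature hp
  by_cases hm : m = 1
  · subst hm
    exact average_eq_zero_of_trace_eq_zero (w p) (ricciForm₂ (connCurvatureTensor Γ p))
      hq.ricciTrace_comm (hscal rfl) v
  · refine hq.ricciTrace_average ?_ v
    have h1 : Module.finrank ℝ E = Module.finrank ℝ (C2 m) := (w p).toLinearEquiv.finrank_eq
    have h2 : Module.finrank ℝ (C2 m) = 4 * m := by
      simp [Module.finrank_pi_fintype, Complex.finrank_real_complex]
      ring
    omega

end IsUStarGeometry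

end LocalMaximumPrinciple

/-! ### Vector fields and Lie brackets in a chart -/

section ChartCoordinates

open Set Filter Topology

variable {E : Type*} [NormedAddCommGroup E] [NormedSpace ℝ E]
  {M : Type*} [TopologicalSpace M] [ChartedSpace E M] [IsManifold 𝓘(ℝ, E) ∞ M]

/-- The tangent space is the model space. -/
def tangentSpaceEquiv (y : M) : TangentSpace 𝓘(ℝ, E) y ≃L[ℝ] E := ContinuousLinearEquiv.refl ℝ E

open Classical in
/-- The trivialization of the tangent bundle over the chart at `a`, extended arbitrarily. -/
def tangentChart (a y : M) : TangentSpace 𝓘(ℝ, E) y ≃L[ℝ] E :=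
  if h : y ∈ (trivializationAt E (TangentSpace 𝓘(ℝ, E) : M → Type _) a).baseSet then
    (trivializationAt E (TangentSpace 𝓘(ℝ, E) : M → Type _) a).continuousLinearEquivAt ℝ y h
  else tangentSpaceEquiv y

/-- The coordinate expression of a vector field in the chart at `a`. -/
def coordField (a : M) (Z : ∀ y : M, TangentSpace 𝓘(ℝ, E) y) (p : E) : E :=
  tangentChart a ((extChartAt 𝓘(ℝ, E) a).symm p) (Z ((extChartAt 𝓘(ℝ, E) a).symm p))

variable {a : M}

theorem tangentChart_apply {y : M} (hy : y ∈ (chartAt E a).source) (v : TangentSpace 𝓘(ℝ, E) y) :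
    tangentChart a y v
      = (trivializationAt E (TangentSpace 𝓘(ℝ, E) : M → Type _) a ⟨y, v⟩).2 := by
  have hy' : y ∈ (trivializationAt E (TangentSpace 𝓘(ℝ, E) : M → Type _) a).baseSet := hy
  rw [tangentChart, dif_pos hy']
  rfl

theorem tangentChart_symm_apply {y : M} (hy : y ∈ (chartAt E a).source) (z : E) :
    (tangentChart a y).symm z
      = (trivializationAt E (TangentSpace 𝓘(ℝ, E) : M → Type _) a).symm y z := by
  have hy' : y ∈ (trivializationAt E (TangentSpace 𝓘(ℝ, E) : M → Type _) a).baseSet := hy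
  rw [tangentChart, dif_pos hy']
  rfl

theorem chart_symm_mem {M : Type*} [TopologicalSpace M] [ChartedSpace E M] {a : M} {p : E} (hp : p ∈ (extChartAt 𝓘(ℝ, E) a).target) :
    (extChartAt 𝓘(ℝ, E) a).symm p ∈ (chartAt E a).source := by
  simpa using (extChartAt 𝓘(ℝ, E) a).map_target hp

theorem chartSource_mem_nhds {M : Type*} [TopologicalSpace M] [ChartedSpace E M] {a : M} {p : E} (hp : p ∈ (extChartAt 𝓘(ℝ, E) a).target) :
    (chartAt E a).source ∈ 𝓝 ((extChartAt 𝓘(ℝ, E) a).symm p) :=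
  (chartAt E a).open_source.mem_nhds (chart_symm_mem hp)

theorem contMDiffAt_chart_symm {p : E} (hp : p ∈ (extChartAt 𝓘(ℝ, E) a).target) :
    ContMDiffAt 𝓘(ℝ, E) 𝓘(ℝ, E) ∞ (extChartAt 𝓘(ℝ, E) a).symm p :=
  (contMDiffOn_extChartAt_symm a).contMDiffAt ((isOpen_extChartAt_target a).mem_nhds hp)

theorem contMDiffAt_chart {y : M} (hy : y ∈ (chartAt E a).source) :
    ContMDiffAt 𝓘(ℝ, E) 𝓘(ℝ, E) ∞ (extChartAt 𝓘(ℝ, E) a) y :=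
  contMDiffAt_extChartAt' hy

/-- A function on `M` is differentiable if its chart expression is. -/
theorem mdifferentiableAt_comp_chart_symm_iff {F : Type*} [NormedAddCommGroup F] [NormedSpace ℝ F]
    {f : M → F} {p : E} (hp : p ∈ (extChartAt 𝓘(ℝ, E) a).target) :
    MDifferentiableAt 𝓘(ℝ, E) 𝓘(ℝ, F) f ((extChartAt 𝓘(ℝ, E) a).symm p) ↔
      DifferentiableAt ℝ (fun q => f ((extChartAt 𝓘(ℝ, E) a).symm q)) p := by
  refine ⟨fun h => ?_, fun h => ?_⟩
  · exact (MDifferentiableAt.comp p h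
      ((contMDiffAt_chart_symm hp).mdifferentiableAt (by simp))).differentiableAt
  · have hy := chart_symm_mem hp
    have h1 : MDifferentiableAt 𝓘(ℝ, E) 𝓘(ℝ, F)
        ((fun q => f ((extChartAt 𝓘(ℝ, E) a).symm q)) ∘ (extChartAt 𝓘(ℝ, E) a))
        ((extChartAt 𝓘(ℝ, E) a).symm p) := by
      refine MDifferentiableAt.comp _ ?_ ((contMDiffAt_chart hy).mdifferentiableAt (by simp))
      rw [(extChartAt 𝓘(ℝ, E) a).right_inv hp]
      exact h.mdifferentiableAt
    refine h1.congr_of_eventuallyEq ?_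
    filter_upwards [chartSource_mem_nhds hp] with y hy
    simp only [Function.comp_apply]
    rw [(extChartAt 𝓘(ℝ, E) a).left_inv (by simpa using hy)]

theorem contMDiffAt_comp_chart_symm_iff {F : Type*} [NormedAddCommGroup F] [NormedSpace ℝ F]
    {f : M → F} {p : E} (hp : p ∈ (extChartAt 𝓘(ℝ, E) a).target) :
    ContMDiffAt 𝓘(ℝ, E) 𝓘(ℝ, F) ∞ f ((extChartAt 𝓘(ℝ, E) a).symm p) ↔
      ContDiffAt ℝ ∞ (fun q => f ((extChartAt 𝓘(ℝ, E) a).symm q)) p := by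
  refine ⟨fun h => ?_, fun h => ?_⟩
  · exact (ContMDiffAt.comp p h (contMDiffAt_chart_symm hp)).contDiffAt
  · have hy := chart_symm_mem hp
    have h1 : ContMDiffAt 𝓘(ℝ, E) 𝓘(ℝ, F) ∞
        ((fun q => f ((extChartAt 𝓘(ℝ, E) a).symm q)) ∘ (extChartAt 𝓘(ℝ, E) a))
        ((extChartAt 𝓘(ℝ, E) a).symm p) := by
      refine ContMDiffAt.comp _ ?_ (contMDiffAt_chart hy)
      rw [(extChartAt 𝓘(ℝ, E) a).right_inv hp]
      exact h.contMDiffAt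
    refine h1.congr_of_eventuallyEq ?_
    filter_upwards [chartSource_mem_nhds hp] with y hy
    simp only [Function.comp_apply]
    rw [(extChartAt 𝓘(ℝ, E) a).left_inv (by simpa using hy)]

theorem mdifferentiableAt_iff_coordField {Z : ∀ y : M, TangentSpace 𝓘(ℝ, E) y} {p : E}
    (hp : p ∈ (extChartAt 𝓘(ℝ, E) a).target) :
    MDiffAt (T% Z) ((extChartAt 𝓘(ℝ, E) a).symm p) ↔ DifferentiableAt ℝ (coordField a Z) p := by
  have hy := chart_symm_mem hp
  refine ((trivializationAt E (TangentSpace 𝓘(ℝ, E) : M → Type _) a).mdifferentiableAt_section_iff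
    𝓘(ℝ, E) Z hy).trans (Iff.trans (Filter.EventuallyEq.mdifferentiableAt_iff ?_)
      (mdifferentiableAt_comp_chart_symm_iff (f := fun y => tangentChart a y (Z y)) hp))
  filter_upwards [chartSource_mem_nhds hp] with y hy
  exact (tangentChart_apply hy _).symm

theorem contMDiffAt_iff_coordField {Z : ∀ y : M, TangentSpace 𝓘(ℝ, E) y} {p : E}
    (hp : p ∈ (extChartAt 𝓘(ℝ, E) a).target) :
    ContMDiffAt 𝓘(ℝ, E) (𝓘(ℝ, E).prod 𝓘(ℝ, E)) ∞
      (fun y => (⟨y, Z y⟩ : TangentBundle 𝓘(ℝ, E) M)) ((extChartAt 𝓘(ℝ, E) a).symm p) ↔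
      ContDiffAt ℝ ∞ (coordField a Z) p := by
  have hy := chart_symm_mem hp
  have h1 := (trivializationAt E (TangentSpace 𝓘(ℝ, E) : M → Type _) a).contMDiffAt_section_iff
    (IB := 𝓘(ℝ, E)) (n := ∞) (s := Z) (x₀ := (extChartAt 𝓘(ℝ, E) a).symm p) hy
  refine h1.trans ?_
  refine Iff.trans ?_
    (contMDiffAt_comp_chart_symm_iff (f := fun y => tangentChart a y (Z y)) hp)
  have h2 : (fun y => (trivializationAt E (TangentSpace 𝓘(ℝ, E) : M → Type _) a ⟨y, Z y⟩).2)
      =ᶠ[𝓝 ((extChartAt 𝓘(ℝ, E) a).symm p)] fun y => tangentChart a y (Z y) := by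
    filter_upwards [chartSource_mem_nhds hp] with y hy
    exact (tangentChart_apply hy _).symm
  exact ⟨fun h => h.congr_of_eventuallyEq h2.symm, fun h => h.congr_of_eventuallyEq h2⟩

theorem mfderiv_chart {y : M} (hy : y ∈ (chartAt E a).source) :
    mfderiv 𝓘(ℝ, E) 𝓘(ℝ, E) (extChartAt 𝓘(ℝ, E) a) y
      = (tangentChart (E := E) a y : TangentSpace 𝓘(ℝ, E) y →L[ℝ] E) := by
  rw [← TangentBundle.continuousLinearMapAt_trivializationAt hy]
  ext v
  have hy' : y ∈ (trivializationAt E (TangentSpace 𝓘(ℝ, E) : M → Type _) a).baseSet := hy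
  rw [ContinuousLinearEquiv.coe_coe, tangentChart_apply hy]
  exact Bundle.Trivialization.continuousLinearMapAt_apply_of_mem ℝ _ hy' _

theorem mfderiv_chart_symm {p : E} (hp : p ∈ (extChartAt 𝓘(ℝ, E) a).target) :
    mfderiv 𝓘(ℝ, E) 𝓘(ℝ, E) (extChartAt 𝓘(ℝ, E) a).symm p
      = ((tangentChart (E := E) a ((extChartAt 𝓘(ℝ, E) a).symm p)).symm :
        E →L[ℝ] TangentSpace 𝓘(ℝ, E) ((extChartAt 𝓘(ℝ, E) a).symm p)) := by
  have h1 := mfderiv_extChartAt_comp_mfderivWithin_extChartAt_symm hp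
  rw [mfderiv_chart (chart_symm_mem hp)] at h1
  simp only [ModelWithCorners.range_eq_univ, mfderivWithin_univ] at h1
  ext v
  apply (tangentChart a ((extChartAt 𝓘(ℝ, E) a).symm p)).injective
  have h2 := congrArg (fun f : E →L[ℝ] E => f v) h1
  refine h2.trans ?_
  exact ((tangentChart (E := E) a ((extChartAt 𝓘(ℝ, E) a).symm p)).apply_symm_apply v).symm

variable [FiniteDimensional ℝ E]

theorem mlieBracket_vectorSpace {E : Type*} [NormedAddCommGroup E] [NormedSpace ℝ E] (X Y : E → E) (p : E) :
    mlieBracket 𝓘(ℝ, E) (M := E) X Y p = fderiv ℝ Y p (X p) - fderiv ℝ X p (Y p) := by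
  refine (congrFun (mlieBracketWithin_univ (I := 𝓘(ℝ, E)) (V := X) (W := Y)) p).symm.trans ?_
  refine (congrFun (mlieBracketWithin_eq_lieBracketWithin (𝕜 := ℝ) (s := univ) (V := X)
    (W := Y)) p).trans ?_
  rw [lieBracketWithin_univ]
  rfl

theorem coordField_mlieBracket {X Y : ∀ y : M, TangentSpace 𝓘(ℝ, E) y} {p : E}
    (hp : p ∈ (extChartAt 𝓘(ℝ, E) a).target)
    (hX : DifferentiableAt ℝ (coordField a X) p) (hY : DifferentiableAt ℝ (coordField a Y) p) :
    coordField a (mlieBracket 𝓘(ℝ, E) X Y) p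
      = fderiv ℝ (coordField a Y) p (coordField a X p)
        - fderiv ℝ (coordField a X) p (coordField a Y p) := by
  have : CompleteSpace E := FiniteDimensional.complete ℝ E
  have : IsManifold 𝓘(ℝ, E) (minSmoothness ℝ 2) M :=
    IsManifold.of_le (n := ∞) (by simp; exact WithTop.coe_le_coe.2 le_top)
  have hpull : ∀ Z : ∀ y : M, TangentSpace 𝓘(ℝ, E) y, ∀ q ∈ (extChartAt 𝓘(ℝ, E) a).target,
      mpullback 𝓘(ℝ, E) 𝓘(ℝ, E) (extChartAt 𝓘(ℝ, E) a).symm Z q = coordField a Z q := by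
    intro Z q hq
    rw [mpullback_apply, mfderiv_chart_symm hq]
    exact congrFun (congrArg DFunLike.coe
      (ContinuousLinearMap.inverse_equiv (tangentChart a ((extChartAt 𝓘(ℝ, E) a).symm q)).symm)) _
  have h1 := mpullback_mlieBracket (I := 𝓘(ℝ, E)) (I' := 𝓘(ℝ, E)) (n := ∞)
    ((mdifferentiableAt_iff_coordField hp).2 hX) ((mdifferentiableAt_iff_coordField hp).2 hY)
    (contMDiffAt_chart_symm hp) (by simp; exact WithTop.coe_le_coe.2 le_top)
  rw [hpull _ p hp] at h1
  have hev : ∀ Z : ∀ y : M, TangentSpace 𝓘(ℝ, E) y,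
      mpullback 𝓘(ℝ, E) 𝓘(ℝ, E) (extChartAt 𝓘(ℝ, E) a).symm Z =ᶠ[𝓝 p] coordField a Z := by
    intro Z
    filter_upwards [(isOpen_extChartAt_target a).mem_nhds hp] with q hq using hpull Z q hq
  exact h1.trans (((hev X).mlieBracket_vectorField_eq (hev Y)).trans
    (mlieBracket_vectorSpace _ _ _))

end ChartCoordinates

/-! ### The connection form in a chart -/

section ChartConnection

open Set Filter Topology

variable {E : Type*} [NormedAddCommGroup E] [NormedSpace ℝ E]
  {M : Type*} [TopologicalSpace M] [ChartedSpace E M] [IsManifold 𝓘(ℝ, E) ∞ M]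

/-- The flat connection of the chart at `a`. -/
def flatDeriv (a : M) (Z : ∀ y : M, TangentSpace 𝓘(ℝ, E) y) (y : M) :
    TangentSpace 𝓘(ℝ, E) y →L[ℝ] TangentSpace 𝓘(ℝ, E) y :=
  ((tangentChart (E := E) a y).symm : E →L[ℝ] TangentSpace 𝓘(ℝ, E) y) ∘L
    fderiv ℝ (coordField a Z) (extChartAt 𝓘(ℝ, E) a y) ∘L
      (tangentChart (E := E) a y : TangentSpace 𝓘(ℝ, E) y →L[ℝ] E)

theorem flatDeriv_apply (a : M) (Z : ∀ y : M, TangentSpace 𝓘(ℝ, E) y) (y : M)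
    (X : TangentSpace 𝓘(ℝ, E) y) : flatDeriv a Z y X = (tangentChart (E := E) a y).symm
      (fderiv ℝ (coordField a Z) (extChartAt 𝓘(ℝ, E) a y) (tangentChart (E := E) a y X)) := rfl

theorem fderiv_comp_chart_symm {F : Type*} [NormedAddCommGroup F] [NormedSpace ℝ F] {a : M}
    {f : M → F} {p : E} (hp : p ∈ (extChartAt 𝓘(ℝ, E) a).target)
    (hf : MDifferentiableAt 𝓘(ℝ, E) 𝓘(ℝ, F) f ((extChartAt 𝓘(ℝ, E) a).symm p))
    (X : TangentSpace 𝓘(ℝ, E) ((extChartAt 𝓘(ℝ, E) a).symm p)) :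
    mvfderiv 𝓘(ℝ, E) f ((extChartAt 𝓘(ℝ, E) a).symm p) X
      = fderiv ℝ (fun q => f ((extChartAt 𝓘(ℝ, E) a).symm q)) p
        (tangentChart (E := E) a ((extChartAt 𝓘(ℝ, E) a).symm p) X) := by
  have h1 := mfderiv_comp p hf ((contMDiffAt_chart_symm hp).mdifferentiableAt (by simp))
  rw [mfderiv_chart_symm hp] at h1
  have h2 := congrArg (fun L : E →L[ℝ] F =>
    L (tangentChart (E := E) a ((extChartAt 𝓘(ℝ, E) a).symm p) X)) h1
  refine Eq.trans ?_ (h2.symm.trans ?_)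
  · exact congrArg (fun Y => mvfderiv 𝓘(ℝ, E) f ((extChartAt 𝓘(ℝ, E) a).symm p) Y)
      ((tangentChart (E := E) a ((extChartAt 𝓘(ℝ, E) a).symm p)).symm_apply_apply X).symm
  · exact congrArg (fun L : E →L[ℝ] F => L _) mfderiv_eq_fderiv

/-- The flat connection serves as origin: its difference from `cov` is tensorial, and that
difference is the connection form. -/
theorem isCovariantDerivativeOn_flatDeriv (a : M) :
    IsCovariantDerivativeOn E (I := 𝓘(ℝ, E)) (flatDeriv (E := E) a) (chartAt E a).source where
  add {σ σ' y} hσ hσ' hy := by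
    have hy' : y ∈ (extChartAt 𝓘(ℝ, E) a).source := by simpa using hy
    obtain ⟨p, hp, rfl⟩ : ∃ p ∈ (extChartAt 𝓘(ℝ, E) a).target,
        (extChartAt 𝓘(ℝ, E) a).symm p = y :=
      ⟨_, (extChartAt 𝓘(ℝ, E) a).map_source hy', (extChartAt 𝓘(ℝ, E) a).left_inv hy'⟩
    have h1 := (mdifferentiableAt_iff_coordField hp).1 hσ
    have h2 := (mdifferentiableAt_iff_coordField hp).1 hσ'
    have h3 : coordField a (σ + σ') = coordField a σ + coordField a σ' := by
      funext q; exact map_add _ _ _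
    ext X
    rw [add_apply, flatDeriv_apply, flatDeriv_apply, flatDeriv_apply,
      (extChartAt 𝓘(ℝ, E) a).right_inv hp, h3, fderiv_add h1 h2, add_apply, map_add]
  leibniz {σ g y} hσ hg hy := by
    have hy' : y ∈ (extChartAt 𝓘(ℝ, E) a).source := by simpa using hy
    obtain ⟨p, hp, rfl⟩ : ∃ p ∈ (extChartAt 𝓘(ℝ, E) a).target,
        (extChartAt 𝓘(ℝ, E) a).symm p = y :=
      ⟨_, (extChartAt 𝓘(ℝ, E) a).map_source hy', (extChartAt 𝓘(ℝ, E) a).left_inv hy'⟩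
    have h1 := (mdifferentiableAt_iff_coordField hp).1 hσ
    have h2 := (mdifferentiableAt_comp_chart_symm_iff hp).1 hg
    have h3 : coordField a (g • σ)
        = fun q => g ((extChartAt 𝓘(ℝ, E) a).symm q) • coordField a σ q := by
      funext q; exact map_smul _ _ _
    ext X
    rw [add_apply, smul_apply, flatDeriv_apply, flatDeriv_apply, ContinuousLinearMap.smulRight_apply,
      (extChartAt 𝓘(ℝ, E) a).right_inv hp, h3, fderiv_fun_smul h2 h1, add_apply, map_add,
      smul_apply, map_smul, ContinuousLinearMap.smulRight_apply, map_smul,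
      fderiv_comp_chart_symm hp hg]
    congr 2
    exact (tangentChart (E := E) a _).symm_apply_apply _

variable [FiniteDimensional ℝ E]
  (cov : CovariantDerivative 𝓘(ℝ, E) E (TangentSpace 𝓘(ℝ, E) : M → Type _))

/-- The connection form of `cov` in the chart at `a`. -/
def chartConnection (a : M) (p : E) : E →L[ℝ] E →L[ℝ] E :=
  let T := tangentChart (E := E) a ((extChartAt 𝓘(ℝ, E) a).symm p)
  let D := IsCovariantDerivativeOn.difference (cov.isCovariantDerivativeOn (s := (chartAt E a).source))
    (isCovariantDerivativeOn_flatDeriv a) ((extChartAt 𝓘(ℝ, E) a).symm p)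
  LinearMap.toContinuousLinearMap
    { toFun := fun X => LinearMap.toContinuousLinearMap
        { toFun := fun z => T (D (T.symm z) (T.symm X))
          map_add' := fun z z' => by simp only [map_add, add_apply]
          map_smul' := fun c z => by simp only [map_smul, smul_apply, RingHom.id_apply] }
      map_add' := fun X X' => by
        ext z
        change T (D (T.symm z) (T.symm (X + X'))) = T (D (T.symm z) (T.symm X))
          + T (D (T.symm z) (T.symm X'))
        simp only [map_add]
      map_smul' := fun c X => by
        ext z
        change T (D (T.symm z) (T.symm (c • X))) = c • T (D (T.symm z) (T.symm X))
        simp only [map_smul] }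

variable {cov} {a : M}

/-- The covariant derivative in a chart. -/
theorem tangentChart_cov {Z : ∀ y : M, TangentSpace 𝓘(ℝ, E) y} {p : E}
    (hp : p ∈ (extChartAt 𝓘(ℝ, E) a).target) (hZ : DifferentiableAt ℝ (coordField a Z) p)
    (X : TangentSpace 𝓘(ℝ, E) ((extChartAt 𝓘(ℝ, E) a).symm p)) :
    tangentChart (E := E) a ((extChartAt 𝓘(ℝ, E) a).symm p)
      (cov Z ((extChartAt 𝓘(ℝ, E) a).symm p) X)
    = fderiv ℝ (coordField a Z) p (tangentChart (E := E) a ((extChartAt 𝓘(ℝ, E) a).symm p) X)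
      + chartConnection cov a p (tangentChart (E := E) a ((extChartAt 𝓘(ℝ, E) a).symm p) X)
        (coordField a Z p) := by
  set T := tangentChart (E := E) a ((extChartAt 𝓘(ℝ, E) a).symm p) with hT
  have h1 := IsCovariantDerivativeOn.difference_apply
    (cov.isCovariantDerivativeOn (s := (chartAt E a).source))
    (isCovariantDerivativeOn_flatDeriv a) (chart_symm_mem hp)
    ((mdifferentiableAt_iff_coordField hp).2 hZ)
  have h2 : chartConnection cov a p (T X) (coordField a Z p)
      = T (IsCovariantDerivativeOn.difference
        (cov.isCovariantDerivativeOn (s := (chartAt E a).source))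
        (isCovariantDerivativeOn_flatDeriv a) ((extChartAt 𝓘(ℝ, E) a).symm p)
          (T.symm (T (Z _))) (T.symm (T X))) := rfl
  rw [h2, T.symm_apply_apply, T.symm_apply_apply, h1, sub_apply, flatDeriv_apply, map_sub,
    (extChartAt 𝓘(ℝ, E) a).right_inv hp, ← hT, T.apply_symm_apply]
  abel

end ChartConnection

/-! ### Smoothness, symmetry and curvature of the connection form -/

section ChartConnectionProperties

open Set Filter Topology

variable {E : Type*} [NormedAddCommGroup E] [NormedSpace ℝ E]
  {M : Type*} [TopologicalSpace M] [ChartedSpace E M] [IsManifold 𝓘(ℝ, E) ∞ M]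

/-- The vector field that is constant in the chart at `a`. -/
def coordConst (a : M) (z : E) (y : M) : TangentSpace 𝓘(ℝ, E) y :=
  (tangentChart (E := E) a y).symm z

@[simp] theorem coordField_coordConst (a : M) (z : E) :
    coordField a (coordConst a z) = fun _ => z := by
  funext p
  exact (tangentChart (E := E) a _).apply_symm_apply z

variable [FiniteDimensional ℝ E]
  {cov : CovariantDerivative 𝓘(ℝ, E) E (TangentSpace 𝓘(ℝ, E) : M → Type _)} {a : M}

theorem chartConnection_apply {p : E} (hp : p ∈ (extChartAt 𝓘(ℝ, E) a).target) (x z : E) :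
    chartConnection cov a p x z
      = coordField a (fun y => cov (coordConst a z) y (coordConst a x y)) p := by
  have h1 := tangentChart_cov (cov := cov) (Z := coordConst a z) hp
    (by rw [coordField_coordConst]; exact differentiableAt_const z)
    (coordConst a x ((extChartAt 𝓘(ℝ, E) a).symm p))
  rw [coordField_coordConst] at h1
  have h2 : tangentChart (E := E) a ((extChartAt 𝓘(ℝ, E) a).symm p)
      (coordConst a x ((extChartAt 𝓘(ℝ, E) a).symm p)) = x :=
    (tangentChart (E := E) a _).apply_symm_apply x
  rw [h2, fderiv_fun_const] at h1
  exact (h1.trans (zero_add _)).symm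

/-- The connection form is the covariant derivative of coordinate fields. These live only in the
chart, while smoothness of `cov` is applied to a global smooth field; a bump function equal to `1`
near the point bridges the gap by locality. -/
theorem contDiffOn_chartConnection [T2Space M] (hcov : cov.ContMDiffCovariantDerivative ∞)
    (a : M) : ContDiffOn ℝ ∞ (chartConnection cov a) (extChartAt 𝓘(ℝ, E) a).target := by
  rw [contDiffOn_clm_apply]
  intro x
  rw [contDiffOn_clm_apply]
  intro z p hp
  refine ContDiffAt.contDiffWithinAt ?_
  set y₀ := (extChartAt 𝓘(ℝ, E) a).symm p with hy₀
  obtain ⟨f, -, hf⟩ := (SmoothBumpFunction.nhds_basis_tsupport (I := 𝓘(ℝ, E)) y₀).mem_iff.1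
    (chartSource_mem_nhds hp)
  have hconst : ∀ z : E, ∀ y ∈ (chartAt E a).source,
      ContMDiffAt 𝓘(ℝ, E) (𝓘(ℝ, E).prod 𝓘(ℝ, E)) ∞
        (fun y => (⟨y, coordConst a z y⟩ : TangentBundle 𝓘(ℝ, E) M)) y := by
    intro z y hy
    have hy' : y ∈ (extChartAt 𝓘(ℝ, E) a).source := by simpa using hy
    rw [← (extChartAt 𝓘(ℝ, E) a).left_inv hy',
      contMDiffAt_iff_coordField ((extChartAt 𝓘(ℝ, E) a).map_source hy'), coordField_coordConst]
    exact contDiffAt_const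
  set Z : ∀ y : M, TangentSpace 𝓘(ℝ, E) y := (f : M → ℝ) • coordConst a z with hZ
  have hZs : ContMDiff 𝓘(ℝ, E) (𝓘(ℝ, E).prod 𝓘(ℝ, E)) ∞
      (fun y => (⟨y, Z y⟩ : TangentBundle 𝓘(ℝ, E) M)) :=
    ContMDiffOn.smul_section_of_tsupport f.contMDiff.contMDiffOn (chartAt E a).open_source hf
      (fun y hy => (hconst z y hy).contMDiffWithinAt)
  have h1 := hcov.contMDiff.contMDiff (σ := Z) hZs.contMDiffOn
  have h2 : ContMDiffAt 𝓘(ℝ, E) (𝓘(ℝ, E).prod 𝓘(ℝ, E)) ∞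
      (fun y => (⟨y, cov Z y (coordConst a x y)⟩ : TangentBundle 𝓘(ℝ, E) M)) y₀ :=
    ContMDiffAt.clm_bundle_apply (h1.contMDiffAt univ_mem) (hconst x y₀ (chart_symm_mem hp))
  rw [hy₀, contMDiffAt_iff_coordField (a := a) (Z := fun y => cov Z y (coordConst a x y)) hp] at h2
  refine h2.congr_of_eventuallyEq ?_
  have hcont : ContinuousAt (extChartAt 𝓘(ℝ, E) a).symm p :=
    (contMDiffAt_chart_symm hp).continuousAt
  have h3 : ∀ᶠ q in 𝓝 p, ∀ᶠ y in 𝓝 ((extChartAt 𝓘(ℝ, E) a).symm q), f y = 1 :=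
    hcont.eventually (eventually_eventually_nhds.2 f.eventuallyEq_one)
  filter_upwards [h3, (isOpen_extChartAt_target a).mem_nhds hp] with q hq hqΩ
  rw [chartConnection_apply hqΩ]
  change tangentChart (E := E) a _ (cov _ _ _) = tangentChart (E := E) a _ (cov _ _ _)
  congr 2
  refine cov.isCovariantDerivativeOnUniv.congr_of_eventuallyEq ?_ ?_ univ_mem ?_
  · exact (hconst z _ (chart_symm_mem hqΩ)).mdifferentiableAt (by simp)
  · exact (hZs _).mdifferentiableAt (by simp)
  · filter_upwards [hq] with y hy
    simp [hZ, hy]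

/-- Coordinate fields have vanishing bracket, so zero torsion reduces to this symmetry. -/
theorem chartConnection_symm (htor : cov.torsion = 0) {p : E}
    (hp : p ∈ (extChartAt 𝓘(ℝ, E) a).target) (x z : E) :
    chartConnection cov a p x z = chartConnection cov a p z x := by
  have hd : ∀ z : E, DifferentiableAt ℝ (coordField a (coordConst a z)) p := fun z => by
    rw [coordField_coordConst]; exact differentiableAt_const z
  have h1 := cov.torsion_eq_zero_iff.1 htor
    ((mdifferentiableAt_iff_coordField hp).2 (hd x)) ((mdifferentiableAt_iff_coordField hp).2 (hd z))
  have h2 := coordField_mlieBracket hp (hd x) (hd z)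
  simp only [coordField_coordConst, fderiv_fun_const] at h2
  have h3 : coordField a (mlieBracket 𝓘(ℝ, E) (coordConst a x) (coordConst a z)) p = 0 :=
    h2.trans (sub_self _)
  rw [chartConnection_apply hp, chartConnection_apply hp, ← sub_eq_zero, ← h3]
  change tangentChart (E := E) a _ _ - tangentChart (E := E) a _ _ = tangentChart (E := E) a _ _
  rw [← map_sub, h1]

/-- The covariant derivative of a vector field along a vector field in a chart. -/
theorem coordField_cov {X Z : ∀ y : M, TangentSpace 𝓘(ℝ, E) y} {p : E}
    (hp : p ∈ (extChartAt 𝓘(ℝ, E) a).target) (hZ : DifferentiableAt ℝ (coordField a Z) p) :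
    coordField a (fun y => cov Z y (X y)) p = fderiv ℝ (coordField a Z) p (coordField a X p)
      + chartConnection cov a p (coordField a X p) (coordField a Z p) :=
  tangentChart_cov hp hZ _

theorem coordField_cov_eventuallyEq {X Z : ∀ y : M, TangentSpace 𝓘(ℝ, E) y} {p : E}
    (hp : p ∈ (extChartAt 𝓘(ℝ, E) a).target) (hZ : ContDiffAt ℝ ∞ (coordField a Z) p) :
    coordField a (fun y => cov Z y (X y)) =ᶠ[𝓝 p]
      fun q => fderiv ℝ (coordField a Z) q (coordField a X q)
        + chartConnection cov a q (coordField a X q) (coordField a Z q) := by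
  have h1 : ∀ᶠ q in 𝓝 p, ContDiffAt ℝ 1 (coordField a Z) q :=
    (hZ.of_le (by norm_cast)).eventually (by simp)
  filter_upwards [h1, (isOpen_extChartAt_target a).mem_nhds hp] with q hq hqΩ
  exact coordField_cov hqΩ (hq.differentiableAt (by simp))

theorem exists_hasFDerivAt_coordField_cov [T2Space M]
    (hcov : cov.ContMDiffCovariantDerivative ∞) {X Z : ∀ y : M, TangentSpace 𝓘(ℝ, E) y} {p : E}
    (hp : p ∈ (extChartAt 𝓘(ℝ, E) a).target) (hX : ContDiffAt ℝ ∞ (coordField a X) p)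
    (hZ : ContDiffAt ℝ ∞ (coordField a Z) p) :
    ∃ D : E →L[ℝ] E, HasFDerivAt (coordField a (fun y => cov Z y (X y))) D p ∧ ∀ v, D v =
      fderiv ℝ (fderiv ℝ (coordField a Z)) p v (coordField a X p)
        + fderiv ℝ (coordField a Z) p (fderiv ℝ (coordField a X) p v)
        + fderiv ℝ (chartConnection cov a) p v (coordField a X p) (coordField a Z p)
        + chartConnection cov a p (fderiv ℝ (coordField a X) p v) (coordField a Z p)
        + chartConnection cov a p (coordField a X p) (fderiv ℝ (coordField a Z) p v) := by
  have h1 : HasFDerivAt (coordField a X) (fderiv ℝ (coordField a X) p) p :=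
    (hX.differentiableAt (by simp)).hasFDerivAt
  have h2 : HasFDerivAt (coordField a Z) (fderiv ℝ (coordField a Z) p) p :=
    (hZ.differentiableAt (by simp)).hasFDerivAt
  have h3 : HasFDerivAt (fderiv ℝ (coordField a Z)) (fderiv ℝ (fderiv ℝ (coordField a Z)) p) p :=
    ((hZ.fderiv_right (m := 1) (by norm_cast)).differentiableAt (by simp)).hasFDerivAt
  have h4 : HasFDerivAt (chartConnection cov a) (fderiv ℝ (chartConnection cov a) p) p :=
    (((contDiffOn_chartConnection hcov a).contDiffAt
      ((isOpen_extChartAt_target a).mem_nhds hp)).differentiableAt (by simp)).hasFDerivAt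
  refine ⟨_, ((h3.clm_apply h1).add ((h4.clm_apply h1).clm_apply h2)).congr_of_eventuallyEq
    (coordField_cov_eventuallyEq hp hZ), fun v => ?_⟩
  simp
  abel

/-- The curvature in a chart. -/
theorem coordField_curvatureFields [T2Space M] (hcov : cov.ContMDiffCovariantDerivative ∞)
    {X Y Z : ∀ y : M, TangentSpace 𝓘(ℝ, E) y} {p : E}
    (hp : p ∈ (extChartAt 𝓘(ℝ, E) a).target) (hX : ContDiffAt ℝ ∞ (coordField a X) p)
    (hY : ContDiffAt ℝ ∞ (coordField a Y) p) (hZ : ContDiffAt ℝ ∞ (coordField a Z) p) :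
    coordField a (curvatureFields cov X Y Z) p
      = connCurvature (chartConnection cov a) p (coordField a X p) (coordField a Y p)
        (coordField a Z p) := by
  obtain ⟨D₁, hD₁, hD₁'⟩ := exists_hasFDerivAt_coordField_cov hcov hp hX hZ
  obtain ⟨D₂, hD₂, hD₂'⟩ := exists_hasFDerivAt_coordField_cov hcov hp hY hZ
  have hZd : DifferentiableAt ℝ (coordField a Z) p := hZ.differentiableAt (by simp)
  have e1 := coordField_cov (cov := cov) (X := X) hp hD₂.differentiableAt
  have e2 := coordField_cov (cov := cov) (X := Y) hp hD₁.differentiableAt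
  have e3 := coordField_cov (cov := cov) (X := mlieBracket 𝓘(ℝ, E) X Y) hp hZd
  rw [hD₂.fderiv, hD₂', coordField_cov hp hZd] at e1
  rw [hD₁.fderiv, hD₁', coordField_cov hp hZd] at e2
  rw [coordField_mlieBracket hp (hX.differentiableAt (by simp)) (hY.differentiableAt (by simp))] at e3
  have hsymm := hZ.isSymmSndFDerivAt (by simp; exact WithTop.coe_le_coe.2 le_top)
    (coordField a X p) (coordField a Y p)
  have e4 : coordField a (curvatureFields cov X Y Z) p
      = coordField a (fun y => cov (fun y => cov Z y (Y y)) y (X y)) p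
        - coordField a (fun y => cov (fun y => cov Z y (X y)) y (Y y)) p
        - coordField a (fun y => cov Z y (mlieBracket 𝓘(ℝ, E) X Y y)) p := by
    change tangentChart (E := E) a _ (_ - _ - _) = _
    rw [map_sub, map_sub]
    rfl
  rw [e4, e1, e2, e3, hsymm]
  simp only [connCurvature, add_apply, sub_apply, mul_apply_eq_comp, map_add, map_sub]
  abel

theorem tangentChart_curvature [T2Space M] (hcov : cov.ContMDiffCovariantDerivative ∞) {p : E}
    (hp : p ∈ (extChartAt 𝓘(ℝ, E) a).target)
    (X Y Z : TangentSpace 𝓘(ℝ, E) ((extChartAt 𝓘(ℝ, E) a).symm p)) :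
    tangentChart (E := E) a ((extChartAt 𝓘(ℝ, E) a).symm p)
      (curvature cov ((extChartAt 𝓘(ℝ, E) a).symm p) X Y Z)
    = connCurvature (chartConnection cov a) p
      (tangentChart (E := E) a ((extChartAt 𝓘(ℝ, E) a).symm p) X)
      (tangentChart (E := E) a ((extChartAt 𝓘(ℝ, E) a).symm p) Y)
      (tangentChart (E := E) a ((extChartAt 𝓘(ℝ, E) a).symm p) Z) := by
  have h : ∀ X : TangentSpace 𝓘(ℝ, E) ((extChartAt 𝓘(ℝ, E) a).symm p),
      ContDiffAt ℝ ∞ (coordField a (FiberBundle.extend E X)) p := fun X =>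
    (contMDiffAt_iff_coordField hp).1 (FiberBundle.contMDiffAt_extend (k := ∞) 𝓘(ℝ, E) E X)
  have h1 := coordField_curvatureFields hcov hp (h X) (h Y) (h Z)
  have h2 : ∀ X : TangentSpace 𝓘(ℝ, E) ((extChartAt 𝓘(ℝ, E) a).symm p),
      coordField a (FiberBundle.extend E X) p
        = tangentChart (E := E) a ((extChartAt 𝓘(ℝ, E) a).symm p) X := fun X =>
    congrArg _ (FiberBundle.extend_apply_self E X)
  rw [h2, h2, h2] at h1
  exact h1

end ChartConnectionProperties

/-! ### Parallel transport in a chart -/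

section ParallelTransport

open Set Filter Topology

variable {E : Type*} [NormedAddCommGroup E] [NormedSpace ℝ E]
  {M : Type*} [TopologicalSpace M] [ChartedSpace E M] [IsManifold 𝓘(ℝ, E) ∞ M]

/-- A form of the constructor whose endpoints are known only up to a propositional equality, as for
a reversed curve, which starts at `γ (1 - 0)`. -/
theorem IsParallelTransport.of_curve
    {cov : CovariantDerivative 𝓘(ℝ, E) E (TangentSpace 𝓘(ℝ, E) : M → Type _)}
    {x y : M} (γ : ℝ → M) (hγ : ContMDiff 𝓘(ℝ, ℝ) 𝓘(ℝ, E) ∞ γ) (h0 : γ 0 = x) (h1 : γ 1 = y)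
    (P : TangentSpace 𝓘(ℝ, E) x ≃L[ℝ] TangentSpace 𝓘(ℝ, E) y)
    (hP : ∀ v, ∃ V : ∀ t, TangentSpace 𝓘(ℝ, E) (γ t),
      IsParallelAlong cov γ V ∧ HEq (V 0) v ∧ HEq (V 1) (P v)) :
    IsParallelTransport cov x y P := by
  subst h0 h1
  refine IsParallelTransport.curve γ hγ P fun v => ?_
  obtain ⟨V, hV, e0, e1⟩ := hP v
  exact ⟨V, hV, eq_of_heq e0, eq_of_heq e1⟩

theorem IsParallelAlong.reverse
    {cov : CovariantDerivative 𝓘(ℝ, E) E (TangentSpace 𝓘(ℝ, E) : M → Type _)}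
    {γ : ℝ → M} (hγ : ContMDiff 𝓘(ℝ, ℝ) 𝓘(ℝ, E) ∞ γ) {V : ∀ t, TangentSpace 𝓘(ℝ, E) (γ t)}
    (hV : IsParallelAlong cov γ V) :
    IsParallelAlong cov (fun t => γ (1 - t)) (fun t => V (1 - t)) := by
  intro t
  have hd : HasDerivAt (fun t : ℝ => 1 - t) (-1) t := by
    simpa using (hasDerivAt_id t).const_sub 1
  have h1 := (hV (1 - t)).scomp t hd
  have h2 : mfderiv 𝓘(ℝ, ℝ) 𝓘(ℝ, E) (fun t => γ (1 - t)) t (1 : ℝ)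
      = -mfderiv 𝓘(ℝ, ℝ) 𝓘(ℝ, E) γ (1 - t) (1 : ℝ) := by
    have h3 := (((hγ (1 - t)).mdifferentiableAt (by simp)).hasMFDerivAt).comp t
      hd.hasFDerivAt.hasMFDerivAt
    have h4 := h3.mfderiv
    refine (congrArg (fun L : ℝ →L[ℝ] E => L 1) h4).trans ?_
    change mfderiv 𝓘(ℝ, ℝ) 𝓘(ℝ, E) γ (1 - t) ((1 : ℝ) • (-1 : ℝ)) = _
    rw [one_smul]
    exact map_neg _ _
  refine h1.congr_deriv ?_
  simp only [h2, map_neg]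
  rw [neg_smul, one_smul, neg_neg]
  have hb : γ (1 - t) ∈ (trivializationAt E (TangentSpace 𝓘(ℝ, E) : M → Type _)
    (γ (1 - t))).baseSet := FiberBundle.mem_baseSet_trivializationAt' (γ (1 - t))
  have hneg : ∀ ξ : TangentSpace 𝓘(ℝ, E) (γ (1 - t)),
      (trivializationAt E (TangentSpace 𝓘(ℝ, E) : M → Type _) (γ (1 - t)) ⟨γ (1 - t), -ξ⟩).2
        = -(trivializationAt E (TangentSpace 𝓘(ℝ, E) : M → Type _) (γ (1 - t))
          ⟨γ (1 - t), ξ⟩).2 := fun ξ => by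
    rw [← Bundle.Trivialization.continuousLinearMapAt_apply_of_mem ℝ _ hb,
      ← Bundle.Trivialization.continuousLinearMapAt_apply_of_mem ℝ _ hb]
    exact map_neg _ ξ
  exact ((congrArg Neg.neg (hneg _)).trans (neg_neg _)).symm

theorem IsParallelTransport.symm
    {cov : CovariantDerivative 𝓘(ℝ, E) E (TangentSpace 𝓘(ℝ, E) : M → Type _)}
    {x y : M} {P : TangentSpace 𝓘(ℝ, E) x ≃L[ℝ] TangentSpace 𝓘(ℝ, E) y}
    (h : IsParallelTransport cov x y P) : IsParallelTransport cov y x P.symm := by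
  induction h with
  | curve γ hγ P hP =>
    refine IsParallelTransport.of_curve (fun t => γ (1 - t)) ?_ (by simp) (by simp) P.symm
      fun v => ?_
    · have : ContMDiff 𝓘(ℝ, ℝ) 𝓘(ℝ, ℝ) ∞ (fun t : ℝ => 1 - t) :=
        (contDiff_const.sub contDiff_id).contMDiff
      exact hγ.comp this
    · obtain ⟨V, hV, e0, e1⟩ := hP (P.symm v)
      refine ⟨fun t => V (1 - t), hV.reverse hγ, ?_, ?_⟩
      · have e2 : HEq (V (1 - 0)) (V 1) := congr_arg_heq V (sub_zero 1)
        rw [e1, P.apply_symm_apply] at e2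
        exact e2
      · have e2 : HEq (V (1 - 1)) (V 0) := congr_arg_heq V (sub_self 1)
        rw [e0] at e2
        exact e2
  | trans hP hQ ihP ihQ => exact ihQ.trans ihP

theorem differentiableAt_coordChange (a b : M) {γ : ℝ → M} {t : ℝ}
    (hγ : MDifferentiableAt 𝓘(ℝ, ℝ) 𝓘(ℝ, E) γ t) (ha : γ t ∈ (chartAt E a).source)
    (hb : γ t ∈ (chartAt E b).source) :
    DifferentiableAt ℝ (fun r => (tangentChart (E := E) b (γ r) : TangentSpace 𝓘(ℝ, E) (γ r) →L[ℝ] E) ∘L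
      ((tangentChart (E := E) a (γ r)).symm : E →L[ℝ] TangentSpace 𝓘(ℝ, E) (γ r))) t := by
  have h1 := (contMDiffAt_coordChangeL (n := ∞) (IB := 𝓘(ℝ, E))
    (e := trivializationAt E (TangentSpace 𝓘(ℝ, E) : M → Type _) a)
    (e' := trivializationAt E (TangentSpace 𝓘(ℝ, E) : M → Type _) b) ha hb).mdifferentiableAt
    (by simp)
  have h2 := (MDifferentiableAt.comp t h1 hγ).differentiableAt
  refine h2.congr_of_eventuallyEq ?_
  filter_upwards [hγ.continuousAt.eventually ((chartAt E a).open_source.mem_nhds ha),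
    hγ.continuousAt.eventually ((chartAt E b).open_source.mem_nhds hb)] with r hra hrb
  ext z
  refine (tangentChart_apply hrb _).trans ?_
  refine Eq.trans ?_ (Bundle.Trivialization.coordChangeL_apply _ _ ⟨hra, hrb⟩ z).symm
  exact congrArg (fun ξ => (trivializationAt E (TangentSpace 𝓘(ℝ, E) : M → Type _) b
    ⟨γ r, ξ⟩).2) (tangentChart_symm_apply hra z)

theorem hasMFDerivAt_chart_symm_comp {a : M} {c : ℝ → E} {t : ℝ} {c' : E}
    (hc : c t ∈ (extChartAt 𝓘(ℝ, E) a).target) (hd : HasDerivAt c c' t) :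
    MDifferentiableAt 𝓘(ℝ, ℝ) 𝓘(ℝ, E) (fun t => (extChartAt 𝓘(ℝ, E) a).symm (c t)) t ∧
    tangentChart (E := E) a ((extChartAt 𝓘(ℝ, E) a).symm (c t))
      (mfderiv 𝓘(ℝ, ℝ) 𝓘(ℝ, E) (fun t => (extChartAt 𝓘(ℝ, E) a).symm (c t)) t (1 : ℝ)) = c' := by
  have h1 := ((contMDiffAt_chart_symm hc).mdifferentiableAt (by simp)).hasMFDerivAt
  rw [mfderiv_chart_symm hc] at h1
  have h2 := h1.comp t hd.hasFDerivAt.hasMFDerivAt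
  refine ⟨h2.mdifferentiableAt, ?_⟩
  have h3 : mfderiv 𝓘(ℝ, ℝ) 𝓘(ℝ, E) (fun t => (extChartAt 𝓘(ℝ, E) a).symm (c t)) t (1 : ℝ)
      = (tangentChart (E := E) a ((extChartAt 𝓘(ℝ, E) a).symm (c t))).symm ((1 : ℝ) • c') :=
    congrArg (fun L : ℝ →L[ℝ] E => L 1) h2.mfderiv
  rw [h3, one_smul]
  exact (tangentChart (E := E) a _).apply_symm_apply c'

variable [FiniteDimensional ℝ E]
  {cov : CovariantDerivative 𝓘(ℝ, E) E (TangentSpace 𝓘(ℝ, E) : M → Type _)} {a : M}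

/-- Parallel vector fields along a curve in a chart. -/
theorem isParallelAlong_chart {c c' z : ℝ → E}
    (hc : ∀ t, c t ∈ (extChartAt 𝓘(ℝ, E) a).target) (hd : ∀ t, HasDerivAt c (c' t) t)
    (hz : ∀ t, HasDerivAt z (-(chartConnection cov a (c t) (c' t) (z t))) t) :
    IsParallelAlong cov (fun t => (extChartAt 𝓘(ℝ, E) a).symm (c t))
      (fun t => (tangentChart (E := E) a ((extChartAt 𝓘(ℝ, E) a).symm (c t))).symm (z t)) := by
  intro t
  set γ : ℝ → M := fun t => (extChartAt 𝓘(ℝ, E) a).symm (c t) with hγ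
  set V : ∀ t, TangentSpace 𝓘(ℝ, E) (γ t) :=
    fun t => (tangentChart (E := E) a (γ t)).symm (z t) with hV
  obtain ⟨hγd, hγ'⟩ := hasMFDerivAt_chart_symm_comp (a := a) (hc t) (hd t)
  have ha : γ t ∈ (chartAt E a).source := chart_symm_mem (hc t)
  have hb : γ t ∈ (chartAt E (γ t)).source := mem_chart_source E (γ t)
  have hτ := (differentiableAt_coordChange a (γ t) hγd ha hb).hasDerivAt
  set τ : ℝ → E →L[ℝ] E := fun r => (tangentChart (E := E) (γ t) (γ r) : TangentSpace 𝓘(ℝ, E) (γ r) →L[ℝ] E) ∘L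
      ((tangentChart (E := E) a (γ r)).symm : E →L[ℝ] TangentSpace 𝓘(ℝ, E) (γ r)) with hτdef
  have hτa : ∀ r (ξ : TangentSpace 𝓘(ℝ, E) (γ r)),
      τ r (tangentChart (E := E) a (γ r) ξ) = tangentChart (E := E) (γ t) (γ r) ξ := fun r ξ =>
    congrArg (tangentChart (E := E) (γ t) (γ r)) ((tangentChart (E := E) a (γ r)).symm_apply_apply ξ)
  set W : ∀ y : M, TangentSpace 𝓘(ℝ, E) y := FiberBundle.extend E (V t) with hW
  have hWd : DifferentiableAt ℝ (coordField a W) (c t) :=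
    (mdifferentiableAt_iff_coordField (hc t)).1
      (FiberBundle.mdifferentiableAt_extend 𝓘(ℝ, E) E (V t))
  have hWt : coordField a W (c t) = z t := by
    refine (congrArg (tangentChart (E := E) a (γ t)) (FiberBundle.extend_apply_self E (V t))).trans ?_
    exact (tangentChart (E := E) a (γ t)).apply_symm_apply (z t)
  have hev : ∀ᶠ r in 𝓝 t, γ r ∈ (chartAt E (γ t)).source :=
    hγd.continuousAt.eventually ((chartAt E (γ t)).open_source.mem_nhds hb)
  -- The definition of a parallel field at time `t` uses the chart at `γ t`, the given equation the
  -- chart at `a`. Since `W` is constant in the former, differentiating `τ W` expresses `τ'` through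
  -- `dW`, and the terms caused by the change of chart cancel.
  have hconst : ∀ᶠ r in 𝓝 t, τ r (coordField a W (c r))
      = (trivializationAt E (TangentSpace 𝓘(ℝ, E) : M → Type _) (γ t) ⟨γ t, V t⟩).2 := by
    filter_upwards [hev] with r hr
    refine (hτa r (W (γ r))).trans ((tangentChart_apply hr _).trans ?_)
    have h1 := Bundle.Trivialization.apply_mk_symm
      (trivializationAt E (TangentSpace 𝓘(ℝ, E) : M → Type _) (γ t)) (b := γ r) hr
      (trivializationAt E (TangentSpace 𝓘(ℝ, E) : M → Type _) (γ t) ⟨γ t, V t⟩).2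
    have h2 := congrArg Prod.snd h1
    exact h2
  have hωd : HasDerivAt (fun r => coordField a W (c r)) (fderiv ℝ (coordField a W) (c t) (c' t)) t :=
    hWd.hasFDerivAt.comp_hasDerivAt t (hd t)
  have h1 := (hτ.clm_apply hωd).unique ((hasDerivAt_const t _).congr_of_eventuallyEq hconst)
  have h2 := hτ.clm_apply (hz t)
  have h3 : (trivializationAt E (TangentSpace 𝓘(ℝ, E) : M → Type _) (γ t)
      ⟨γ t, cov W (γ t) (mfderiv 𝓘(ℝ, ℝ) 𝓘(ℝ, E) γ t (1 : ℝ))⟩).2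
      = τ t (fderiv ℝ (coordField a W) (c t) (c' t)
        + chartConnection cov a (c t) (c' t) (z t)) := by
    refine (tangentChart_apply hb _).symm.trans ((hτa t _).symm.trans (congrArg (τ t) ?_))
    have h4 := tangentChart_cov (cov := cov) (hc t) hWd
      (mfderiv 𝓘(ℝ, ℝ) 𝓘(ℝ, E) γ t (1 : ℝ))
    rw [hγ', hWt] at h4
    exact h4
  have h5 : HasDerivAt (fun r => (trivializationAt E (TangentSpace 𝓘(ℝ, E) : M → Type _) (γ t)
      ⟨γ r, V r⟩).2) (deriv τ t (z t) + τ t (-(chartConnection cov a (c t) (c' t) (z t)))) t := by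
    refine h2.congr_of_eventuallyEq ?_
    filter_upwards [hev] with r hr
    exact (tangentChart_apply hr _).symm
  refine h5.congr_deriv ?_
  refine Eq.trans ?_ (congrArg Neg.neg h3).symm
  rw [hWt] at h1
  rw [map_add, map_neg]
  linear_combination (norm := module) h1

/-- Parallel transport along a curve in a chart. -/
theorem isParallelTransport_chart {c : ℝ → E} (hcs : ContDiff ℝ ∞ c)
    (hc : ∀ t, c t ∈ (extChartAt 𝓘(ℝ, E) a).target) {p q : E} (h0 : c 0 = p) (h1 : c 1 = q)
    (A : E ≃L[ℝ] E) (hA : ∀ z₀, ∃ z : ℝ → E, z 0 = z₀ ∧ z 1 = A z₀ ∧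
      ∀ t, HasDerivAt z (-(chartConnection cov a (c t) (deriv c t) (z t))) t) :
    IsParallelTransport cov ((extChartAt 𝓘(ℝ, E) a).symm p) ((extChartAt 𝓘(ℝ, E) a).symm q)
      ((tangentChart (E := E) a ((extChartAt 𝓘(ℝ, E) a).symm p)).trans
        (A.trans (tangentChart (E := E) a ((extChartAt 𝓘(ℝ, E) a).symm q)).symm)) := by
  subst h0 h1
  refine IsParallelTransport.curve (fun t => (extChartAt 𝓘(ℝ, E) a).symm (c t)) ?_ _ fun v => ?_
  · exact fun t => (contMDiffAt_chart_symm (hc t)).comp t hcs.contMDiff.contMDiffAt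
  · obtain ⟨z, hz0, hz1, hz⟩ := hA (tangentChart (E := E) a ((extChartAt 𝓘(ℝ, E) a).symm (c 0)) v)
    refine ⟨fun t => (tangentChart (E := E) a ((extChartAt 𝓘(ℝ, E) a).symm (c t))).symm (z t),
      isParallelAlong_chart hc (fun t => (hcs.differentiable (by simp) t).hasDerivAt) hz, ?_, ?_⟩
    · exact (congrArg _ hz0).trans (ContinuousLinearEquiv.symm_apply_apply _ v)
    · exact congrArg _ hz1

end ParallelTransport

/-! ### Transport along short segments -/

section ParallelFrames

open Set Filter Topology

variable {E : Type*} [NormedAddCommGroup E] [NormedSpace ℝ E] [FiniteDimensional ℝ E]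

/-- The invertible fundamental solution of a linear differential equation. -/
theorem exists_fundamental_solution {A : ℝ → E →L[ℝ] E} (hA : ContinuousOn A (Icc (-2) 2))
    (hb : ∀ t ∈ Icc (-2 : ℝ) 2, ‖A t‖ ≤ 1 / 8) :
    ∃ U : ℝ → E →L[ℝ] E, U 0 = 1 ∧ ∀ t ∈ Ioo (-2 : ℝ) 2, HasDerivAt U (-(A t * U t)) t ∧
      ∃ e : E ≃L[ℝ] E, (e : E →L[ℝ] E) = U t := by
  have : CompleteSpace E := FiniteDimensional.complete ℝ E
  let l := ContinuousLinearMap.mul ℝ (E →L[ℝ] E)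
  have hl : ‖l‖ ≤ 1 := ContinuousLinearMap.opNorm_mul_le ℝ _
  have hlf : ‖l.flip‖ ≤ 1 := (ContinuousLinearMap.opNorm_flip l).trans_le hl
  obtain ⟨U, hU0, hU⟩ := exists_linear_ode_solution (A := fun t => -(l (A t)))
    (l.continuous.comp_continuousOn hA).neg (fun t ht => by
      rw [norm_neg]
      exact (l.le_of_opNorm_le hl _).trans (by rw [one_mul]; exact hb t ht)) 1
  -- `W` solves the adjoint equation `W' = W A`. Then `W U` is constant and equal to `1`, which
  -- makes `U` injective and hence invertible.
  obtain ⟨W, hW0, hW⟩ := exists_linear_ode_solution (A := fun t => l.flip (A t))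
    (l.flip.continuous.comp_continuousOn hA) (fun t ht =>
      (l.flip.le_of_opNorm_le hlf _).trans (by rw [one_mul]; exact hb t ht)) 1
  have hprod : ∀ t ∈ Ioo (-2 : ℝ) 2, HasDerivAt (fun t => W t * U t) 0 t := fun t ht => by
    refine ((hW t ht).mul (hU t ht)).congr_deriv ?_
    change (W t * A t) * U t + W t * -(A t * U t) = 0
    rw [mul_neg, mul_assoc, add_neg_cancel]
  have hWU : ∀ t ∈ Ioo (-2 : ℝ) 2, W t * U t = 1 := fun t ht => by
    have h := isOpen_Ioo.is_const_of_deriv_eq_zero (isPreconnected_Ioo)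
      (fun t ht => (hprod t ht).differentiableAt.differentiableWithinAt)
      (fun t ht => (hprod t ht).deriv) ht (show (0 : ℝ) ∈ Ioo (-2 : ℝ) 2 by norm_num)
    simpa [hU0, hW0] using h
  refine ⟨U, hU0, fun t ht => ⟨hU t ht, ?_⟩⟩
  have hinj : Function.Injective (U t) := Function.LeftInverse.injective (g := W t) fun z =>
    congrArg (fun L : E →L[ℝ] E => L z) (hWU t ht)
  refine ⟨(LinearEquiv.ofInjectiveEndo (U t : E →ₗ[ℝ] E) hinj).toContinuousLinearEquiv, ?_⟩
  ext z
  rfl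

variable {M : Type*} [TopologicalSpace M] [ChartedSpace E M] [IsManifold 𝓘(ℝ, E) ∞ M]
  {cov : CovariantDerivative 𝓘(ℝ, E) E (TangentSpace 𝓘(ℝ, E) : M → Type _)} {a : M}

/-- Parallel transport along short segments in a chart. -/
theorem exists_isParallelTransport_segment [T2Space M]
    (hcov : cov.ContMDiffCovariantDerivative ∞) {p v : E}
    (hseg : ∀ t ∈ Icc (-2 : ℝ) 2, p + t • v ∈ (extChartAt 𝓘(ℝ, E) a).target)
    (hb : ∀ t ∈ Icc (-2 : ℝ) 2, ‖chartConnection cov a (p + t • v) v‖ ≤ 1 / 8) :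
    ∃ U : ℝ → E →L[ℝ] E, U 0 = 1 ∧ HasDerivAt U (-(chartConnection cov a p v)) 0 ∧
      ∀ s ∈ Icc (-1 : ℝ) 1, ∃ A : E ≃L[ℝ] E, (A : E →L[ℝ] E) = U s ∧
        IsParallelTransport cov ((extChartAt 𝓘(ℝ, E) a).symm p)
          ((extChartAt 𝓘(ℝ, E) a).symm (p + s • v))
          ((tangentChart (E := E) a ((extChartAt 𝓘(ℝ, E) a).symm p)).trans
            (A.trans (tangentChart (E := E) a ((extChartAt 𝓘(ℝ, E) a).symm (p + s • v))).symm)) := by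
  have hcont : ContinuousOn (fun t : ℝ => chartConnection cov a (p + t • v) v) (Icc (-2) 2) := by
    have h1 : ContinuousOn (fun t : ℝ => chartConnection cov a (p + t • v)) (Icc (-2) 2) :=
      (contDiffOn_chartConnection hcov a).continuousOn.comp (by fun_prop) hseg
    exact h1.clm_apply continuousOn_const
  obtain ⟨U, hU0, hU⟩ := exists_fundamental_solution hcont hb
  refine ⟨U, hU0, ?_, fun s hs => ?_⟩
  · have h := (hU 0 (by norm_num)).1
    simpa [hU0] using h
  · obtain ⟨A, hA⟩ := (hU s ⟨by linarith [hs.1], by linarith [hs.2]⟩).2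
    refine ⟨A, hA, ?_⟩
    -- Transport is defined by curves that are smooth on all of `ℝ`. The reparametrized segment
    -- stays in the chart for all times, and runs from `p` at time `0` to `p + s • v` at time `1`.
    have hθ : ∀ t, s * Real.smoothTransition t ∈ Icc (-1 : ℝ) 1 := fun t => by
      have h0 := Real.smoothTransition.nonneg t
      have h1 := Real.smoothTransition.le_one t
      have := abs_le.2 hs
      refine abs_le.1 ?_
      rw [abs_mul, abs_of_nonneg h0]
      nlinarith [abs_nonneg s]
    have hθs : ContDiff ℝ ∞ (fun t => s * Real.smoothTransition t) :=
      contDiff_const.mul Real.smoothTransition.contDiff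
    have hd : ∀ t, HasDerivAt (fun t => p + (s * Real.smoothTransition t) • v)
        (deriv (fun t => s * Real.smoothTransition t) t • v) t := fun t =>
      (((hθs.differentiable (by simp) t).hasDerivAt).smul_const v).const_add p
    refine isParallelTransport_chart (c := fun t => p + (s * Real.smoothTransition t) • v)
      (contDiff_const.add (hθs.smul contDiff_const))
      (fun t => hseg _ ⟨by linarith [(hθ t).1], by linarith [(hθ t).2]⟩) (by simp) (by simp) A
      fun z₀ => ⟨fun t => U (s * Real.smoothTransition t) z₀, by simp [hU0], ?_, fun t => ?_⟩
    · simp [← hA]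
    · have h1 : HasDerivAt (fun r => U r z₀)
          (-(chartConnection cov a (p + (s * Real.smoothTransition t) • v) v
            (U (s * Real.smoothTransition t) z₀))) (s * Real.smoothTransition t) :=
        ((ContinuousLinearMap.apply ℝ E z₀).hasFDerivAt.comp_hasDerivAt _
          (hU (s * Real.smoothTransition t)
            ⟨by linarith [(hθ t).1], by linarith [(hθ t).2]⟩).1).congr_deriv rfl
      have h2 : HasDerivAt (fun t => U (s * Real.smoothTransition t) z₀) _ t :=
        HasDerivAt.scomp (h := fun t => s * Real.smoothTransition t) t h1
          (hθs.differentiable (by simp) t).hasDerivAt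
      refine h2.congr_deriv ?_
      rw [(hd t).deriv, map_smul, smul_apply, smul_neg]

theorem exists_short_segments [T2Space M] (hcov : cov.ContMDiffCovariantDerivative ∞) {p : E}
    (hp : p ∈ (extChartAt 𝓘(ℝ, E) a).target) :
    ∃ r > 0, ∀ v : E, ‖v‖ ≤ r → ∀ t ∈ Icc (-2 : ℝ) 2,
      p + t • v ∈ (extChartAt 𝓘(ℝ, E) a).target ∧
        ‖chartConnection cov a (p + t • v) v‖ ≤ 1 / 8 := by
  have hΩ : IsOpen (extChartAt 𝓘(ℝ, E) a).target := isOpen_extChartAt_target a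
  have hc := ((contDiffOn_chartConnection hcov a).continuousOn.continuousAt (hΩ.mem_nhds hp)).norm
  have h1 := hc.eventually (gt_mem_nhds (lt_add_one ‖chartConnection cov a p‖))
  obtain ⟨ε, hε, hball⟩ := Metric.eventually_nhds_iff_ball.1 (h1.and (hΩ.mem_nhds hp))
  set C := ‖chartConnection cov a p‖ + 1 with hC
  have hC0 : 0 < C := by positivity
  -- Here `ε/3` keeps `p + t • v` in the ball for `|t| ≤ 2`, and `1/(8C)` gives the bound `1/8`
  -- required by the existence theorem for the linear equation.
  refine ⟨min (ε / 3) (1 / (8 * C)), by positivity, fun v hv t ht => ?_⟩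
  have hmem : p + t • v ∈ Metric.ball p ε := by
    rw [mem_ball_iff_norm, add_sub_cancel_left, norm_smul, Real.norm_eq_abs]
    have := abs_le.2 ht
    have h3 := hv.trans (min_le_left _ _)
    nlinarith [norm_nonneg v]
  refine ⟨(hball _ hmem).2, (ContinuousLinearMap.le_opNorm _ _).trans ?_⟩
  have h3 := hv.trans (min_le_right _ _)
  calc _ ≤ C * (1 / (8 * C)) := mul_le_mul (hball _ hmem).1.le h3 (norm_nonneg _) hC0.le
    _ = 1 / 8 := by field_simp

end ParallelFrames

/-! ### Adapted frames and holonomy -/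

section AdaptedFrames

open Set Filter Topology

variable {E : Type*} [NormedAddCommGroup E] [NormedSpace ℝ E] [FiniteDimensional ℝ E]
  {M : Type*} [TopologicalSpace M] [ChartedSpace E M] [IsManifold 𝓘(ℝ, E) ∞ M] [T2Space M]
  {cov : CovariantDerivative 𝓘(ℝ, E) E (TangentSpace 𝓘(ℝ, E) : M → Type _)} {m : ℕ}

theorem eventually_exists_isParallelTransport (hcov : cov.ContMDiffCovariantDerivative ∞) (a : M) :
    ∀ᶠ y in 𝓝 a, ∃ P, IsParallelTransport cov a y P := by
  obtain ⟨r, hr, h⟩ := exists_short_segments hcov (mem_extChartAt_target (I := 𝓘(ℝ, E)) a)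
  have h1 : ∀ᶠ y in 𝓝 a, extChartAt 𝓘(ℝ, E) a y ∈ Metric.closedBall (extChartAt 𝓘(ℝ, E) a a) r :=
    (continuousAt_extChartAt a).eventually (Metric.closedBall_mem_nhds _ hr)
  filter_upwards [h1, extChartAt_source_mem_nhds (I := 𝓘(ℝ, E)) a] with y hy hys
  have h2 := h (extChartAt 𝓘(ℝ, E) a y - extChartAt 𝓘(ℝ, E) a a) (by
    rwa [mem_closedBall_iff_norm] at hy)
  obtain ⟨U, -, -, hU⟩ := exists_isParallelTransport_segment hcov (fun t ht => (h2 t ht).1)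
    (fun t ht => (h2 t ht).2)
  obtain ⟨A, -, hA⟩ := hU 1 (by norm_num)
  have e1 : (extChartAt 𝓘(ℝ, E) a).symm (extChartAt 𝓘(ℝ, E) a a) = a := extChartAt_to_inv a
  have e2 : (extChartAt 𝓘(ℝ, E) a).symm (extChartAt 𝓘(ℝ, E) a a
      + (1 : ℝ) • (extChartAt 𝓘(ℝ, E) a y - extChartAt 𝓘(ℝ, E) a a)) = y := by
    rw [one_smul, add_sub_cancel]
    exact (extChartAt 𝓘(ℝ, E) a).left_inv hys
  have h3 : ∃ P, IsParallelTransport cov ((extChartAt 𝓘(ℝ, E) a).symm (extChartAt 𝓘(ℝ, E) a a))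
    ((extChartAt 𝓘(ℝ, E) a).symm (extChartAt 𝓘(ℝ, E) a a
      + (1 : ℝ) • (extChartAt 𝓘(ℝ, E) a y - extChartAt 𝓘(ℝ, E) a a))) P := ⟨_, hA⟩
  rwa [e1, e2] at h3

/-- The points that can be reached from `x` form an open and closed set, by transport along short
segments and its inverse. Hence the default value in `adaptedFrame` never occurs. -/
theorem exists_isParallelTransport [ConnectedSpace M]
    (hcov : cov.ContMDiffCovariantDerivative ∞) (x y : M) :
    ∃ P, IsParallelTransport cov x y P := by
  have hclopen : IsClopen {y : M | ∃ P, IsParallelTransport cov x y P} := by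
    refine ⟨⟨isOpen_iff_mem_nhds.2 fun b hb => ?_⟩, isOpen_iff_mem_nhds.2 fun b hb => ?_⟩
    · filter_upwards [eventually_exists_isParallelTransport hcov b] with c hc
      rintro ⟨P, hP⟩
      obtain ⟨Q, hQ⟩ := hc
      exact hb ⟨_, hP.trans hQ.symm⟩
    · filter_upwards [eventually_exists_isParallelTransport hcov b] with c hc
      obtain ⟨P, hP⟩ := hb
      obtain ⟨Q, hQ⟩ := hc
      exact ⟨_, hP.trans hQ⟩
  have h := hclopen.eq_univ ⟨x, (eventually_exists_isParallelTransport hcov x).self_of_nhds⟩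
  exact h.ge (mem_univ y)

theorem adaptedFrame_eq [ConnectedSpace M] (hcov : cov.ContMDiffCovariantDerivative ∞) (x₀ : M)
    (u : TangentSpace 𝓘(ℝ, E) x₀ ≃L[ℝ] C2 m) (x : M) :
    ∃ P, IsParallelTransport cov x₀ x P ∧ adaptedFrame cov x₀ u x = P.symm.trans u := by
  have h := exists_isParallelTransport hcov x₀ x
  exact ⟨h.choose, h.choose_spec, dif_pos h⟩

/-- Adapted frames are unique up to `U*(2m)`. -/
theorem adaptedFrame_transport [ConnectedSpace M] (hcov : cov.ContMDiffCovariantDerivative ∞)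
    {x₀ : M} {u : TangentSpace 𝓘(ℝ, E) x₀ ≃L[ℝ] C2 m} (hhol : HolonomyInUStar cov x₀ u)
    {x y : M} {Q : TangentSpace 𝓘(ℝ, E) x ≃L[ℝ] TangentSpace 𝓘(ℝ, E) y}
    (hQ : IsParallelTransport cov x y Q) :
    ∃ B ∈ UStar m, ∀ ξ, adaptedFrame cov x₀ u y (Q ξ) = B.mulVec (adaptedFrame cov x₀ u x ξ) := by
  obtain ⟨P, hP, eP⟩ := adaptedFrame_eq hcov x₀ u x
  obtain ⟨R, hR, eR⟩ := adaptedFrame_eq hcov x₀ u y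
  -- The loop goes from `x₀` to `x` by the curve chosen for `x`, on to `y` by `Q`, and back by the
  -- curve chosen for `y`.
  obtain ⟨B, hB, h⟩ := hhol _ ((hP.trans hQ).trans hR.symm)
  refine ⟨B, hB, fun ξ => ?_⟩
  have h1 := h (P.symm ξ)
  rw [eP, eR]
  refine Eq.trans ?_ h1
  change u (R.symm (Q ξ)) = u (R.symm (Q (P (P.symm ξ))))
  rw [P.apply_symm_apply]

/-- The adapted frames in the chart at `a`. -/
def chartFrame (cov : CovariantDerivative 𝓘(ℝ, E) E (TangentSpace 𝓘(ℝ, E) : M → Type _)) (x₀ : M)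
    (u : TangentSpace 𝓘(ℝ, E) x₀ ≃L[ℝ] C2 m) (a : M) (p : E) : E ≃L[ℝ] C2 m :=
  (tangentChart (E := E) a ((extChartAt 𝓘(ℝ, E) a).symm p)).symm.trans
    (adaptedFrame cov x₀ u ((extChartAt 𝓘(ℝ, E) a).symm p))

theorem isUStarParallel_chartFrame [ConnectedSpace M]
    (hcov : cov.ContMDiffCovariantDerivative ∞)
    {x₀ : M} {u : TangentSpace 𝓘(ℝ, E) x₀ ≃L[ℝ] C2 m} (hhol : HolonomyInUStar cov x₀ u) (a : M) :
    IsUStarParallel (chartConnection cov a) (chartFrame cov x₀ u a)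
      (extChartAt 𝓘(ℝ, E) a).target := by
  intro p hp v
  obtain ⟨r, hr, h⟩ := exists_short_segments hcov hp
  -- Only short vectors are covered by the transport lemma; `v` is rescaled by `δ` and time by
  -- `δ⁻¹`.
  set δ := r / (‖v‖ + 1) with hδdef
  have hδ : 0 < δ := by positivity
  have h2 := h (δ • v) (by
    rw [norm_smul, Real.norm_of_nonneg hδ.le, hδdef, div_mul_eq_mul_div,
      div_le_iff₀ (by positivity)]
    nlinarith [norm_nonneg v])
  obtain ⟨U, hU0, hU', hU⟩ := exists_isParallelTransport_segment hcov (fun t ht => (h2 t ht).1)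
    (fun t ht => (h2 t ht).2)
  refine ⟨fun s => U (s * δ⁻¹), by simp [hU0], ?_, ?_⟩
  · have h3 : HasDerivAt (fun s : ℝ => s * δ⁻¹) δ⁻¹ 0 := by
      simpa using (hasDerivAt_id (0 : ℝ)).mul_const δ⁻¹
    have h4 : HasDerivAt U (-(chartConnection cov a p (δ • v))) ((0 : ℝ) * δ⁻¹) := by
      rwa [zero_mul]
    refine (HasDerivAt.scomp (h := fun s : ℝ => s * δ⁻¹) 0 h4 h3).congr_deriv ?_
    rw [map_smul, smul_neg, smul_smul, inv_mul_cancel₀ hδ.ne', one_smul]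
  · have h3 : ∀ᶠ s : ℝ in 𝓝 0, s * δ⁻¹ ∈ Icc (-1 : ℝ) 1 := by
      have : ContinuousAt (fun s : ℝ => s * δ⁻¹) 0 := by fun_prop
      refine this.eventually (Icc_mem_nhds ?_ ?_) <;> simp
    filter_upwards [h3] with s hs
    obtain ⟨A, hA, hT⟩ := hU _ hs
    obtain ⟨B, hB, hrel⟩ := adaptedFrame_transport hcov hhol hT
    refine ⟨B, hB, fun z => ?_⟩
    have e : p + (s * δ⁻¹) • δ • v = p + s • v := by
      rw [smul_smul, inv_mul_cancel_right₀ hδ.ne']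
    have h5 := hrel ((tangentChart (E := E) a ((extChartAt 𝓘(ℝ, E) a).symm p)).symm z)
    have h6 : ∀ q, q = p + s • v → adaptedFrame cov x₀ u ((extChartAt 𝓘(ℝ, E) a).symm q)
        ((tangentChart (E := E) a ((extChartAt 𝓘(ℝ, E) a).symm q)).symm (A z))
        = chartFrame cov x₀ u a (p + s • v) (A z) := by
      rintro q rfl
      rfl
    refine Eq.trans ?_ h5
    change _ = adaptedFrame cov x₀ u _ ((tangentChart (E := E) a _).symm
      (A ((tangentChart (E := E) a _) ((tangentChart (E := E) a _).symm z))))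
    rw [ContinuousLinearEquiv.apply_symm_apply, h6 _ e, ← hA]
    rfl

theorem isUStarGeometry_chart [ConnectedSpace M]
    (hcov : cov.ContMDiffCovariantDerivative ∞) (htor : cov.torsion = 0)
    {x₀ : M} {u : TangentSpace 𝓘(ℝ, E) x₀ ≃L[ℝ] C2 m} (hhol : HolonomyInUStar cov x₀ u) (a : M) :
    IsUStarGeometry (chartConnection cov a) (chartFrame cov x₀ u a)
      (extChartAt 𝓘(ℝ, E) a).target where
  isOpen := isOpen_extChartAt_target a
  smooth := contDiffOn_chartConnection hcov a
  symm := fun _ hp X Y => chartConnection_symm htor hp X Y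
  parallel := isUStarParallel_chartFrame hcov hhol a

end AdaptedFrames

/-! ### Holomorphic sections in a gauge -/

section SectionsInCharts

open Set Filter Topology

variable {E : Type*} [NormedAddCommGroup E] [NormedSpace ℝ E]
  {M : Type*} [TopologicalSpace M] [ChartedSpace E M] [IsManifold 𝓘(ℝ, E) ∞ M] {m : ℕ}

theorem chart_symm_mem_preimage {M : Type*} [TopologicalSpace M] [ChartedSpace E M] {a : M}
    {Ω : Set E} {p : E} (hΩt : Ω ⊆ (extChartAt 𝓘(ℝ, E) a).target) (hp : p ∈ Ω) :
    (extChartAt 𝓘(ℝ, E) a).symm p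
      ∈ (extChartAt 𝓘(ℝ, E) a).source ∩ extChartAt 𝓘(ℝ, E) a ⁻¹' Ω :=
  ⟨(extChartAt 𝓘(ℝ, E) a).map_target (hΩt hp), by
    rwa [mem_preimage, (extChartAt 𝓘(ℝ, E) a).right_inv (hΩt hp)]⟩

/-- The complex frame of the tangent bundle defined by a gauge in the chart at `a`. -/
def gaugeField (a : M) (L : E → E →L[ℝ] E) (w₀ : E ≃L[ℝ] C2 m) (j : Fin m ⊕ Fin m) (y : M) :
    TangentSpace 𝓘(ℝ, E) y :=
  (tangentChart (E := E) a y).symm (L (extChartAt 𝓘(ℝ, E) a y) (w₀.symm (Pi.single j 1)))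

theorem coordField_gaugeField {a : M} (L : E → E →L[ℝ] E) (w₀ : E ≃L[ℝ] C2 m)
    (j : Fin m ⊕ Fin m) {p : E} (hp : p ∈ (extChartAt 𝓘(ℝ, E) a).target) :
    coordField a (gaugeField a L w₀ j) p = L p (w₀.symm (Pi.single j 1)) := by
  refine ((tangentChart (E := E) a _).apply_symm_apply _).trans ?_
  rw [(extChartAt 𝓘(ℝ, E) a).right_inv hp]

variable {cov : CovariantDerivative 𝓘(ℝ, E) E (TangentSpace 𝓘(ℝ, E) : M → Type _)}
  {x₀ : M} {u : TangentSpace 𝓘(ℝ, E) x₀ ≃L[ℝ] C2 m} {a : M}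
  {w₀ : E ≃L[ℝ] C2 m} {L K : E → E →L[ℝ] E} {Ω : Set E} {N : ℤ}
  {s : ∀ x : M, (Fin m ⊕ Fin m → TangentSpace 𝓘(ℝ, E) x) → ℂ}

theorem tangentChart_complexStructure (p : E)
    (ξ : TangentSpace 𝓘(ℝ, E) ((extChartAt 𝓘(ℝ, E) a).symm p)) :
    tangentChart (E := E) a ((extChartAt 𝓘(ℝ, E) a).symm p)
        (complexStructure cov x₀ u ((extChartAt 𝓘(ℝ, E) a).symm p) ξ)
      = frameI (chartFrame cov x₀ u a p)
        (tangentChart (E := E) a ((extChartAt 𝓘(ℝ, E) a).symm p) ξ) := by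
  set T := tangentChart (E := E) a ((extChartAt 𝓘(ℝ, E) a).symm p)
  set f := adaptedFrame cov x₀ u ((extChartAt 𝓘(ℝ, E) a).symm p)
  change T (f.symm (mulI m (f ξ))) = T (f.symm (mulI m (f (T.symm (T ξ)))))
  rw [T.symm_apply_apply]

theorem IsComplexGauge.exists_frame
    (hg : IsComplexGauge (chartFrame cov x₀ u a) w₀ L K Ω)
    (hΩt : Ω ⊆ (extChartAt 𝓘(ℝ, E) a).target) {p : E} (hp : p ∈ Ω) :
    ∃ w' : TangentSpace 𝓘(ℝ, E) ((extChartAt 𝓘(ℝ, E) a).symm p) ≃L[ℝ] C2 m,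
      (∀ z, w'.symm z
        = (tangentChart (E := E) a ((extChartAt 𝓘(ℝ, E) a).symm p)).symm (L p (w₀.symm z))) ∧
      (∀ k, w'.symm (Pi.single k 1) = gaugeField a L w₀ k ((extChartAt 𝓘(ℝ, E) a).symm p)) ∧
      frameI w' = complexStructure cov x₀ u ((extChartAt 𝓘(ℝ, E) a).symm p) := by
  let e : E ≃L[ℝ] E := ContinuousLinearEquiv.equivOfInverse (K p) (L p)
    (fun z => congrArg (fun A : E →L[ℝ] E => A z) (hg.mul_inv p hp))
    (fun z => congrArg (fun A : E →L[ℝ] E => A z) (hg.inv_mul p hp))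
  set T := tangentChart (E := E) a ((extChartAt 𝓘(ℝ, E) a).symm p) with hT
  refine ⟨T.trans (e.trans w₀), fun z => rfl, fun k => ?_, ?_⟩
  · refine T.injective ?_
    refine Eq.trans ?_ (coordField_gaugeField L w₀ k (hΩt hp)).symm
    exact T.apply_symm_apply _
  · ext ξ
    refine T.injective ?_
    rw [tangentChart_complexStructure]
    have h1 := congrArg (fun A : E →L[ℝ] E => A (K p (T ξ))) (hg.comm p hp)
    have h2 := congrArg (fun A : E →L[ℝ] E => A (T ξ)) (hg.mul_inv p hp)
    change L p (K p (T ξ)) = T ξ at h2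
    change L p (frameI w₀ (K p (T ξ))) = frameI _ (L p (K p (T ξ))) at h1
    rw [h2] at h1
    refine Eq.trans ?_ h1
    exact T.apply_symm_apply _

theorem IsComplexGauge.isSmoothComplexFrameOn
    (hg : IsComplexGauge (chartFrame cov x₀ u a) w₀ L K Ω) (hΩ : IsOpen Ω)
    (hΩt : Ω ⊆ (extChartAt 𝓘(ℝ, E) a).target) :
    IsSmoothComplexFrameOn (complexStructure cov x₀ u) (gaugeField a L w₀)
      ((extChartAt 𝓘(ℝ, E) a).source ∩ extChartAt 𝓘(ℝ, E) a ⁻¹' Ω) where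
  isOpen := (continuousOn_extChartAt a).isOpen_inter_preimage (isOpen_extChartAt_source a) hΩ
  smooth := by
    rintro k y ⟨hy, hyΩ⟩
    obtain ⟨p, hp, rfl⟩ : ∃ p ∈ Ω, (extChartAt 𝓘(ℝ, E) a).symm p = y :=
      ⟨_, hyΩ, (extChartAt 𝓘(ℝ, E) a).left_inv hy⟩
    refine ((contMDiffAt_iff_coordField (hΩt hp)).2 ?_).contMDiffWithinAt
    have h1 : ContDiffAt ℝ ∞ (fun q => L q (w₀.symm (Pi.single k 1))) p :=
      (hg.smooth.contDiffAt (hΩ.mem_nhds hp)).clm_apply contDiffAt_const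
    refine h1.congr_of_eventuallyEq ?_
    filter_upwards [hΩ.mem_nhds hp] with q hq
    exact coordField_gaugeField L w₀ k (hΩt hq)
  frame := by
    rintro y ⟨hy, hyΩ⟩
    obtain ⟨p, hp, rfl⟩ : ∃ p ∈ Ω, (extChartAt 𝓘(ℝ, E) a).symm p = y :=
      ⟨_, hyΩ, (extChartAt 𝓘(ℝ, E) a).left_inv hy⟩
    obtain ⟨w', -, h1, h2⟩ := hg.exists_frame hΩt hp
    have h3 := isComplexFrame_frame w'
    rw [h2] at h3
    simpa only [h1] using h3

/-- The local function representing a section in a gauge. -/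
def localSection (s : ∀ x : M, (Fin m ⊕ Fin m → TangentSpace 𝓘(ℝ, E) x) → ℂ) (a : M)
    (L : E → E →L[ℝ] E) (w₀ : E ≃L[ℝ] C2 m) (p : E) : ℂ :=
  s ((extChartAt 𝓘(ℝ, E) a).symm p)
    (fun k => gaugeField a L w₀ k ((extChartAt 𝓘(ℝ, E) a).symm p))

theorem IsHolomorphicSection.contDiffOn_localSection
    (hs : IsHolomorphicSection (complexStructure cov x₀ u) N s)
    (hg : IsComplexGauge (chartFrame cov x₀ u a) w₀ L K Ω) (hΩ : IsOpen Ω)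
    (hΩt : Ω ⊆ (extChartAt 𝓘(ℝ, E) a).target) :
    ContDiffOn ℝ ∞ (localSection s a L w₀) Ω := by
  intro p hp
  have hY := hg.isSmoothComplexFrameOn hΩ hΩt
  have h1 := (hs.smooth _ _ hY).contMDiffAt
    (hY.isOpen.mem_nhds (chart_symm_mem_preimage hΩt hp))
  exact ((contMDiffAt_comp_chart_symm_iff (hΩt hp)).1 h1).contDiffWithinAt

/-- The norm of a section of `K^N` in the adapted frames. -/
def sectionNorm (cov : CovariantDerivative 𝓘(ℝ, E) E (TangentSpace 𝓘(ℝ, E) : M → Type _)) (x₀ : M)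
    (u : TangentSpace 𝓘(ℝ, E) x₀ ≃L[ℝ] C2 m)
    (s : ∀ x : M, (Fin m ⊕ Fin m → TangentSpace 𝓘(ℝ, E) x) → ℂ) (y : M) : ℝ :=
  ‖s y (fun k => (adaptedFrame cov x₀ u y).symm (Pi.single k 1))‖

/-- The gauge frame and the adapted frame define the same complex structure, so the values of `s` on
them differ by the `N`-th power of a complex determinant. Its squared modulus is the real
determinant of the change of frame, which factors into the density and `det L`. -/
theorem IsHolomorphicSection.norm_localSection_sq
    (hs : IsHolomorphicSection (complexStructure cov x₀ u) N s)
    (hg : IsComplexGauge (chartFrame cov x₀ u a) w₀ L K Ω)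
    (hΩt : Ω ⊆ (extChartAt 𝓘(ℝ, E) a).target) {p : E} (hp : p ∈ Ω) :
    ‖localSection s a L w₀ p‖ ^ 2
      = (frameDensity w₀ (chartFrame cov x₀ u a p) * |(L p).det|) ^ N
        * sectionNorm cov x₀ u s ((extChartAt 𝓘(ℝ, E) a).symm p) ^ 2 := by
  obtain ⟨w', hw', hwk, hI⟩ := hg.exists_frame hΩt hp
  set f := adaptedFrame cov x₀ u ((extChartAt 𝓘(ℝ, E) a).symm p) with hf
  have hIf : frameI f = frameI w' := hI.symm
  have h1 := hs.equivariant ((extChartAt 𝓘(ℝ, E) a).symm p) (fun k => f.symm (Pi.single k 1))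
    (frameChange f w') (isComplexFrame_frame f) (by
      rw [show complexStructure cov x₀ u ((extChartAt 𝓘(ℝ, E) a).symm p) = frameI f from rfl,
        complexComb_frameChange, hIf]
      exact isComplexFrame_frame w')
  rw [show complexStructure cov x₀ u ((extChartAt 𝓘(ℝ, E) a).symm p) = frameI f from rfl,
    complexComb_frameChange] at h1
  simp only [hwk] at h1
  have hdet : ‖(frameChange f w').det‖ ^ 2
      = frameDensity w₀ (chartFrame cov x₀ u a p) * |(L p).det| := by
    have h2 := norm_det_frameChange_sq hIf
    have h3 : LinearMap.det ((w'.symm.trans f : C2 m ≃L[ℝ] C2 m) : C2 m →ₗ[ℝ] C2 m)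
        = ((w₀.symm : C2 m →L[ℝ] E) ∘L (chartFrame cov x₀ u a p : E →L[ℝ] C2 m)).det
          * (L p).det := by
      rw [← LinearMap.det_conj _ w₀.symm.toLinearEquiv]
      change _ = LinearMap.det _ * LinearMap.det _
      rw [← map_mul]
      congr 1
      ext z
      change w₀.symm (f (w'.symm (w₀ z))) = _
      rw [hw', w₀.symm_apply_apply]
      rfl
    rw [← abs_of_nonneg (sq_nonneg ‖(frameChange f w').det‖), h2, h3, abs_mul]
    rfl
  change ‖s _ _‖ ^ 2 = _ * ‖s _ _‖ ^ 2
  rw [h1, norm_mul, norm_zpow, mul_pow, ← hdet]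
  congr 1
  exact (zpow_natCast _ 2).symm.trans ((zpow_comm _ N 2).trans
    (congrArg (· ^ N) (zpow_natCast _ 2)))

variable [FiniteDimensional ℝ E]

/-- Without torsion and with `∇I = 0`, the operator `½([X,Y] + I[IX,Y])` equals `½(∇_X Y + I ∇_{IX}
Y)`, as the derivatives of the fields along `Y` cancel. So in the gauge `∂̄` is given by the
corresponding combination of the connection form. -/
theorem dbarField_gaugeField
    (h : IsUStarGeometry (chartConnection cov a) (chartFrame cov x₀ u a) Ω)
    (hg : IsComplexGauge (chartFrame cov x₀ u a) w₀ L K Ω)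
    (hΩt : Ω ⊆ (extChartAt 𝓘(ℝ, E) a).target) {p : E} (hp : p ∈ Ω) (x : E) (j : Fin m ⊕ Fin m) :
    tangentChart (E := E) a ((extChartAt 𝓘(ℝ, E) a).symm p)
      (dbarField (complexStructure cov x₀ u) (coordConst a x) (gaugeField a L w₀ j)
        ((extChartAt 𝓘(ℝ, E) a).symm p))
      = (2⁻¹ : ℝ) • L p ((gaugeForm (chartConnection cov a) L K p x
        + frameI w₀ * gaugeForm (chartConnection cov a) L K p
          (frameI (chartFrame cov x₀ u a p) x)) (w₀.symm (Pi.single j 1))) := by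
  set Γ := chartConnection cov a
  set w := chartFrame cov x₀ u a
  set ε := w₀.symm (Pi.single j 1)
  have hL := hg.hasFDerivAt h.isOpen hp
  have hLε : HasFDerivAt (fun q => L q ε) ((fderiv ℝ L p).flip ε) p :=
    (hL.clm_apply (hasFDerivAt_const ε p)).congr_fderiv (by ext; simp)
  have hY : HasFDerivAt (coordField a (gaugeField a L w₀ j)) ((fderiv ℝ L p).flip ε) p := by
    refine hLε.congr_of_eventuallyEq ?_
    filter_upwards [h.isOpen.mem_nhds hp] with q hq
    exact coordField_gaugeField L w₀ j (hΩt hq)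
  obtain ⟨D, hD, hD'⟩ := h.exists_hasFDerivAt_frameI hp
  have hX : coordField a (coordConst a x) = fun _ => x := coordField_coordConst a x
  have hJX : coordField a (fun y => complexStructure cov x₀ u y (coordConst a x y))
      = fun q => frameI (w q) x := funext fun q => by
    refine (tangentChart_complexStructure q _).trans (congrArg _ ?_)
    exact congrFun (coordField_coordConst a x) q
  have hIx : HasFDerivAt (fun q => frameI (w q) x) (D.flip x) p :=
    (hD.clm_apply (hasFDerivAt_const x p)).congr_fderiv (by ext; simp)
  have hYp := coordField_gaugeField (a := a) L w₀ j (hΩt hp)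
  have e1 := coordField_mlieBracket (hΩt hp) (X := coordConst a x) (Y := gaugeField a L w₀ j)
    (by rw [hX]; exact differentiableAt_const _) hY.differentiableAt
  have e2 := coordField_mlieBracket (hΩt hp)
    (X := fun y => complexStructure cov x₀ u y (coordConst a x y)) (Y := gaugeField a L w₀ j)
    (by rw [hJX]; exact hIx.differentiableAt) hY.differentiableAt
  rw [hX, hY.fderiv, fderiv_const_apply] at e1
  rw [hJX, hY.fderiv, hIx.fderiv, hYp] at e2
  set T := tangentChart (E := E) a ((extChartAt 𝓘(ℝ, E) a).symm p)
  have e3 : ∀ A B : TangentSpace 𝓘(ℝ, E) ((extChartAt 𝓘(ℝ, E) a).symm p),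
      T ((2⁻¹ : ℝ) • (A + complexStructure cov x₀ u _ B))
        = (2⁻¹ : ℝ) • (T A + frameI (w p) (T B)) := fun A B => by
    rw [map_smul, map_add, tangentChart_complexStructure]
  refine (e3 _ _).trans (congrArg _ ?_)
  change coordField a _ p + frameI (w p) (coordField a _ p) = _
  rw [e1, e2]
  have hLK : ∀ z, L p (K p z) = z := fun z =>
    congrArg (fun A : E →L[ℝ] E => A z) (hg.mul_inv p hp)
  have hLI : ∀ z, L p (frameI w₀ z) = frameI (w p) (L p z) := fun z =>
    congrArg (fun A : E →L[ℝ] E => A z) (hg.comm p hp)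
  simp only [gaugeForm_apply, add_apply, mul_apply_eq_comp, map_add, hLI, hLK,
    ContinuousLinearMap.flip_apply, zero_apply, sub_zero, hD', sub_apply, map_sub,
    frameI_frameI]
  rw [h.symm p hp (L p ε) x, h.symm p hp (L p ε) (frameI (w p) x)]
  module

/-- The Cauchy–Riemann equation of a holomorphic section, in a gauge. -/
theorem IsHolomorphicSection.fderiv_localSection
    (hs : IsHolomorphicSection (complexStructure cov x₀ u) N s)
    (h : IsUStarGeometry (chartConnection cov a) (chartFrame cov x₀ u a) Ω)
    (hg : IsComplexGauge (chartFrame cov x₀ u a) w₀ L K Ω)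
    (hΩt : Ω ⊆ (extChartAt 𝓘(ℝ, E) a).target) {p : E} (hp : p ∈ Ω) (x : E) :
    fderiv ℝ (localSection s a L w₀) p x
        + Complex.I * fderiv ℝ (localSection s a L w₀) p (frameI (chartFrame cov x₀ u a p) x)
      = N * (complexTrace w₀ (gaugeForm (chartConnection cov a) L K p x : E →ₗ[ℝ] E)
        + Complex.I * complexTrace w₀ (gaugeForm (chartConnection cov a) L K p
          (frameI (chartFrame cov x₀ u a p) x) : E →ₗ[ℝ] E)) * localSection s a L w₀ p := by
  have hY := hg.isSmoothComplexFrameOn h.isOpen hΩt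
  have hmem := chart_symm_mem_preimage hΩt hp
  obtain ⟨w', hw', hwk, hI⟩ := hg.exists_frame hΩt hp
  set T := tangentChart (E := E) a ((extChartAt 𝓘(ℝ, E) a).symm p) with hT
  set w := chartFrame cov x₀ u a
  set G : E →L[ℝ] E := gaugeForm (chartConnection cov a) L K p x
    + frameI w₀ * gaugeForm (chartConnection cov a) L K p (frameI (w p) x) with hG
  let B : Matrix (Fin m ⊕ Fin m) (Fin m ⊕ Fin m) ℂ :=
    Matrix.of fun i j => (2⁻¹ : ℂ) * w₀ (G (w₀.symm (Pi.single j 1))) i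
  have hX : ContMDiffOn 𝓘(ℝ, E) (𝓘(ℝ, E).prod 𝓘(ℝ, E)) ∞
      (fun y => (⟨y, coordConst a x y⟩ : TangentBundle 𝓘(ℝ, E) M))
      ((extChartAt 𝓘(ℝ, E) a).source ∩ extChartAt 𝓘(ℝ, E) a ⁻¹' Ω) := by
    rintro y ⟨hy, hyΩ⟩
    obtain ⟨q, hq, rfl⟩ : ∃ q ∈ Ω, (extChartAt 𝓘(ℝ, E) a).symm q = y :=
      ⟨_, hyΩ, (extChartAt 𝓘(ℝ, E) a).left_inv hy⟩
    refine ((contMDiffAt_iff_coordField (hΩt hq)).2 ?_).contMDiffWithinAt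
    rw [coordField_coordConst]
    exact contDiffAt_const
  have hB : ∀ j, dbarField (complexStructure cov x₀ u) (coordConst a x) (gaugeField a L w₀ j)
      ((extChartAt 𝓘(ℝ, E) a).symm p) = complexComb (complexStructure cov x₀ u _)
        (fun k => gaugeField a L w₀ k ((extChartAt 𝓘(ℝ, E) a).symm p)) B j := fun j => by
    rw [← hI]
    simp only [← hwk]
    rw [complexComb_frame, hw']
    refine T.injective ?_
    rw [T.apply_symm_apply]
    refine (dbarField_gaugeField h hg hΩt hp x j).trans ?_
    rw [← map_smul]
    refine congrArg (L p) (w₀.injective ?_)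
    rw [map_smul, w₀.apply_symm_apply]
    funext i
    change (2⁻¹ : ℝ) • w₀ (G (w₀.symm (Pi.single j 1))) i
      = (2⁻¹ : ℂ) * w₀ (G (w₀.symm (Pi.single j 1))) i
    rw [Complex.real_smul, Complex.ofReal_inv, Complex.ofReal_ofNat]
  have h1 := hs.dbar_eq_zero _ _ hY (coordConst a x) hX _ hmem B hB
  have hd := ((hs.smooth _ _ hY).contMDiffAt (hY.isOpen.mem_nhds hmem)).mdifferentiableAt
    (by simp)
  unfold dbarFun at h1
  rw [fderiv_comp_chart_symm (hΩt hp) hd, fderiv_comp_chart_symm (hΩt hp) hd,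
    tangentChart_complexStructure] at h1
  have hTx : T (coordConst a x ((extChartAt 𝓘(ℝ, E) a).symm p)) = x := T.apply_symm_apply x
  rw [hTx] at h1
  have hBtr : B.trace = 2⁻¹ * (complexTrace w₀
      (gaugeForm (chartConnection cov a) L K p x : E →ₗ[ℝ] E)
        + Complex.I * complexTrace w₀ (gaugeForm (chartConnection cov a) L K p
          (frameI (chartFrame cov x₀ u a p) x) : E →ₗ[ℝ] E)) := by
    simp only [complexTrace, Matrix.trace, Finset.mul_sum, ← Finset.sum_add_distrib]
    refine Finset.sum_congr rfl fun k _ => ?_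
    simp [B, hG, w]
  rw [hBtr] at h1
  change 2⁻¹ * (fderiv ℝ (localSection s a L w₀) p x
    + Complex.I * fderiv ℝ (localSection s a L w₀) p (frameI (w p) x)) = _ at h1
  change _ = (N : ℂ) * _ * localSection s a L w₀ p at h1
  linear_combination 2 * h1

end SectionsInCharts

/-! ### The norm of a section on the manifold -/

section GlobalMaximumPrinciple

open Set Filter Topology

variable {m : ℕ} {E : Type*} [NormedAddCommGroup E] [NormedSpace ℝ E] [FiniteDimensional ℝ E]
  {M : Type*} [TopologicalSpace M] [ChartedSpace E M] [IsManifold 𝓘(ℝ, E) ∞ M] [T2Space M]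
  {cov : CovariantDerivative 𝓘(ℝ, E) E (TangentSpace 𝓘(ℝ, E) : M → Type _)}
  {x₀ : M} {u : TangentSpace 𝓘(ℝ, E) x₀ ≃L[ℝ] C2 m} {a : M}

theorem chartFrame_curvature (hcov : cov.ContMDiffCovariantDerivative ∞) {p : E}
    (hp : p ∈ (extChartAt 𝓘(ℝ, E) a).target)
    (X Y Z : TangentSpace 𝓘(ℝ, E) ((extChartAt 𝓘(ℝ, E) a).symm p)) :
    adaptedFrame cov x₀ u ((extChartAt 𝓘(ℝ, E) a).symm p) (curvature cov _ X Y Z)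
      = chartFrame cov x₀ u a p (connCurvature (chartConnection cov a) p
        (tangentChart (E := E) a _ X) (tangentChart (E := E) a _ Y)
        (tangentChart (E := E) a _ Z)) := by
  rw [← tangentChart_curvature hcov hp X Y Z]
  exact congrArg _ ((tangentChart (E := E) a _).symm_apply_apply _).symm

/-- The Ricci form is the complex trace of the curvature in a chart. -/
theorem ricciForm_eq_complexTrace (hcov : cov.ContMDiffCovariantDerivative ∞) {p : E}
    (hp : p ∈ (extChartAt 𝓘(ℝ, E) a).target)
    (X Y : TangentSpace 𝓘(ℝ, E) ((extChartAt 𝓘(ℝ, E) a).symm p)) :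
    ricciForm cov x₀ u ((extChartAt 𝓘(ℝ, E) a).symm p) X Y
      = Complex.I * complexTrace (chartFrame cov x₀ u a p)
        (connCurvature (chartConnection cov a) p (tangentChart (E := E) a _ X)
          (tangentChart (E := E) a _ Y) : E →ₗ[ℝ] E) := by
  refine congrArg (Complex.I * ·) (Finset.sum_congr rfl fun k _ => ?_)
  exact congrFun (chartFrame_curvature hcov hp X Y _) k

theorem scalarCurvature_eq_sum_ricciTrace (hcov : cov.ContMDiffCovariantDerivative ∞) {p : E}
    (hp : p ∈ (extChartAt 𝓘(ℝ, E) a).target) :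
    scalarCurvature cov x₀ u ((extChartAt 𝓘(ℝ, E) a).symm p)
      = ∑ q : (Fin m ⊕ Fin m) × Fin 2, ricciTrace (connCurvatureTensor (chartConnection cov a) p)
        ((chartFrame cov x₀ u a p).symm (Pi.single q.1 ((![1, Complex.I] : Fin 2 → ℂ) q.2)))
        ((chartFrame cov x₀ u a p).symm (Pi.single q.1 ((![1, Complex.I] : Fin 2 → ℂ) q.2))) := by
  rw [← sum_ricciTrace_frame]
  refine Finset.sum_congr rfl fun i _ => Finset.sum_congr rfl fun j _ => ?_
  refine congrArg (fun z : C2 m => (starRingEnd ℂ ((![1, Complex.I] : Fin 2 → ℂ) i.2)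
    * z i.1).re) ?_
  exact chartFrame_curvature hcov hp _ _ _

variable {N : ℤ} {s : ∀ x : M, (Fin m ⊕ Fin m → TangentSpace 𝓘(ℝ, E) x) → ℂ}

theorem exists_sectionNorm_ne_zero {E : Type*} [NormedAddCommGroup E] [NormedSpace ℝ E]
    {M : Type*} [TopologicalSpace M] [ChartedSpace E M] [IsManifold 𝓘(ℝ, E) ∞ M]
    {cov : CovariantDerivative 𝓘(ℝ, E) E (TangentSpace 𝓘(ℝ, E) : M → Type _)}
    {x₀ : M} {u : TangentSpace 𝓘(ℝ, E) x₀ ≃L[ℝ] C2 m} {N : ℤ}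
    {s : ∀ x : M, (Fin m ⊕ Fin m → TangentSpace 𝓘(ℝ, E) x) → ℂ}
    (hs : IsHolomorphicSection (complexStructure cov x₀ u) N s) (h0 : s ≠ 0) :
    ∃ y, sectionNorm cov x₀ u s y ≠ 0 := by
  by_contra! hcon
  refine h0 (funext fun x => funext fun v => ?_)
  by_cases hv : IsComplexFrame (complexStructure cov x₀ u x) v
  · set f := adaptedFrame cov x₀ u x with hf
    have h1 : complexComb (complexStructure cov x₀ u x) (fun k => f.symm (Pi.single k 1))
        (Matrix.of fun i j => f (v j) i) = v := funext fun j =>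
      (complexComb_frame f _ j).trans (f.symm_apply_apply (v j))
    have h2 := hs.equivariant x (fun k => f.symm (Pi.single k 1)) (Matrix.of fun i j => f (v j) i)
      (isComplexFrame_frame f) (by rwa [h1])
    rw [h1, norm_eq_zero.1 (hcon x), mul_zero] at h2
    exact h2
  · exact hs.off_frames x v hv

theorem IsComplexGauge.density_pos {E : Type*} [NormedAddCommGroup E] [NormedSpace ℝ E]
    {w : E → E ≃L[ℝ] C2 m} {w₀ : E ≃L[ℝ] C2 m} {L K : E → E →L[ℝ] E}
    {Ω : Set E} (hg : IsComplexGauge w w₀ L K Ω) {p : E} (hp : p ∈ Ω) :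
    0 < frameDensity w₀ (w p) * |(L p).det| := by
  refine mul_pos (frameDensity_pos _ _) (abs_pos.2 fun h => ?_)
  have h1 : (L p * K p).det = (L p).det * (K p).det := map_mul LinearMap.det _ _
  rw [hg.mul_inv p hp, h, zero_mul] at h1
  exact one_ne_zero ((map_one LinearMap.det).symm.trans h1)

variable [ConnectedSpace M]

/-- The adapted frames need not be continuous, but by `norm_localSection_sq` the norm is an
expression in the local section, the density and the gauge, which are. -/
theorem continuous_sectionNorm (hcov : cov.ContMDiffCovariantDerivative ∞)
    (htor : cov.torsion = 0) (hhol : HolonomyInUStar cov x₀ u)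
    (hs : IsHolomorphicSection (complexStructure cov x₀ u) N s) :
    Continuous (sectionNorm cov x₀ u s) := by
  refine continuous_iff_continuousAt.2 fun a => ?_
  have hgeo := isUStarGeometry_chart hcov htor hhol a
  obtain ⟨L, K, Ω, hΩt, hΩ, haΩ, hg⟩ := hgeo.exists_isComplexGauge
    (mem_extChartAt_target (I := 𝓘(ℝ, E)) a)
  set w₀ := chartFrame cov x₀ u a (extChartAt 𝓘(ℝ, E) a a)
  have hmem := hΩ.mem_nhds haΩ
  have c1 : ContinuousAt (fun p => √(‖localSection s a L w₀ p‖ ^ 2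
      * ((frameDensity w₀ (chartFrame cov x₀ u a p) * |(L p).det|) ^ N)⁻¹))
      (extChartAt 𝓘(ℝ, E) a a) := by
    have d1 := ((hs.contDiffOn_localSection hg hΩ hΩt).continuousOn.continuousAt hmem)
    have d2 := (((hgeo.mono hΩ hΩt).contDiffOn_frameDensity w₀).continuousOn.continuousAt hmem)
    have d3 := ContinuousLinearMap.continuous_det.continuousAt.comp
      (hg.smooth.continuousOn.continuousAt hmem)
    have hpos := hg.density_pos haΩ
    exact ((d1.norm.pow 2).mul (((d2.mul d3.abs).zpow₀ N (Or.inl hpos.ne')).inv₀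
      (zpow_pos hpos N).ne')).sqrt
  refine (c1.comp (continuousAt_extChartAt a)).congr ?_
  filter_upwards [extChartAt_source_mem_nhds (I := 𝓘(ℝ, E)) a,
    (continuousAt_extChartAt a).eventually hmem] with y hy hyΩ
  have hpos := hg.density_pos hyΩ
  simp only [Function.comp_apply]
  rw [hs.norm_localSection_sq hg hΩt hyΩ, (extChartAt 𝓘(ℝ, E) a).left_inv hy,
    mul_right_comm, mul_inv_cancel₀ (zpow_pos hpos N).ne', one_mul]
  exact Real.sqrt_sq (norm_nonneg _)

/-- Shrinking the gauge neighbourhood to where the local section does not vanish makes the logarithm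
legitimate. There the local potential is the logarithm of a function on `M` that does not depend on
the gauge. -/
theorem exists_gauge_sectionPotential (hcov : cov.ContMDiffCovariantDerivative ∞)
    (htor : cov.torsion = 0) (hhol : HolonomyInUStar cov x₀ u)
    (hs : IsHolomorphicSection (complexStructure cov x₀ u) N s) {a : M}
    (ha : sectionNorm cov x₀ u s a ≠ 0) :
    ∃ L K Ω, extChartAt 𝓘(ℝ, E) a a ∈ Ω ∧ Ω ⊆ (extChartAt 𝓘(ℝ, E) a).target ∧
      IsUStarGeometry (chartConnection cov a) (chartFrame cov x₀ u a) Ω ∧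
      IsComplexGauge (chartFrame cov x₀ u a)
        (chartFrame cov x₀ u a (extChartAt 𝓘(ℝ, E) a a)) L K Ω ∧
      ∀ p ∈ Ω, localSection s a L (chartFrame cov x₀ u a (extChartAt 𝓘(ℝ, E) a a)) p ≠ 0 ∧
        sectionPotential N (localSection s a L (chartFrame cov x₀ u a (extChartAt 𝓘(ℝ, E) a a)))
          (chartFrame cov x₀ u a) (chartFrame cov x₀ u a (extChartAt 𝓘(ℝ, E) a a)) L p
          = Real.log (sectionNorm cov x₀ u s ((extChartAt 𝓘(ℝ, E) a).symm p) ^ 2) := by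
  have hgeo := isUStarGeometry_chart hcov htor hhol a
  obtain ⟨L, K, Ω, hΩt, hΩ, haΩ, hg⟩ := hgeo.exists_isComplexGauge
    (mem_extChartAt_target (I := 𝓘(ℝ, E)) a)
  set w₀ := chartFrame cov x₀ u a (extChartAt 𝓘(ℝ, E) a a)
  have hσ := hs.contDiffOn_localSection hg hΩ hΩt
  have hΩ' : IsOpen (Ω ∩ localSection s a L w₀ ⁻¹' {0}ᶜ) :=
    hσ.continuousOn.isOpen_inter_preimage hΩ isOpen_compl_singleton
  refine ⟨L, K, Ω ∩ localSection s a L w₀ ⁻¹' {0}ᶜ, ⟨haΩ, fun h0 => ?_⟩,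
    inter_subset_left.trans hΩt, hgeo.mono hΩ' (inter_subset_left.trans hΩt),
    hg.mono inter_subset_left, fun p hp => ⟨hp.2, ?_⟩⟩
  · have h1 := hs.norm_localSection_sq hg hΩt haΩ
    rw [extChartAt_to_inv, mem_singleton_iff.1 h0, norm_zero, zero_pow two_ne_zero] at h1
    exact mul_ne_zero (zpow_pos (hg.density_pos haΩ) N).ne' (pow_ne_zero 2 ha) h1.symm
  · have h1 := hs.norm_localSection_sq hg hΩt hp.1
    have hpos := hg.density_pos hp.1
    have hne : sectionNorm cov x₀ u s ((extChartAt 𝓘(ℝ, E) a).symm p) ^ 2 ≠ 0 := fun h0 => by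
      rw [h0, mul_zero] at h1
      exact hp.2 (norm_eq_zero.1 (pow_eq_zero_iff two_ne_zero |>.1 h1))
    rw [sectionPotential, h1, Real.log_mul (zpow_pos hpos N).ne' hne, Real.log_zpow,
      Real.log_mul (frameDensity_pos _ _).ne' (abs_pos.1 (pos_of_mul_pos_right hpos
        (frameDensity_pos _ _).le) |> abs_ne_zero.2), Real.log_abs]
    ring

end GlobalMaximumPrinciple

/-! ### Constancy of the norm and vanishing of the Ricci form -/

section Vanishing

open Set Filter Topology

variable {m : ℕ} {E : Type*} [NormedAddCommGroup E] [InnerProductSpace ℝ E]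
  [FiniteDimensional ℝ E] [Nontrivial E]
  {M : Type*} [TopologicalSpace M] [ChartedSpace E M] [IsManifold 𝓘(ℝ, E) ∞ M] [T2Space M]
  [ConnectedSpace M]
  {cov : CovariantDerivative 𝓘(ℝ, E) E (TangentSpace 𝓘(ℝ, E) : M → Type _)}
  {x₀ : M} {u : TangentSpace 𝓘(ℝ, E) x₀ ≃L[ℝ] C2 m}
  {N : ℤ} {s : ∀ x : M, (Fin m ⊕ Fin m → TangentSpace 𝓘(ℝ, E) x) → ℂ}

/-- The strong maximum principle for the norm of a holomorphic section. -/
theorem sectionNorm_eventually_eq (hcov : cov.ContMDiffCovariantDerivative ∞)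
    (htor : cov.torsion = 0) (hhol : HolonomyInUStar cov x₀ u)
    (hscal : m = 1 → ∀ x, scalarCurvature cov x₀ u x = 0)
    (hs : IsHolomorphicSection (complexStructure cov x₀ u) N s) {a : M}
    (ha : sectionNorm cov x₀ u s a ≠ 0)
    (hmax : ∀ y, sectionNorm cov x₀ u s y ≤ sectionNorm cov x₀ u s a) :
    ∀ᶠ y in 𝓝 a, sectionNorm cov x₀ u s y = sectionNorm cov x₀ u s a := by
  obtain ⟨L, K, Ω, haΩ, hΩt, hgeo, hg, hpot⟩ := exists_gauge_sectionPotential hcov htor hhol hs ha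
  have hne : ∀ p ∈ Ω, sectionNorm cov x₀ u s ((extChartAt 𝓘(ℝ, E) a).symm p) ≠ 0 := fun p hp h0 => by
    have h1 := hs.norm_localSection_sq hg hΩt hp
    rw [h0, zero_pow two_ne_zero, mul_zero] at h1
    exact (hpot p hp).1 (norm_eq_zero.1 (pow_eq_zero_iff two_ne_zero |>.1 h1))
  have h1 := hgeo.sectionPotential_eventually_eq (fun p hp => hgeo.ricciTrace_average hp fun hm => by
      rw [← scalarCurvature_eq_sum_ricciTrace hcov (hΩt hp)]
      exact hscal hm _) hg
    (hs.contDiffOn_localSection hg hgeo.isOpen hΩt) (fun p hp => (hpot p hp).1)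
    (fun p hp => hs.fderiv_localSection hgeo hg hΩt hp) haΩ (fun p hp => by
      rw [(hpot p hp).2, (hpot _ haΩ).2, extChartAt_to_inv]
      exact Real.log_le_log (pow_pos ((norm_nonneg _).lt_of_ne' (hne p hp)) 2)
        (pow_le_pow_left₀ (norm_nonneg _) (hmax _) 2))
  filter_upwards [(continuousAt_extChartAt a).eventually h1,
    (continuousAt_extChartAt a).eventually (hgeo.isOpen.mem_nhds haΩ),
    extChartAt_source_mem_nhds (I := 𝓘(ℝ, E)) a] with y hy hyΩ hys
  rw [(hpot _ hyΩ).2, (hpot _ haΩ).2, extChartAt_to_inv,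
    (extChartAt 𝓘(ℝ, E) a).left_inv hys] at hy
  have hney := hne _ hyΩ
  rw [(extChartAt 𝓘(ℝ, E) a).left_inv hys] at hney
  have h3 := Real.log_injOn_pos (mem_Ioi.2 (pow_pos ((norm_nonneg _).lt_of_ne' hney) 2))
    (mem_Ioi.2 (pow_pos ((norm_nonneg _).lt_of_ne' ha) 2)) hy
  exact (pow_left_inj₀ (norm_nonneg _) (norm_nonneg _) two_ne_zero).1 h3

/-- A nonzero holomorphic section of a power of the canonical bundle has constant norm. -/
theorem sectionNorm_eq [CompactSpace M] (hcov : cov.ContMDiffCovariantDerivative ∞)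
    (htor : cov.torsion = 0) (hhol : HolonomyInUStar cov x₀ u)
    (hscal : m = 1 → ∀ x, scalarCurvature cov x₀ u x = 0)
    (hs : IsHolomorphicSection (complexStructure cov x₀ u) N s) (h0 : s ≠ 0) :
    ∃ C ≠ 0, ∀ y, sectionNorm cov x₀ u s y = C := by
  have hcont := continuous_sectionNorm hcov htor hhol hs
  obtain ⟨b, -, hb⟩ := isCompact_univ.exists_isMaxOn univ_nonempty hcont.continuousOn
  have hb : ∀ y, sectionNorm cov x₀ u s y ≤ sectionNorm cov x₀ u s b := fun y => hb (mem_univ y)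
  obtain ⟨y₀, hy₀⟩ := exists_sectionNorm_ne_zero hs h0
  have hpos : 0 < sectionNorm cov x₀ u s b :=
    ((norm_nonneg _).lt_of_ne' hy₀).trans_le (hb y₀)
  refine ⟨_, hpos.ne', fun y => ?_⟩
  have hclopen : IsClopen {y | sectionNorm cov x₀ u s y = sectionNorm cov x₀ u s b} := by
    refine ⟨isClosed_eq hcont continuous_const, isOpen_iff_mem_nhds.2 fun c hc => ?_⟩
    have hc : sectionNorm cov x₀ u s c = sectionNorm cov x₀ u s b := hc
    filter_upwards [sectionNorm_eventually_eq hcov htor hhol hscal hs (a := c)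
      (by rw [hc]; exact hpos.ne') (by rw [hc]; exact hb)] with y hy
    exact hy.trans hc
  exact (hclopen.eq_univ ⟨b, rfl⟩).ge (mem_univ y)

/-- As the norm is a nonzero constant, the potential is constant near every point, which gives `tr(I
R) = 0`. Together with `tr R = 0` this kills the imaginary and the real part of the complex trace.
-/
theorem ricciForm_eq_zero [CompactSpace M] (hcov : cov.ContMDiffCovariantDerivative ∞)
    (htor : cov.torsion = 0) (hhol : HolonomyInUStar cov x₀ u)
    (hscal : m = 1 → ∀ x, scalarCurvature cov x₀ u x = 0)
    (hs : IsHolomorphicSection (complexStructure cov x₀ u) N s) (h0 : s ≠ 0) (hN : N ≠ 0)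
    (x : M) (X Y : TangentSpace 𝓘(ℝ, E) x) : ricciForm cov x₀ u x X Y = 0 := by
  obtain ⟨C, hC, hconst⟩ := sectionNorm_eq hcov htor hhol hscal hs h0
  obtain ⟨L, K, Ω, hxΩ, hΩt, hgeo, hg, hpot⟩ := exists_gauge_sectionPotential hcov htor hhol hs
    (a := x) (by rw [hconst]; exact hC)
  have htr := hgeo.trace_frameI_mul_curvature_eq_zero hg
    (hs.contDiffOn_localSection hg hgeo.isOpen hΩt) (fun p hp => (hpot p hp).1)
    (fun p hp => hs.fderiv_localSection hgeo hg hΩt hp) hN hxΩ (by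
      filter_upwards [hgeo.isOpen.mem_nhds hxΩ] with p hp
      rw [(hpot p hp).2, (hpot _ hxΩ).2, hconst, hconst])
  -- The point `x` equals its chart image carried back only propositionally; quantifying over `y`
  -- transports the dependent vectors.
  have h1 : ∀ y, y = (extChartAt 𝓘(ℝ, E) x).symm (extChartAt 𝓘(ℝ, E) x x) →
      ∀ X Y : TangentSpace 𝓘(ℝ, E) y, ricciForm cov x₀ u y X Y = 0 := by
    rintro y rfl X Y
    rw [ricciForm_eq_complexTrace hcov (hΩt hxΩ)]
    set R := connCurvature (chartConnection cov x) (extChartAt 𝓘(ℝ, E) x x)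
      (tangentChart (E := E) x _ X) (tangentChart (E := E) x _ Y) with hR
    have hcomm : ∀ z, R (frameI (chartFrame cov x₀ u x (extChartAt 𝓘(ℝ, E) x x)) z)
        = frameI (chartFrame cov x₀ u x (extChartAt 𝓘(ℝ, E) x x)) (R z) := fun z =>
      congrArg (fun A : E →L[ℝ] E => A z) (hgeo.curvature_comm_frameI hxΩ _ _)
    have hre := two_mul_re_complexTrace _ (R : E →ₗ[ℝ] E) hcomm
    have him := two_mul_im_complexTrace _ (R : E →ₗ[ℝ] E) hcomm
    have e1 : LinearMap.trace ℝ E (R : E →ₗ[ℝ] E) = 0 := hgeo.trace_curvature hxΩ _ _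
    have e2 : LinearMap.trace ℝ E ((frameI (chartFrame cov x₀ u x (extChartAt 𝓘(ℝ, E) x x)) :
      E →ₗ[ℝ] E) ∘ₗ (R : E →ₗ[ℝ] E)) = 0 := htr _ _
    rw [e1] at hre
    rw [e2] at him
    have h3 : complexTrace (chartFrame cov x₀ u x (extChartAt 𝓘(ℝ, E) x x)) (R : E →ₗ[ℝ] E) = 0 :=
      Complex.ext (by simpa using hre) (by simpa using him)
    rw [h3, mul_zero]
  exact h1 x (extChartAt_to_inv x).symm X Y

end Vanishing

end

theorem mainTheorem1 (m : ℕ) {M : Type*} [TopologicalSpace M] [T2Space M] [CompactSpace M]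
    [ConnectedSpace M] [ChartedSpace (EuclideanSpace ℝ (Fin (4 * m))) M]
    [IsManifold (𝓡 (4 * m)) ∞ M]
    (cov : CovariantDerivative (𝓡 (4 * m)) (EuclideanSpace ℝ (Fin (4 * m)))
      (TangentSpace (𝓡 (4 * m)) : M → Type _))
    (hsmooth : cov.ContMDiffCovariantDerivative ∞)
    (htorsion : cov.torsion = 0)
    (x₀ : M) (u : TangentSpace (𝓡 (4 * m)) x₀ ≃L[ℝ] C2 m)
    (hhol : HolonomyInUStar cov x₀ u)
    (hscal : m = 1 → ∀ x, scalarCurvature cov x₀ u x = 0) :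
    (∀ x X Y, ricciForm cov x₀ u x X Y = 0) ∨
      ∀ N : ℤ, N ≠ 0 → plurigenus m (complexStructure cov x₀ u) N = 0 := by
  by_cases hm : m = 0
  · subst hm
    exact Or.inl fun x X Y => by simp [ricciForm]
  have : Nonempty (Fin (4 * m)) := ⟨⟨0, by omega⟩⟩
  have : Nontrivial (EuclideanSpace ℝ (Fin (4 * m))) := inferInstance
  by_contra! hcon
  obtain ⟨⟨x, X, Y, hXY⟩, N, hN, hrank⟩ := hcon
  refine hrank ?_
  have hbot : holomorphicSections m (complexStructure cov x₀ u) N = ⊥ := by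
    refine (Submodule.eq_bot_iff _).2 fun s hs => ?_
    by_contra h0
    exact hXY (ricciForm_eq_zero hsmooth htorsion hhol hscal hs h0 hN x X Y)
  rw [plurigenus, hbot, rank_bot]
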